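/- **Setting.** Let $d\ge 1$, $T\ge 0$, $\mathcal X=[0,1)^d$ and let $\lambda_k$ be the Lebesgue measure on $[0,1)^k$. Let $m_0$ be a probability measure on $\mathcal X$, and for $t\ge 1$ let $m_t(x',\mathrm dx)=m_t(x',x)\,\lambda_d(\mathrm dx)$ be Markov kernels on $\mathcal X$ with measurable, strictly positive densities. Let $G_0:\mathcal X\to[0,\infty)$ and $G_t:\mathcal X^2\to[0,\infty)$ ($t\ge1$) be measurable. Let $(x_t)$ be the Markov chain with initial law $m_0$ and transitions $m_t$, let $Z_t=\mathbb E[G_0(x_0)\prod_{s=1}^tG_s(x_{s-1},x_s)]$, let $\widetilde{\mathbb Q}_t$ be the smoothing distribution on $\mathcal X^{t+1}$, $\widetilde{\mathbb Q}_t(\varphi)=Z_t^{-1}\mathbb E[\varphi(x_{0:t})G_0(x_0)\prod_{s=1}^tG_s(x_{s-1},x_s)]$, and let $\mathbb Q_t$ be its last marginal (the law of $x_t$). For a probability measure $\pi$ on $\mathcal X$ put $$\mathcal M_{t,\pi}(x_t,\mathrm dx_{t-1})=\widetilde G_{t,\pi}(x_{t-1},x_t)\,\pi(\mathrm dx_{t-1}),\qquad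 \widetilde G_{t,\pi}(x_{t-1},x_t)=\frac{m_t(x_{t-1},x_t)G_t(x_{t-1},x_t)}{\int m_t(y,x_t)G_t(y,x_t)\,\pi(\mathrm dy)},$$ and $\widetilde G_t=\widetilde G_{t,\mathbb Q_{t-1}}$. The Rosenblatt transform $F_\pi$ of $\pi$ has as $i$-th coordinate the conditional distribution function of $x_i$ given $x_{1:i-1}$ under $\pi$, evaluated at $x_i$; $F_{m_t}(x',\cdot)$ is that of $m_t(x',\cdot)$. Let $H:[0,1]\to[0,1]^d$ be a Hilbert space-filling curve with $H(0)=0$ (consecutive dyadic intervals of length $2^{-dm}$ are mapped into consecutive, face-adjacent, nested dyadic cubes of side $2^{-m}$), and $h:[0,1]^d\to[0,1]$ a measurable pseudo-inverse, $H\circ h=\mathrm{id}$. For a point set write $\mathcal S(x^{1:N})=N^{-1}\sum_n\delta_{x^n}$, and let $D(u^{1:N})=\sup_B|\mathcal S(u^{1:N})(B)-\lambda_k(B)|$, the supremum being over boxes $B=\prod_i[a_i,b_i]$ with $0\le a_i<b_i<1$. **Algorithm.** *Forward (SQMC), with input $u_0^{1:N}\subset[0,1)^d$ and $u_t^{1:N}=(u_t^n,v_t^n)_n\subset[0,1)^{d+1}$,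 $t=1,\dots,T$:* $x_0^n=F_{m_0}^{-1}(u_0^n)$ and $W_0^n\propto G_0(x_0^n)$. For $t\ge1$, let $\sigma_{t-1}$ sort the $h(x_{t-1}^n)$ increasingly, let $a^n$ be the least $i$ with $\sum_{j\le i}W_{t-1}^{\sigma_{t-1}(j)}\ge u_t^n$, and set $\hat x_{t-1}^n=x_{t-1}^{\sigma_{t-1}(a^n)}$, $x_t^n=F_{m_t}^{-1}(\hat x_{t-1}^n,v_t^n)$, $W_t^n\propto G_t(\hat x_{t-1}^n,x_t^n)$ (weights are normalised to sum to one). *Backward, with input $\tilde u^{1:N}\subset[0,1)^{T+1}$, $\tilde u^n=(\tilde u_0^n,\dots,\tilde u_T^n)$:* $\tilde x_T^n=x_T^{\sigma_T(i)}$ with $i$ the least index such that $\sum_{j\le i}W_T^{\sigma_T(j)}\ge\tilde u_T^n$; for $t=T-1,\dots,0$, $\tilde x_t^n=x_t^{\sigma_t(i)}$ with $i$ the least index such that $\sum_{j\le i}\widetilde W_t^{\sigma_t(j)}(\tilde x_{t+1}^n)\ge\tilde u_t^n$, where $\widetilde W_t^m(y)\propto W_t^m\,m_{t+1}(x_t^m,y)\,G_{t+1}(x_t^m,y)$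 is normalised over $m$. **Theorem.** Assume the following. 1. The $(u_t^{1:N})_{N\ge1}$, $t=0,\dots,T$, are independent random sequences of point sets, and for all $t$ and $\epsilon>0$ there is a (deterministic) $N_{\epsilon,t}$ such that, almost surely, $D(u_t^{1:N})\le\epsilon$ for all $N\ge N_{\epsilon,t}$. 2. $(\tilde u^{1:N})_{N\ge1}$ is a random sequence of point sets in $[0,1)^{T+1}$ (on the same probability space) such that (a) each $\tilde u^n$ is uniform on $[0,1)^{T+1}$; (b) there are a constant $C$ and a sequence $r(N)\to0$ such that for all $\psi\in L_2([0,1)^{T+1},\lambda_{T+1})$ and all $N\ge 1$, $\mathrm{Var}\big(\frac1N\sum_{n=1}^N\psi(\tilde u^n)\big)\le C\sigma_\psi^2r(N)$, where $\sigma_\psi^2=\int(\psi-\int\psi)^2$. 3. Almost surely, for all $N$ and $t\in\{0,\dots,T\}$ the particles $x_t^{1:N}$ are pairwise distinct. 4. For $t\in\{0,\dots,T\}$: $G_t$ is continuous and bounded; the $i$-th coordinate of $F_{m_t}(x',x)$ is strictly increasing in $x_i$ for all $i$; $F_{m_t}(x',x)$ is Hölder continuous in $(x',x)$; the conditional distributions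 of $x_i$ given $x_{1:i-1}$ under $m_t(x',\cdot)$ have Lebesgue densities bounded uniformly in all arguments (for $t=0$, $m_0$ in place of $m_t(x',\cdot)$); and $\mathbb Q_t$ has a strictly positive bounded density. 5. For $t\in\{1,\dots,T\}$: $\widetilde G_t$ is continuous and bounded on $\mathcal X^2$, and the Rosenblatt transform of $\mathcal M_{t,\mathbb Q_{t-1}}(x_t,\mathrm dx_{t-1})$ is Hölder continuous in $(x_t,x_{t-1})$ with $i$-th coordinate strictly increasing in the $i$-th coordinate of $x_{t-1}$. Then for every continuous and bounded $\varphi:\mathcal X^{T+1}\to\mathbb R$, the estimates $\mathcal S(\tilde x_{0:T}^{1:N})(\varphi)=\frac1N\sum_{n=1}^N\varphi(\tilde x_{0:T}^n)$ are square-integrable random variables, and as $N\to\infty$ $$\mathbb E\big|\mathcal S(\tilde x_{0:T}^{1:N})(\varphi)-\widetilde{\mathbb Q}_T(\varphi)\big|\to0,\qquad \mathrm{Var}\big(\mathcal S(\tilde x_{0:T}^{1:N})(\varphi)\big)\to0 .$$ -/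

import Mathlib

open MeasureTheory ProbabilityTheory Filter Topology
open scoped ENNReal NNReal

noncomputable section

namespace SQMC

/-! ### The unit cube, point sets and the extreme discrepancy -/

/-- The half-open unit cube `[0,1)^k`, with the sup metric and the product order. -/
abbrev Cube (k : ℕ) : Type := Fin k → Set.Ico (0 : ℝ) 1

/-- The Lebesgue measure on `[0,1)`. -/
def lebesgueIco : Measure (Set.Ico (0 : ℝ) 1) := Measure.comap Subtype.val volume

instance : IsProbabilityMeasure lebesgueIco := by
  constructor
  have h := (MeasurableEmbedding.subtype_coe (measurableSet_Ico (a := (0 : ℝ)) (b := 1))).comap_apply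
    (volume : Measure ℝ) Set.univ
  rw [lebesgueIco, h, Set.image_univ, Subtype.range_coe, Real.volume_Ico]
  simp

/-- The Lebesgue measure on `[0,1)^k`, i.e. the uniform distribution. -/
def lebesgue (k : ℕ) : Measure (Cube k) := Measure.pi fun _ => lebesgueIco

/-- The empirical measure `S(x^{1:N}) = N⁻¹ ∑ δ_{x^n}`. -/
def empirical {E : Type*} [MeasurableSpace E] {N : ℕ} (x : Fin N → E) : Measure E :=
  (N : ℝ≥0∞)⁻¹ • ∑ n, Measure.dirac (x n)

/-- The extreme norm: supremum of `|μ(B) - ν(B)|` over the boxes `B = ∏ [a_i, b_i]` with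
`0 ≤ a_i < b_i < 1`. -/
def extremeNorm {k : ℕ} (μ ν : Measure (Cube k)) : ℝ :=
  ⨆ B : {p : Cube k × Cube k // ∀ i, p.1 i < p.2 i},
    |μ.real (Set.Icc B.1.1 B.1.2) - ν.real (Set.Icc B.1.1 B.1.2)|

/-- The extreme discrepancy of a point set. -/
def discrepancy {k N : ℕ} (u : Fin N → Cube k) : ℝ :=
  extremeNorm (empirical u) (lebesgue k)

/-! ### The Hilbert curve -/

/-- `H : [0,1] → [0,1]^d` is a Hilbert space-filling curve started at the origin. At each level `m`
the dyadic interval `[k 2^{-dm}, (k+1) 2^{-dm}]` is sent into the dyadic cube with integer corner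
`c m k` and side `2^{-m}`; the map `k ↦ c m k` enumerates all the cubes of level `m`; consecutive
cubes share a face (adjacency); the cubes of level `m+1` that belong to the `2^d` subintervals of
the interval `k` of level `m` are subcubes of the cube `c m k` (nesting). For `d = 1` the only such
map is the identity. -/
def IsHilbertCurve {d : ℕ} (H : unitInterval → Fin d → unitInterval) : Prop :=
  H 0 = 0 ∧
  ∃ c : ℕ → ℕ → Fin d → ℕ,
    (∀ m, Set.BijOn (c m) (Set.Iio (2 ^ (d * m))) {a | ∀ i, a i < 2 ^ m}) ∧
    (∀ m k : ℕ, k + 1 < 2 ^ (d * m) →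
      ∃ j, (c m (k + 1) j = c m k j + 1 ∨ c m k j = c m (k + 1) j + 1) ∧
        ∀ i, i ≠ j → c m (k + 1) i = c m k i) ∧
    (∀ m k : ℕ, k < 2 ^ (d * m) → ∀ l : ℕ, l < 2 ^ d → ∀ i, c (m + 1) (2 ^ d * k + l) i / 2 = c m k i) ∧
    (∀ m k : ℕ, k < 2 ^ (d * m) → ∀ s : unitInterval,
      (k : ℝ) / 2 ^ (d * m) ≤ s → (s : ℝ) ≤ (k + 1) / 2 ^ (d * m) →
      ∀ i, (c m k i : ℝ) / 2 ^ m ≤ H s i ∧ (H s i : ℝ) ≤ (c m k i + 1) / 2 ^ m)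

/-- The inclusion of `[0,1)^d` in `[0,1]^d`. -/
def toClosedCube {d : ℕ} (x : Cube d) : Fin d → unitInterval :=
  fun i => ⟨x i, (x i).2.1, (x i).2.2.le⟩

/-! ### Rosenblatt transforms -/

/-- `F` is (a version of) the Rosenblatt transform of the distribution `π` on `[0,1)^d`: the
coordinate `F x i` depends only on `x_1, …, x_i`; it is, as a function of `x_i`, a distribution
function; and for every `c` the map `x ↦ F (x_1, …, x_{i-1}, c) i` is a version of the conditional
probability of `x_i ≤ c` given `(x_1, …, x_{i-1})` under `π`. -/
def IsRosenblatt {d : ℕ} (π : Measure (Cube d)) (F : Cube d → Fin d → ℝ) : Prop :=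
  ∀ i : Fin d,
    (∀ x y : Cube d, (∀ j ≤ i, x j = y j) → F x i = F y i) ∧
    (∀ x, 0 ≤ F x i ∧ F x i ≤ 1) ∧
    (∀ x : Cube d, Monotone fun c => F (Function.update x i c) i) ∧
    (∀ (x : Cube d) (c : Set.Ico (0 : ℝ) 1),
      ContinuousWithinAt (fun c => F (Function.update x i c) i) (Set.Ici c) c) ∧
    (∀ c, Measurable fun x => F (Function.update x i c) i) ∧
    ∀ (A : Set ({j : Fin d // j < i} → Set.Ico (0 : ℝ) 1)), MeasurableSet A →
      ∀ c : Set.Ico (0 : ℝ) 1,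
        ∫⁻ x in {x : Cube d | (fun j : {j : Fin d // j < i} => x j) ∈ A},
            ENNReal.ofReal (F (Function.update x i c) i) ∂π =
          π {x : Cube d | (fun j : {j : Fin d // j < i} => x j) ∈ A ∧ x i ≤ c}

open Classical in
/-- The inverse of a Rosenblatt transform that maps `[0,1)^d` bijectively to `[0,1)^d`. -/
def rosenblattInv {d : ℕ} (F : Cube d → Fin d → ℝ) (v : Cube d) : Cube d :=
  if hv : ∃ x : Cube d, ∀ i, F x i = v i then hv.choose else v

/-- The `i`-th coordinate of `F(x', x)` is strictly increasing in `x_i`. -/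
def CoordStrictMono {d : ℕ} (F : Cube d → Cube d → Fin d → ℝ) : Prop :=
  ∀ (i : Fin d) (x' x : Cube d), StrictMono fun c => F x' (Function.update x i c) i

/-- `F` is Hölder continuous as a function of both arguments. -/
def JointlyHolder {d : ℕ} (F : Cube d → Cube d → Fin d → ℝ) : Prop :=
  ∃ C r : ℝ≥0, 0 < r ∧ HolderWith C r fun p : Cube d × Cube d => F p.1 p.2

/-- The conditional distributions with distribution functions `c ↦ F(x', (x_1, …, x_{i-1}, c)) i`
have densities with respect to the Lebesgue measure, which are bounded uniformly in all
arguments. -/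
def BoundedCondDensities {d : ℕ} (F : Cube d → Cube d → Fin d → ℝ) : Prop :=
  ∀ i : Fin d, ∃ (p : Cube d → Cube d → ℝ) (C : ℝ),
    (∀ x' x, 0 ≤ p x' x ∧ p x' x ≤ C) ∧
    ∀ x' x : Cube d, (Measurable fun s => p x' (Function.update x i s)) ∧
      ∀ c : Set.Ico (0 : ℝ) 1,
        F x' (Function.update x i c) i = ∫ s in Set.Iic c, p x' (Function.update x i s) ∂lebesgueIco

/-! ### The Feynman-Kac model -/

/-- A Feynman-Kac model on `[0,1)^d`: an initial distribution `m0`, transition kernels `m t`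
(`t ≥ 1`) with strictly positive densities `dens t x_{t-1} x_t`, and non-negative potential
functions `G0` and `G t` (`t ≥ 1`). The values of `m`, `dens` and `G` at `t = 0` are not used. -/
structure Model (d : ℕ) where
  m0 : Measure (Cube d)
  prob_m0 : IsProbabilityMeasure m0
  m : ℕ → Kernel (Cube d) (Cube d)
  markov_m : ∀ t, IsMarkovKernel (m t)
  dens : ℕ → Cube d → Cube d → ℝ
  measurable_dens : ∀ t, Measurable fun p : Cube d × Cube d => dens t p.1 p.2
  dens_pos : ∀ t x' x, 0 < dens t x' x
  m_eq : ∀ t x', m t x' = (lebesgue d).withDensity fun x => ENNReal.ofReal (dens t x' x)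
  G0 : Cube d → ℝ
  measurable_G0 : Measurable G0
  G0_nonneg : ∀ x, 0 ≤ G0 x
  G : ℕ → Cube d → Cube d → ℝ
  measurable_G : ∀ t, Measurable fun p : Cube d × Cube d => G t p.1 p.2
  G_nonneg : ∀ t x' x, 0 ≤ G t x' x

namespace Model

variable {d : ℕ} (M : Model d)

/-- The law of the path `(x_0, …, x_t)` of the Markov chain. -/
def pathLaw : (t : ℕ) → Measure (Fin (t + 1) → Cube d)
  | 0 => M.m0.map fun x _ => x
  | t + 1 =>
      (pathLaw t ⊗ₘ (M.m (t + 1)).comap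
          (fun x : Fin (t + 1) → Cube d => x (Fin.last t)) (measurable_pi_apply _)).map
        fun p => (Fin.snoc p.1 p.2 : Fin (t + 2) → Cube d)

/-- `G_0(x_0) ∏_{s=1}^t G_s(x_{s-1}, x_s)`. -/
def pathWeight (t : ℕ) (x : Fin (t + 1) → Cube d) : ℝ :=
  M.G0 (x 0) * ∏ s : Fin t, M.G (s + 1) (x s.castSucc) (x s.succ)

/-- The normalising constant `Z_t`. -/
def Z (t : ℕ) : ℝ≥0∞ :=
  ∫⁻ x, ENNReal.ofReal (M.pathWeight t x) ∂M.pathLaw t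

/-- The smoothing distribution `Q̃_t` on `([0,1)^d)^{t+1}`. -/
def smooth (t : ℕ) : Measure (Fin (t + 1) → Cube d) :=
  (M.Z t)⁻¹ • (M.pathLaw t).withDensity fun x => ENNReal.ofReal (M.pathWeight t x)

/-- The filtering distribution `Q_t`, the law of `x_t` under `Q̃_t`. -/
def filt (t : ℕ) : Measure (Cube d) :=
  (M.smooth t).map fun x => x (Fin.last t)

/-- `G̃_t(x_{t-1}, x_t)`, relative to a distribution `π` of `x_{t-1}`. -/
def Gtilde (t : ℕ) (π : Measure (Cube d)) (x' x : Cube d) : ℝ :=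
  M.dens t x' x * M.G t x' x / ∫ y, M.dens t y x * M.G t y x ∂π

/-- The backward kernel `M_{t,π}(x_t, dx_{t-1}) = G̃_t(x_{t-1}, x_t) π(dx_{t-1})`. -/
def backKernel (t : ℕ) (π : Measure (Cube d)) (x : Cube d) : Measure (Cube d) :=
  π.withDensity fun x' => ENNReal.ofReal (M.Gtilde t π x' x)

end Model

/-! ### The algorithms -/

/-- Normalised weights. -/
def normalize {N : ℕ} (w : Fin N → ℝ) (n : Fin N) : ℝ := w n / ∑ m, w m

/-- The inverse distribution function of a probability vector `w`: the smallest index `i` with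
`u ≤ ∑_{m ≤ i} w m`. (The default value `n₀` only occurs if the total mass is less than `u`.) -/
def invIndex {N : ℕ} (w : Fin N → ℝ) (u : ℝ) (n₀ : Fin N) : Fin N :=
  if hne : (Finset.univ.filter fun i : Fin N => u ≤ ∑ m ∈ Finset.Iic i, w m).Nonempty
  then Finset.min' _ hne else n₀

/-- Resampling after sorting: sort the points `x` by the key `h` and return the point whose rank
is the inverse distribution function of the sorted weights at `u`. -/
def resample {d N : ℕ} (h : Cube d → ℝ) (x : Fin N → Cube d) (w : Fin N → ℝ) (u : ℝ)
    (n₀ : Fin N) : Cube d :=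
  let σ := Tuple.sort fun n => h (x n)
  x (σ (invIndex (fun i => w (σ i)) u n₀))

/-- Dimension of the point set used at time `t` of the forward pass. -/
def dimAt (d : ℕ) : ℕ → ℕ
  | 0 => d
  | _ + 1 => d + 1

/-- SQMC (forward pass): particles `x_t^{1:N}` and weights `W_t^{1:N}` as functions of the input
point sets `u`. Here `F0` and `F t` are the Rosenblatt transforms of `m_0` and `m_t`, and `h` is the
key of the Hilbert sort. -/
def forward {d N : ℕ} (M : Model d) (h : Cube d → ℝ) (F0 : Cube d → Fin d → ℝ)
    (F : ℕ → Cube d → Cube d → Fin d → ℝ) (u : (t : ℕ) → Fin N → Cube (dimAt d t)) :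
    ℕ → (Fin N → Cube d) × (Fin N → ℝ)
  | 0 =>
      let x : Fin N → Cube d := fun n => rosenblattInv F0 (u 0 n)
      (x, normalize fun n => M.G0 (x n))
  | t + 1 =>
      let s := forward M h F0 F u t
      let v : Fin N → Cube (d + 1) := u (t + 1)
      let xhat : Fin N → Cube d := fun n => resample h s.1 s.2 (v n 0) n
      let x : Fin N → Cube d := fun n => rosenblattInv (F (t + 1) (xhat n)) (Fin.tail (v n))
      (x, normalize fun n => M.G (t + 1) (xhat n) (x n))

/-- The backward weights `W̃_t^n(x_{t+1})`. -/
def backWeight {d N : ℕ} (M : Model d) (t : ℕ) (x : Fin N → Cube d) (W : Fin N → ℝ)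
    (y : Cube d) : Fin N → ℝ :=
  normalize fun n => W n * M.dens (t + 1) (x n) y * M.G (t + 1) (x n) y

/-- The part `x̃_0, …, x̃_t` of a backward trajectory with `x̃_t = y`, from the forward output
`s` and the inputs `ũ_0, …, ũ_{t-1}`. -/
def backPath {d N : ℕ} (M : Model d) (h : Cube d → ℝ)
    (s : ℕ → (Fin N → Cube d) × (Fin N → ℝ)) (n₀ : Fin N) :
    (t : ℕ) → Cube d → Cube t → (Fin (t + 1) → Cube d)
  | 0, y, _ => fun _ => y
  | t + 1, y, v =>
      Fin.snoc (backPath M h s n₀ t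
        (resample h (s t).1 (backWeight M t (s t).1 (s t).2 y) (v (Fin.last t)) n₀)
        (Fin.init v)) y

/-- SQMC backward step for full smoothing: the `N` trajectories `x̃_{0:T}^{1:N}` obtained from the
forward output `s` and the point set `v` in `[0,1)^{T+1}`. -/
def backward {d N : ℕ} (M : Model d) (h : Cube d → ℝ) (T : ℕ)
    (s : ℕ → (Fin N → Cube d) × (Fin N → ℝ)) (v : Fin N → Cube (T + 1)) (n : Fin N) :
    Fin (T + 1) → Cube d :=
  backPath M h s n T (resample h (s T).1 (s T).2 (v n (Fin.last T)) n) (Fin.init (v n))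

/-- The estimate `S(x̃_{0:T}^{1:N})(φ)` of forward filtering followed by backward sampling, as a
function of the forward input points `u` and of the backward input points `v`, for the key `h` of
the Hilbert sort and the Rosenblatt transforms `F0` and `F t` of `m_0` and `m_t`. -/
def estimate {d N : ℕ} (M : Model d) (h : Cube d → ℝ) (F0 : Cube d → Fin d → ℝ)
    (F : ℕ → Cube d → Cube d → Fin d → ℝ) (T : ℕ) (φ : (Fin (T + 1) → Cube d) → ℝ)
    (u : (t : ℕ) → Fin N → Cube (dimAt d t)) (v : Fin N → Cube (T + 1)) : ℝ :=
  ∫ x, φ x ∂empirical (backward M h T (forward M h F0 F u) v)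

end SQMC

end

noncomputable section
namespace SQMC

/-! ### Weak convergence of weighted point sets -/

/-! The algorithm has an explicit limit. For a distribution `μ` on the cube, the quantile function
of the Hilbert key under `μ`, followed by the curve `H`, sends the uniform law on [0,1) to `μ`
(`map_curveQuantile`). Applying this map to the last coordinate of a uniform point of [0,1)^(T+1)
with `μ` the filtering distribution at time `T`, and to the other coordinates with `μ` the
successive backward kernels, gives a limit trajectory whose law is the smoothing distribution
(`map_limitTrajectory`).

Hilbert-sorted resampling converges to this quantile map, even when the uniform variate moves along
a convergent family (`tendsto_resample`). Two facts carry this. The key is continuous off the dyadic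
hyperplanes, so for `μ` absolutely continuous the distribution functions of the keys converge. And
`μ` charges open sets, so the limiting distribution function is strictly increasing and its quantile
function has no jumps. Inverse Rosenblatt transforms are jointly continuous and transport the
uniform law (`continuous_rosenblattInv`, `map_rosenblattInv`). Hence one forward step is a function
of a single input point that converges at almost every point, also along moving arguments, and the
extended continuous mapping theorem `WTendsto.tendsto_sum` turns vanishing discrepancy into weak
convergence of the weighted particles (`forward_approximates`). In the same way the backward
trajectories converge at almost every point (`ae_tendsto_backPath`).

The backward points are controlled only through their marginals and variances. Since the discrepancy
thresholds are deterministic, all limits hold uniformly over an almost sure set of `ω`, and the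
Egorov argument `exists_uniform_approx` makes the backward convergence uniform off a set of small
Lebesgue measure. Each backward point is uniform, so the expected proportion of points in that set
is small, whatever the dependence between the inputs. The estimate is therefore close in mean to the
average of `φ` along limit trajectories, which has the correct mean and vanishing variance.
Boundedness of `φ` upgrades convergence in mean to vanishing variance. -/

instance (k : ℕ) : IsProbabilityMeasure (lebesgue k) := by unfold lebesgue; infer_instance

instance : LocallyCompactSpace (Set.Ico (0 : ℝ) 1) := isLocallyClosed_Ico.locallyCompactSpace

instance (k : ℕ) : LocallyCompactSpace (Cube k) := Pi.locallyCompactSpace_of_finite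

/-- The weighted point sets `∑ w_n δ_{x_n}` converge weakly to `μ` along the filter `l`. -/
def WTendsto {ι E : Type*} [TopologicalSpace E] [MeasurableSpace E] (l : Filter ι) {N : ι → ℕ}
    (x : ∀ i, Fin (N i) → E) (w : ∀ i, Fin (N i) → ℝ) (μ : Measure E) : Prop :=
  ∀ f : BoundedContinuousFunction E ℝ,
    Tendsto (fun i => ∑ n, w i n * f (x i n)) l (𝓝 (∫ e, f e ∂μ))

/-- If `g j e'` tends to `g₀ e` for `j → l`, `e' → e`, for almost all `e`, then outside of a set
of small measure the convergence is uniform, and the limit is continuous. -/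
theorem exists_uniform_approx {J E : Type*} [TopologicalSpace E] [NormalSpace E] [T2Space E]
    [MeasurableSpace E] [BorelSpace E] {μ : Measure E} [IsFiniteMeasure μ]
    [μ.InnerRegularCompactLTTop] {l : Filter J} [l.NeBot] {g : J → E → ℝ} {g₀ : E → ℝ} {B : ℝ}
    (hB : 0 ≤ B) (hgB : ∀ j e, |g j e| ≤ B)
    (hg : ∀ᵐ e ∂μ, Tendsto (fun p : J × E => g p.1 p.2) (l ×ˢ 𝓝 e) (𝓝 (g₀ e)))
    {ε : ℝ} (hε : 0 < ε) :
    ∃ (K : Set E) (G f : BoundedContinuousFunction E ℝ), MeasurableSet K ∧ μ.real Kᶜ < ε ∧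
      (∀ e ∈ K, G e = g₀ e ∧ f e = 0) ∧ (∀ e, |G e| ≤ B) ∧ (∀ e, 0 ≤ f e ∧ f e ≤ 1) ∧
      ∀ᶠ j in l, ∀ e, |g j e - G e| ≤ ε + 2 * B * f e := by
  -- Egorov's idea: `t` contains the points without convergence, and inner regularity gives a
  -- compact `K` of good points with small complement.
  obtain ⟨t, hsub, htm, ht0⟩ := exists_measurable_superset_of_null hg
  have hU : ∀ e ∈ tᶜ, Tendsto (fun p : J × E => g p.1 p.2) (l ×ˢ 𝓝 e) (𝓝 (g₀ e)) := by
    intro e he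
    by_contra hcon
    exact he (hsub hcon)
  obtain ⟨K, hKU, hKc, hKμ⟩ := htm.compl.exists_isCompact_sdiff_lt (measure_ne_top μ _)
    (ε := ENNReal.ofReal ε) (by simpa using hε)
  have hKε : μ.real Kᶜ < ε := by
    have h1 : μ Kᶜ ≤ μ (tᶜ \ K) + μ t := by
      refine (measure_mono ?_).trans (measure_union_le _ _)
      intro e he
      by_cases h : e ∈ t
      · exact Or.inr h
      · exact Or.inl ⟨h, he⟩
    rw [ht0, add_zero] at h1
    exact (ENNReal.toReal_lt_toReal (measure_ne_top μ _) (by simp)).2 (h1.trans_lt hKμ) |>.trans_eq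
      (ENNReal.toReal_ofReal hε.le)
  -- The limit of a continuously convergent family is continuous: bound `g j e'` against `g₀ e` for
  -- `e'` near `e`, then let `j` tend to `l` with `e'` fixed.
  have hcont : ContinuousOn g₀ K := by
    intro e he
    rw [ContinuousWithinAt, Metric.tendsto_nhds]
    intro δ hδ
    have h1 := (Metric.tendsto_nhds.1 (hU e (hKU he)) (δ / 2) (by linarith))
    obtain ⟨pa, hpa, pb, hpb, hab⟩ := eventually_prod_iff.1 h1
    filter_upwards [self_mem_nhdsWithin, nhdsWithin_le_nhds hpb] with e' he' hbe
    have h2 : Tendsto (fun j => g j e') l (𝓝 (g₀ e')) :=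
      (hU e' (hKU he')).comp (tendsto_id.prodMk tendsto_const_nhds)
    have h3 : dist (g₀ e') (g₀ e) ≤ δ / 2 :=
      le_of_tendsto (h2.dist tendsto_const_nhds)
        (hpa.mono fun j hj => (hab hj hbe).le)
    linarith
  have hg₀B : ∀ e ∈ K, |g₀ e| ≤ B := fun e he => by
    have h2 : Tendsto (fun j => g j e) l (𝓝 (g₀ e)) :=
      (hU e (hKU he)).comp (tendsto_id.prodMk tendsto_const_nhds)
    exact le_of_tendsto h2.abs (Eventually.of_forall fun j => hgB j e)
  let f₀ : BoundedContinuousFunction K ℝ :=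
    BoundedContinuousFunction.ofNormedAddCommGroup (K.domRestrict g₀)
      (continuousOn_iff_continuous_domRestrict.1 hcont) B fun e => hg₀B e e.2
  -- Tietze extension, keeping the bound `B`.
  obtain ⟨G, hG, hGf⟩ := f₀.exists_extension_forall_mem_Icc_of_isClosedEmbedding (a := -B) (b := B)
    (fun e => abs_le.1 (hg₀B e e.2)) (by linarith) hKc.isClosed.isClosedEmbedding_subtypeVal
  have hGK : ∀ e ∈ K, G e = g₀ e := fun e he => congrFun hGf ⟨e, he⟩
  -- Compactness of `K` makes the estimate uniform on a neighbourhood `O` of `K`. Urysohn's function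
  -- `f`, zero on `K` and one off `O`, then pays for the trivial bound `2 * B` off `O`.
  have hev : {p : J × E | |g p.1 p.2 - G p.2| ≤ ε} ∈ l ×ˢ 𝓝ˢ K := by
    refine hKc.mem_prod_nhdsSet_of_forall fun e he => ?_
    have h1 : Tendsto (fun p : J × E => g p.1 p.2 - G p.2) (l ×ˢ 𝓝 e) (𝓝 (g₀ e - G e)) :=
      (hU e (hKU he)).sub ((G.continuous.tendsto e).comp tendsto_snd)
    rw [hGK e he, sub_self] at h1
    filter_upwards [Metric.tendsto_nhds.1 h1 ε hε] with p hp
    simpa using hp.le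
  obtain ⟨pa, hpa, pb, hpb, hab⟩ := eventually_prod_iff.1 hev
  obtain ⟨O, hO, hKO, hOb⟩ := eventually_nhdsSet_iff_exists.1 hpb
  obtain ⟨f, hf0, hf1, hf⟩ := exists_bounded_zero_one_of_closed hKc.isClosed hO.isClosed_compl
    (Set.disjoint_compl_right_iff_subset.2 hKO)
  refine ⟨K, G, f, hKc.measurableSet, hKε, fun e he => ⟨hGK e he, hf0 he⟩,
    fun e => abs_le.2 (hG e), hf, ?_⟩
  filter_upwards [hpa] with j hj e
  by_cases he : e ∈ O
  · have h1 : |g j e - G e| ≤ ε := hab hj (hOb e he)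
    have h2 := mul_nonneg (mul_nonneg zero_le_two hB) (hf e).1
    linarith
  · have h1 : f e = 1 := hf1 he
    have h2 := abs_sub (g j e) (G e)
    have h3 := hgB j e
    have h4 := abs_le.2 (hG e)
    rw [h1]
    linarith

/-- The extended continuous mapping theorem for weighted point sets. -/
theorem WTendsto.tendsto_sum {ι E : Type*} [TopologicalSpace E] [NormalSpace E] [T2Space E]
    [MeasurableSpace E] [BorelSpace E] {μ : Measure E} [IsFiniteMeasure μ]
    [μ.InnerRegularCompactLTTop] {l : Filter ι} {N : ι → ℕ} (hN : ∀ i, 0 < N i)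
    {x : ∀ i, Fin (N i) → E} {w : ∀ i, Fin (N i) → ℝ} (hw : ∀ i n, 0 ≤ w i n)
    (h : WTendsto l x w μ) {g : (Σ i, Fin (N i)) → E → ℝ} {g₀ : E → ℝ} (hg₀ : Measurable g₀)
    {B : ℝ} (hgB : ∀ j e, |g j e| ≤ B)
    (hg : ∀ᵐ e ∂μ, Tendsto (fun p : (Σ i, Fin (N i)) × E => g p.1 p.2)
      (comap Sigma.fst l ×ˢ 𝓝 e) (𝓝 (g₀ e))) :
    Tendsto (fun i => ∑ n, w i n * g ⟨i, n⟩ (x i n)) l (𝓝 (∫ e, g₀ e ∂μ)) := by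
  rcases l.eq_or_neBot with rfl | hl
  · simp
  have hsurj : Function.Surjective (Sigma.fst : (Σ i, Fin (N i)) → ι) :=
    fun i => ⟨⟨i, ⟨0, hN i⟩⟩, rfl⟩
  have : (comap (Sigma.fst : (Σ i, Fin (N i)) → ι) l).NeBot := hl.comap_of_surj hsurj
  obtain ⟨i₀⟩ := hl.nonempty
  have hB : 0 ≤ B := (abs_nonneg _).trans (hgB ⟨i₀, ⟨0, hN i₀⟩⟩ (x i₀ ⟨0, hN i₀⟩))
  have hg₀B : ∀ᵐ e ∂μ, |g₀ e| ≤ B := hg.mono fun e he => by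
    have h2 : Tendsto (fun j => g j e) (comap Sigma.fst l) (𝓝 (g₀ e)) :=
      he.comp (tendsto_id.prodMk tendsto_const_nhds)
    exact le_of_tendsto h2.abs (Eventually.of_forall fun j => hgB j e)
  have hg₀i : Integrable g₀ μ :=
    Integrable.of_bound hg₀.aestronglyMeasurable B hg₀B
  rw [Metric.tendsto_nhds]
  intro ε hε
  set m := μ.real Set.univ with hm
  have hm0 : 0 ≤ m := measureReal_nonneg
  -- The total error is `δ * c`. The summands come from `g` against `G` under a total weight of at
  -- most `m + 1`, from `2 * B * f` with weighted sum of `f` at most `2 * δ`, from weak convergence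
  -- tested on `G`, and from `G` against `g₀` off `K`.
  set c : ℝ := (m + 1) + 2 * B * 2 + 1 + 2 * B with hc
  have hcpos : 0 < c := by positivity
  obtain ⟨K, G, f, hKm, hKε, hK, hGB, hf, hev⟩ := exists_uniform_approx hB hgB hg
    (show 0 < ε / (2 * c) by positivity)
  set δ := ε / (2 * c) with hδ
  have hδ0 : 0 < δ := by positivity
  have hfint : ∫ e, f e ∂μ ≤ δ := by
    have h1 : ∫ e, f e ∂μ ≤ ∫ e, Kᶜ.indicator (fun _ => (1 : ℝ)) e ∂μ := by
      refine integral_mono (f.integrable μ) ((integrable_const _).indicator hKm.compl) fun e => ?_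
      by_cases he : e ∈ K
      · simp [he, (hK e he).2]
      · simp [he, (hf e).2]
    rw [integral_indicator hKm.compl] at h1
    simp at h1
    exact h1.trans hKε.le
  have hGint : |∫ e, G e ∂μ - ∫ e, g₀ e ∂μ| ≤ 2 * B * δ := by
    rw [← integral_sub (G.integrable μ) hg₀i]
    refine (abs_integral_le_integral_abs).trans ?_
    have h1 : ∫ e, |G e - g₀ e| ∂μ ≤ ∫ e, Kᶜ.indicator (fun _ => 2 * B) e ∂μ := by
      refine integral_mono_ae ((G.integrable μ).sub hg₀i).abs
        ((integrable_const _).indicator hKm.compl) ?_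
      filter_upwards [hg₀B] with e he₀
      by_cases he : e ∈ K
      · simp [he, (hK e he).1]
      · have := abs_sub (G e) (g₀ e)
        have := hGB e
        simp [he]
        linarith
    rw [integral_indicator hKm.compl] at h1
    simp at h1
    nlinarith
  have hev' : ∀ᶠ i in l, ∀ n e, |g ⟨i, n⟩ e - G e| ≤ δ + 2 * B * f e := by
    obtain ⟨s, hs, hsub⟩ := mem_comap.1 hev
    filter_upwards [hs] with i hi n e
    exact hsub (show (⟨i, n⟩ : Σ i, Fin (N i)) ∈ Sigma.fst ⁻¹' s from hi) e
  -- Testing against the constant one controls the total weight.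
  have h1 := h (BoundedContinuousFunction.const E 1)
  simp only [BoundedContinuousFunction.const_apply, integral_const, smul_eq_mul, mul_one] at h1
  filter_upwards [hev', (tendsto_order.1 h1).2 (m + 1) (by linarith),
    (tendsto_order.1 (h f)).2 (2 * δ) (by linarith),
    Metric.tendsto_nhds.1 (h G) δ hδ0] with i hi h1i hfi hGi
  rw [Real.dist_eq] at hGi ⊢
  have hA : |∑ n, w i n * g ⟨i, n⟩ (x i n) - ∑ n, w i n * G (x i n)| ≤
      δ * (m + 1) + 2 * B * (2 * δ) := by
    rw [← Finset.sum_sub_distrib]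
    refine (Finset.abs_sum_le_sum_abs _ _).trans ?_
    calc ∑ n, |w i n * g ⟨i, n⟩ (x i n) - w i n * G (x i n)|
        ≤ ∑ n, (δ * w i n + 2 * B * (w i n * f (x i n))) := by
          refine Finset.sum_le_sum fun n _ => ?_
          rw [← mul_sub, abs_mul, abs_of_nonneg (hw i n)]
          have := mul_le_mul_of_nonneg_left (hi n (x i n)) (hw i n)
          linarith
      _ = δ * ∑ n, w i n + 2 * B * ∑ n, w i n * f (x i n) := by
          rw [Finset.sum_add_distrib, Finset.mul_sum, Finset.mul_sum]
      _ ≤ _ := by gcongr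
  have hfin : |∑ n, w i n * g ⟨i, n⟩ (x i n) - ∫ e, g₀ e ∂μ| ≤ δ * c := by
    have := abs_sub_le (∑ n, w i n * g ⟨i, n⟩ (x i n)) (∑ n, w i n * G (x i n)) (∫ e, g₀ e ∂μ)
    have := abs_sub_le (∑ n, w i n * G (x i n)) (∫ e, G e ∂μ) (∫ e, g₀ e ∂μ)
    rw [hc]
    linarith
  refine hfin.trans_lt ?_
  rw [hδ]
  field_simp
  linarith

/-! ### Discrepancy -/

theorem empirical_apply {E : Type*} [MeasurableSpace E] {N : ℕ} (x : Fin N → E) {s : Set E}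
    (hs : MeasurableSet s) :
    empirical x s = (N : ℝ≥0∞)⁻¹ * ∑ n, s.indicator 1 (x n) := by
  simp [empirical, Measure.finsetSum_apply, Measure.dirac_apply' _ hs]

theorem isProbabilityMeasure_empirical {E : Type*} [MeasurableSpace E] {N : ℕ} (hN : 0 < N)
    (x : Fin N → E) : IsProbabilityMeasure (empirical x) := by
  constructor
  rw [empirical_apply _ MeasurableSet.univ]
  simp only [Set.mem_univ, Set.indicator_of_mem, Pi.one_apply, Finset.sum_const, Finset.card_univ,
    Fintype.card_fin, nsmul_eq_mul, mul_one]
  exact ENNReal.inv_mul_cancel (by simpa using hN.ne') (by simp)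

theorem integral_empirical {E : Type*} [MeasurableSpace E] [TopologicalSpace E]
    [BorelSpace E] {N : ℕ} (x : Fin N → E) {f : E → ℝ} (hf : Continuous f) :
    ∫ e, f e ∂empirical x = (1 / (N : ℝ)) * ∑ n, f (x n) := by
  rw [empirical, integral_smul_measure, integral_finsetSum_measure]
  · simp only [integral_dirac' _ _ hf.stronglyMeasurable]
    simp
  · intro n _
    exact (integrable_dirac' hf.stronglyMeasurable (by simp))

theorem lebesgueIco_Icc (a b : Set.Ico (0 : ℝ) 1) :
    lebesgueIco (Set.Icc a b) = ENNReal.ofReal (b - a : ℝ) := by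
  rw [lebesgueIco, (MeasurableEmbedding.subtype_coe measurableSet_Ico).comap_apply]
  have : Subtype.val '' Set.Icc a b = Set.Icc (a : ℝ) b := by
    ext y
    constructor
    · rintro ⟨z, hz, rfl⟩
      exact hz
    · intro hy
      exact ⟨⟨y, a.2.1.trans hy.1, hy.2.trans_lt b.2.2⟩, hy, rfl⟩
  rw [this, Real.volume_Icc]

instance : NullSingletonClass lebesgueIco :=
  ⟨fun a => by rw [← Set.Icc_self, lebesgueIco_Icc]; simp⟩

theorem abs_sub_le_discrepancy {k N : ℕ} (hN : 0 < N) (u : Fin N → Cube k) {a b : Cube k}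
    (hab : ∀ i, a i < b i) :
    |(empirical u).real (Set.Icc a b) - (lebesgue k).real (Set.Icc a b)| ≤ discrepancy u := by
  have := isProbabilityMeasure_empirical hN u
  -- A real supremum needs a bound, here one, since both measures are probabilities.
  refine le_ciSup (f := fun B : {p : Cube k × Cube k // ∀ i, p.1 i < p.2 i} =>
    |(empirical u).real (Set.Icc B.1.1 B.1.2) - (lebesgue k).real (Set.Icc B.1.1 B.1.2)|)
    ⟨1, ?_⟩ ⟨(a, b), hab⟩
  rintro _ ⟨B, rfl⟩
  refine abs_le.2 ⟨?_, ?_⟩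
  · have h1 : (lebesgue k).real (Set.Icc B.1.1 B.1.2) ≤ 1 := measureReal_le_one
    have h2 : 0 ≤ (empirical u).real (Set.Icc B.1.1 B.1.2) := measureReal_nonneg
    linarith
  · have h1 : (empirical u).real (Set.Icc B.1.1 B.1.2) ≤ 1 := measureReal_le_one
    have h2 : 0 ≤ (lebesgue k).real (Set.Icc B.1.1 B.1.2) := measureReal_nonneg
    linarith

theorem lebesgue_Icc_le {k : ℕ} (a b : Cube k) (i : Fin k) :
    lebesgue k (Set.Icc a b) ≤ ENNReal.ofReal (b i - a i : ℝ) := by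
  rw [← lebesgueIco_Icc, ← (measurePreserving_eval (fun _ : Fin k => lebesgueIco) i).measure_preimage
    measurableSet_Icc.nullMeasurableSet]
  exact measure_mono fun x hx => ⟨hx.1 i, hx.2 i⟩

theorem Cube.exists_Icc_subset {k : ℕ} {U : Set (Cube k)} (hU : IsOpen U) {x : Cube k}
    (hx : x ∈ U) : ∃ a b : Cube k, (∀ i, a i < b i) ∧ Set.Icc a b ∈ 𝓝 x ∧ Set.Icc a b ⊆ U := by
  obtain ⟨r, hr, hrU⟩ := Metric.nhds_basis_closedBall.mem_iff.1 (hU.mem_nhds hx)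
  have h0 := fun i => (x i).2.1
  have h1 := fun i => (x i).2.2
  refine ⟨fun i => ⟨max 0 (x i - r), le_max_left _ _, max_lt one_pos (by linarith [h1 i])⟩,
    fun i => ⟨min (x i + r) ((x i + 1) / 2), le_min (by linarith [h0 i]) (by linarith [h0 i]),
      (min_le_right _ _).trans_lt (by linarith [h1 i])⟩, ?_, ?_, ?_⟩
  · exact fun i => Subtype.mk_lt_mk.2 (lt_of_le_of_lt (max_le (h0 i) (by linarith))
      (lt_min (by linarith) (by linarith [h1 i]) : (x i : ℝ) < _))
  · rw [← Set.pi_univ_Icc]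
    refine set_pi_mem_nhds Set.finite_univ fun i _ => ?_
    have h2 : Set.Ioo ((x i : ℝ) - r) (min (x i + r) ((x i + 1) / 2)) ∈ 𝓝 (x i : ℝ) :=
      Ioo_mem_nhds (by linarith) (lt_min (by linarith) (by linarith [h1 i]))
    filter_upwards [continuous_subtype_val.continuousAt.preimage_mem_nhds h2] with y hy
    exact ⟨max_le y.2.1 hy.1.le, hy.2.le⟩
  · intro y hy
    refine hrU ((dist_pi_le_iff hr.le).2 fun i => ?_)
    rw [Subtype.dist_eq, Real.dist_eq, abs_le]
    have h2 : max 0 ((x i : ℝ) - r) ≤ y i := hy.1 i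
    have h3 : (y i : ℝ) ≤ min (x i + r) ((x i + 1) / 2) := hy.2 i
    have := (le_max_right _ _).trans h2
    have := h3.trans (min_le_left _ _)
    constructor <;> linarith

/-- Point sets of vanishing discrepancy converge weakly to the uniform distribution. -/
theorem wTendsto_of_discrepancy {ι : Type*} {k : ℕ} {l : Filter ι} [l.IsCountablyGenerated]
    {N : ι → ℕ} (hN : ∀ i, 0 < N i) {u : ∀ i, Fin (N i) → Cube k}
    (h : Tendsto (fun i => discrepancy (u i)) l (𝓝 0)) :
    WTendsto l u (fun i _ => 1 / (N i : ℝ)) (lebesgue k) := by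
  have hp : ∀ i, IsProbabilityMeasure (empirical (u i)) :=
    fun i => isProbabilityMeasure_empirical (hN i) (u i)
  have key : ∀ a b : Cube k, Tendsto (fun i => (empirical (u i)).real (Set.Icc a b)) l
      (𝓝 ((lebesgue k).real (Set.Icc a b))) := by
    intro a b
    by_cases hlt : ∀ j, a j < b j
    · rw [tendsto_iff_norm_sub_tendsto_zero]
      exact squeeze_zero (fun i => norm_nonneg _)
        (fun i => abs_sub_le_discrepancy (hN i) (u i) hlt) h
    -- The discrepancy only tests boxes with `a i < b i` for all `i`, whereas the closed boxes
    -- forming a π-system include degenerate ones. A degenerate box is null for the limit and lies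
    -- in a slightly larger admissible box.
    push Not at hlt
    obtain ⟨j, hj⟩ := hlt
    by_cases hab : a ≤ b
    swap
    · simpa [Set.Icc_eq_empty hab] using tendsto_const_nhds
    have hz : (lebesgue k).real (Set.Icc a b) = 0 := by
      have h1 := lebesgue_Icc_le a b j
      rw [ENNReal.ofReal_of_nonpos (sub_nonpos.2 hj)] at h1
      simp [measureReal_def, le_antisymm h1 bot_le]
    rw [hz, tendsto_order]
    refine ⟨fun c hc => Eventually.of_forall fun i => hc.trans_le measureReal_nonneg,
      fun c hc => ?_⟩
    obtain ⟨n, hn⟩ := exists_nat_gt (2 / c)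
    -- Moving `b` by the fraction `1 / (n + 2)` of its distance to one enlarges every side, stays in
    -- the cube, and keeps side `j` at most `c / 2`.
    let b' : Cube k := fun i => ⟨b i + (1 - b i) / (n + 2),
      add_nonneg (b i).2.1 (div_nonneg (by linarith [(b i).2.2]) (by positivity)), by
        have h1 : (0 : ℝ) < 1 - b i := by linarith [(b i).2.2]
        have h2 : (1 - b i : ℝ) / (n + 2) < 1 - b i :=
          div_lt_self h1 (by linarith [(Nat.cast_nonneg n : (0 : ℝ) ≤ n)])
        linarith⟩
    have hb' : ∀ i, b i < b' i := fun i => by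
      have h1 : (0 : ℝ) < 1 - b i := by linarith [(b i).2.2]
      have h2 : (0 : ℝ) < (1 - b i) / (n + 2) := by positivity
      exact Subtype.coe_lt_coe.1 (show (b i : ℝ) < b i + (1 - b i) / (n + 2) by linarith)
    have hlam : (lebesgue k).real (Set.Icc a b') ≤ c / 2 := by
      have h1 := lebesgue_Icc_le a b' j
      have h2 : (b' j - a j : ℝ) ≤ c / 2 := by
        have h3 : (b' j : ℝ) = b j + (1 - b j) / (n + 2) := rfl
        have h4 : (b j : ℝ) ≤ a j := hj
        have h5 : (1 - b j : ℝ) / (n + 2) ≤ 1 / (n + 2) := by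
          gcongr
          linarith [(b j).2.1]
        have h6 : (1 : ℝ) / (n + 2) ≤ c / 2 := by
          rw [div_lt_iff₀ hc] at hn
          rw [div_le_div_iff₀ (by positivity) (by norm_num)]
          nlinarith
        linarith
      calc (lebesgue k).real (Set.Icc a b') ≤ (ENNReal.ofReal (c / 2)).toReal :=
            ENNReal.toReal_mono (by simp) (h1.trans (ENNReal.ofReal_le_ofReal h2))
        _ = c / 2 := ENNReal.toReal_ofReal (by positivity)
    filter_upwards [(tendsto_order.1 h).2 (c / 2) (by positivity)] with i hi
    have h1 := abs_sub_le_discrepancy (hN i) (u i) (a := a) (b := b')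
      fun i => (hab i).trans_lt (hb' i)
    have h2 : (empirical (u i)).real (Set.Icc a b) ≤ (empirical (u i)).real (Set.Icc a b') :=
      measureReal_mono (Set.Icc_subset_Icc_right fun i => (hb' i).le)
    linarith [(abs_le.1 h1).2]
  let μ : ι → ProbabilityMeasure (Cube k) := fun i => ⟨empirical (u i), hp i⟩
  let ν : ProbabilityMeasure (Cube k) := ⟨lebesgue k, inferInstance⟩
  have hlim : Tendsto μ l (𝓝 ν) := by
    -- Closed boxes are stable under intersection and contain a neighbourhood basis of each point,
    -- so convergence on them implies weak convergence.
    refine IsPiSystem.tendsto_probabilityMeasure_of_tendsto_of_mem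
      (S := {s | ∃ a b : Cube k, s = Set.Icc a b}) ?_ ?_ ?_ ?_
    · rintro _ ⟨a, b, rfl⟩ _ ⟨a', b', rfl⟩ -
      exact ⟨a ⊔ a', b ⊓ b', Set.Icc_inter_Icc⟩
    · rintro _ ⟨a, b, rfl⟩
      exact measurableSet_Icc
    · intro U hU x hx
      obtain ⟨a, b, -, h1, h2⟩ := Cube.exists_Icc_subset hU hx
      exact ⟨_, ⟨a, b, rfl⟩, h1, h2⟩
    · rintro _ ⟨a, b, rfl⟩
      exact NNReal.tendsto_coe.1 (key a b)
  intro f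
  refine ((ProbabilityMeasure.tendsto_iff_forall_integral_tendsto.1 hlim) f).congr fun i => ?_
  exact (integral_empirical (u i) f.continuous).trans (Finset.mul_sum _ _ _)

/-! ### The Hilbert curve -/

theorem exists_nat_div_le {n : ℕ} (hn : 0 < n) (s : unitInterval) :
    ∃ k < n, (k : ℝ) / n ≤ s ∧ (s : ℝ) ≤ (k + 1) / n := by
  have hn' : (0 : ℝ) < n := by exact_mod_cast hn
  -- At `s = 1` the floor would be `n`, which is out of range; the last interval is taken instead.
  by_cases h : (s : ℝ) = 1
  · refine ⟨n - 1, by omega, ?_⟩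
    rw [Nat.cast_sub hn, h, div_le_one hn', le_div_iff₀ hn']
    constructor <;> simp
  · have hs : (s : ℝ) < 1 := lt_of_le_of_ne s.2.2 h
    have h0 : 0 ≤ (s : ℝ) * n := mul_nonneg s.2.1 hn'.le
    refine ⟨⌊(s : ℝ) * n⌋₊, (Nat.floor_lt h0).2 (by nlinarith), ?_, ?_⟩
    · rw [div_le_iff₀ hn']
      exact Nat.floor_le h0
    · rw [le_div_iff₀ hn']
      exact (Nat.lt_floor_add_one _).le

theorem exists_one_div_two_pow_lt {d : ℕ} (hd : 1 ≤ d) {ε : ℝ} (hε : 0 < ε) :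
    ∃ m : ℕ, (1 : ℝ) / 2 ^ (d * m) < ε := by
  obtain ⟨m, hm⟩ := exists_pow_lt_of_lt_one hε (show (1 / 2 : ℝ) < 1 by norm_num)
  refine ⟨m, lt_of_le_of_lt ?_ hm⟩
  rw [← one_div_pow]
  exact pow_le_pow_of_le_one (by norm_num) (by norm_num) (Nat.le_mul_of_pos_left m hd)

variable {d : ℕ} {H : unitInterval → Fin d → unitInterval}
  {h : (Fin d → unitInterval) → unitInterval}

/-- Parameters closer than `2^(-dm)` lie in the same or in consecutive intervals of level `m`. The
common endpoint `e` of consecutive intervals is mapped into both cubes, so no coordinate of `H`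
moves by more than `2 / 2^m`. -/
theorem IsHilbertCurve.continuous (hH : IsHilbertCurve H) : Continuous H := by
  obtain ⟨-, c, -, -, -, hc⟩ := hH
  have key : ∀ m : ℕ, ∀ s s' : unitInterval, s ≤ s' → (s' : ℝ) - s < 1 / 2 ^ (d * m) →
      ∀ i, |(H s i : ℝ) - H s' i| ≤ 2 / 2 ^ m := by
    intro m s s' hss hlt i
    obtain ⟨k, hk, hks, hsk⟩ := exists_nat_div_le (n := 2 ^ (d * m)) (by positivity) s
    push_cast at hks hsk
    have hss' : (s : ℝ) ≤ s' := hss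
    have hp : (0 : ℝ) < 2 ^ (d * m) := by positivity
    have hq : (0 : ℝ) < 2 ^ m := by positivity
    have h1 := hc m k hk s hks hsk i
    have e1 : ((c m k i : ℝ) + 1) / 2 ^ m = c m k i / 2 ^ m + 1 / 2 ^ m := by ring
    have e2 : (2 : ℝ) / 2 ^ m = 1 / 2 ^ m + 1 / 2 ^ m := by ring
    have hq' : (0 : ℝ) < 1 / 2 ^ m := by positivity
    by_cases hs' : (s' : ℝ) ≤ (k + 1) / 2 ^ (d * m)
    · have h2 := hc m k hk s' (hks.trans hss') hs' i
      rw [abs_le]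
      constructor <;> linarith
    · push Not at hs'
      have hk1 : k + 1 < 2 ^ (d * m) := by
        have h3 : ((k : ℝ) + 1) / 2 ^ (d * m) < 1 := hs'.trans_le s'.2.2
        rw [div_lt_one hp] at h3
        exact_mod_cast h3
      let e : unitInterval := ⟨(k + 1) / 2 ^ (d * m), by positivity, (hs'.trans_le s'.2.2).le⟩
      have e3 : ((k : ℝ) + 1 + 1) / 2 ^ (d * m) = (k + 1) / 2 ^ (d * m) + 1 / 2 ^ (d * m) := by ring
      have h2 := hc m k hk e (by
        show (k : ℝ) / 2 ^ (d * m) ≤ (k + 1) / 2 ^ (d * m)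
        gcongr
        linarith) le_rfl i
      have h3 := hc m (k + 1) hk1 e (by push_cast; exact le_rfl) (by
        push_cast
        rw [e3]
        have : (0 : ℝ) < 1 / 2 ^ (d * m) := by positivity
        show ((k : ℝ) + 1) / 2 ^ (d * m) ≤ _
        linarith) i
      have h4 := hc m (k + 1) hk1 s' (by push_cast; exact hs'.le) (by
        push_cast
        rw [e3]
        linarith) i
      have e4 : ((c m (k + 1) i : ℝ) + 1) / 2 ^ m = c m (k + 1) i / 2 ^ m + 1 / 2 ^ m := by ring
      rw [abs_le]
      constructor <;> linarith
  rw [continuous_pi_iff]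
  intro i
  rw [Metric.continuous_iff]
  intro s ε hε
  obtain ⟨m, hm⟩ := exists_one_div_two_pow_lt le_rfl (half_pos hε)
  rw [one_mul] at hm
  have e2 : (2 : ℝ) / 2 ^ m = 1 / 2 ^ m + 1 / 2 ^ m := by ring
  refine ⟨1 / 2 ^ (d * m), by positivity, fun s' hs' => ?_⟩
  rw [Subtype.dist_eq, Real.dist_eq] at hs' ⊢
  rcases le_total s s' with hle | hle
  · have := key m s s' hle ((le_abs_self _).trans_lt hs') i
    rw [abs_sub_comm]
    linarith
  · have := key m s' s hle ((neg_sub (s' : ℝ) s ▸ neg_le_abs _).trans_lt hs') i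
    linarith

/-- The closed cube attached to the interval containing `h y` contains `H (h y) = y`. If `y` is
interior to a cube of the same level, the two cubes have the same corner, and the enumeration of
cubes is injective. -/
theorem IsHilbertCurve.exists_corner (hH : IsHilbertCurve H) (hh : ∀ x, H (h x) = x) :
    ∃ c : ℕ → ℕ → Fin d → ℕ,
      (∀ m, Set.BijOn (c m) (Set.Iio (2 ^ (d * m))) {a | ∀ i, a i < 2 ^ m}) ∧
      ∀ m k, k < 2 ^ (d * m) → ∀ y : Fin d → unitInterval,
        (∀ i, (c m k i : ℝ) / 2 ^ m < y i ∧ (y i : ℝ) < (c m k i + 1) / 2 ^ m) →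
        (k : ℝ) / 2 ^ (d * m) ≤ h y ∧ (h y : ℝ) ≤ (k + 1) / 2 ^ (d * m) := by
  obtain ⟨-, c, hbij, -, -, hc⟩ := hH
  refine ⟨c, hbij, fun m k hk y hy => ?_⟩
  obtain ⟨k', hk', h1, h2⟩ := exists_nat_div_le (n := 2 ^ (d * m)) (by positivity) (h y)
  push_cast at h1 h2
  have h3 := hc m k' hk' (h y) h1 h2
  rw [hh] at h3
  have hq : (0 : ℝ) < 2 ^ m := by positivity
  have : c m k' = c m k := by
    funext i
    obtain ⟨ha, hb⟩ := h3 i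
    obtain ⟨ha', hb'⟩ := hy i
    have h4 := ha.trans_lt hb'
    have h5 := ha'.trans_le hb
    rw [div_lt_div_iff_of_pos_right hq] at h4 h5
    have h6 : c m k' i < c m k i + 1 := by exact_mod_cast h4
    have h7 : c m k i < c m k' i + 1 := by exact_mod_cast h5
    omega
  rw [← (hbij m).injOn hk' hk this]
  exact ⟨h1, h2⟩

theorem isOpen_dyadicBox (m : ℕ) (c : Fin d → ℕ) :
    IsOpen {x : Cube d | ∀ i, (c i : ℝ) / 2 ^ m < x i ∧ (x i : ℝ) < (c i + 1) / 2 ^ m} := by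
  simp only [Set.ofPred_forall]
  refine isOpen_iInter_of_finite fun i => ?_
  have hc : Continuous fun x : Cube d => (x i : ℝ) := by fun_prop
  exact (isOpen_lt continuous_const hc).inter (isOpen_lt hc continuous_const)

/-- A point without dyadic coordinates is interior to its cube at every level `m`, and on that open
cube the key varies by at most `2^(-dm)`. The excluded points form a Lebesgue null set. -/
theorem IsHilbertCurve.continuousAt_key (hd : 1 ≤ d) (hH : IsHilbertCurve H)
    (hh : ∀ x, H (h x) = x) {x : Cube d} (hx : ∀ (i : Fin d) (m j : ℕ), (x i : ℝ) ≠ j / 2 ^ m) :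
    ContinuousAt (fun x => h (toClosedCube x)) x := by
  obtain ⟨c, hbij, hc⟩ := hH.exists_corner hh
  rw [Metric.continuousAt_iff']
  intro ε hε
  obtain ⟨m, hm⟩ := exists_one_div_two_pow_lt hd hε
  have hq : (0 : ℝ) < 2 ^ m := by positivity
  have h0 : ∀ i, 0 ≤ (x i : ℝ) * 2 ^ m := fun i => mul_nonneg (x i).2.1 hq.le
  obtain ⟨k, hk, hck⟩ := (hbij m).surjOn (show (fun i => ⌊(x i : ℝ) * 2 ^ m⌋₊) ∈ _ from fun i => by
    rw [Nat.floor_lt (h0 i)]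
    push_cast
    nlinarith [(x i).2.2])
  have hxV : x ∈ {x : Cube d | ∀ i, (c m k i : ℝ) / 2 ^ m < x i ∧ (x i : ℝ) < (c m k i + 1) / 2 ^ m} := by
    intro i
    have h1 : c m k i = ⌊(x i : ℝ) * 2 ^ m⌋₊ := congrFun hck i
    rw [h1]
    refine ⟨lt_of_le_of_ne ?_ (hx i m _).symm, ?_⟩
    · rw [div_le_iff₀ hq]
      exact Nat.floor_le (h0 i)
    · rw [lt_div_iff₀ hq]
      exact Nat.lt_floor_add_one _
  filter_upwards [(isOpen_dyadicBox m (c m k)).mem_nhds hxV] with y hy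
  have h1 := hc m k hk (toClosedCube x) hxV
  have h2 := hc m k hk (toClosedCube y) hy
  have e : ((k : ℝ) + 1) / 2 ^ (d * m) = k / 2 ^ (d * m) + 1 / 2 ^ (d * m) := by ring
  rw [Subtype.dist_eq, Real.dist_eq]
  refine lt_of_le_of_lt (abs_le.2 ?_) hm
  constructor <;> linarith

/-- For a measure charging open sets, this makes the distribution function of the key strictly
increasing, so that its quantile function has no jumps. -/
theorem IsHilbertCurve.exists_isOpen_key (hd : 1 ≤ d) (hH : IsHilbertCurve H)
    (hh : ∀ x, H (h x) = x) {a b : unitInterval} (hab : a < b) :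
    ∃ V : Set (Cube d), IsOpen V ∧ V.Nonempty ∧
      ∀ x ∈ V, a < h (toClosedCube x) ∧ h (toClosedCube x) < b := by
  obtain ⟨c, hbij, hc⟩ := hH.exists_corner hh
  have hab' : (a : ℝ) < b := hab
  obtain ⟨m, hm⟩ := exists_one_div_two_pow_lt hd (show (0 : ℝ) < (b - a) / 2 by linarith)
  set D : ℝ := 2 ^ (d * m) with hD
  have hD0 : 0 < D := by positivity
  have hq : (0 : ℝ) < 2 ^ m := by positivity
  -- `k / D` is the first point of the grid beyond `a`; as `1 / D < (b - a) / 2`, the interval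
  -- starting there ends before `b`.
  set k : ℕ := ⌊(a : ℝ) * D⌋₊ + 1 with hk
  have h0 : 0 ≤ (a : ℝ) * D := mul_nonneg a.2.1 hD0.le
  have h1 : (a : ℝ) < k / D := by
    rw [lt_div_iff₀ hD0, hk]
    push_cast
    exact Nat.lt_floor_add_one _
  have h2 : ((k : ℝ) + 1) / D < b := by
    have h3 : (k : ℝ) / D ≤ a + 1 / D := by
      rw [div_le_iff₀ hD0, add_mul, one_div, inv_mul_cancel₀ hD0.ne', hk]
      push_cast
      linarith [Nat.floor_le h0]
    rw [add_div]
    linarith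
  have hk' : k < 2 ^ (d * m) := by
    have h3 := h2.trans_le b.2.2
    rw [div_lt_one hD0] at h3
    have : (k : ℝ) < D := by linarith
    rw [hD] at this
    exact_mod_cast this
  refine ⟨_, isOpen_dyadicBox m (c m k), ?_, fun x hx => ?_⟩
  · refine ⟨fun i => ⟨(c m k i + 1 / 2) / 2 ^ m, by positivity, ?_⟩, fun i => ⟨?_, ?_⟩⟩
    · have h3 : c m k i < 2 ^ m := (hbij m).mapsTo hk' i
      have h4 : (c m k i : ℝ) + 1 ≤ 2 ^ m := by exact_mod_cast h3
      rw [div_lt_one hq]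
      linarith
    · show (c m k i : ℝ) / 2 ^ m < (c m k i + 1 / 2) / 2 ^ m
      gcongr
      linarith
    · show ((c m k i : ℝ) + 1 / 2) / 2 ^ m < (c m k i + 1) / 2 ^ m
      gcongr
      linarith
  · have h3 := hc m k hk' (toClosedCube x) hx
    exact ⟨Subtype.coe_lt_coe.1 (h1.trans_le h3.1), Subtype.coe_lt_coe.1 (h3.2.trans_lt h2)⟩

/-! ### Quantiles along the Hilbert curve -/

section Quantile

variable {d : ℕ} {H : unitInterval → Fin d → unitInterval}
  {h : (Fin d → unitInterval) → unitInterval}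

/-- A retraction of `[0,1]^d` onto `[0,1)^d`. -/
def fromClosed {d : ℕ} (y : Fin d → unitInterval) : Cube d :=
  fun i => if hi : (y i : ℝ) < 1 then ⟨y i, (y i).2.1, hi⟩ else ⟨0, le_rfl, one_pos⟩

theorem fromClosed_toClosedCube (x : Cube d) : fromClosed (toClosedCube x) = x := by
  funext i
  have : ((toClosedCube x i : unitInterval) : ℝ) < 1 := (x i).2.2
  simp only [fromClosed, this, dif_pos]
  rfl

theorem measurable_fromClosed : Measurable (fromClosed (d := d)) := by
  refine measurable_pi_lambda _ fun i => ?_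
  rw [← (MeasurableEmbedding.subtype_coe measurableSet_Ico).measurable_comp_iff]
  have : (Subtype.val ∘ fun y : Fin d → unitInterval => fromClosed y i) =
      fun y => if (y i : ℝ) < 1 then (y i : ℝ) else 0 := by
    funext y
    by_cases hy : (y i : ℝ) < 1 <;>
      simp only [Function.comp, fromClosed, hy, ↓reduceDIte, ↓reduceIte]
  rw [this]
  exact Measurable.ite (measurableSet_lt (by fun_prop) measurable_const) (by fun_prop)
    measurable_const

theorem continuousAt_fromClosed {y : Fin d → unitInterval} (hy : ∀ i, (y i : ℝ) < 1) :
    ContinuousAt fromClosed y := by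
  rw [continuousAt_pi]
  intro i
  rw [ContinuousAt, tendsto_subtype_rng]
  have hc : Tendsto (fun z : Fin d → unitInterval => (z i : ℝ)) (𝓝 y) (𝓝 (y i : ℝ)) :=
    (by fun_prop : Continuous fun z : Fin d → unitInterval => (z i : ℝ)).tendsto y
  have : (fromClosed y i : ℝ) = y i := by simp [fromClosed, hy i]
  rw [this]
  refine hc.congr' ?_
  filter_upwards [(tendsto_order.1 hc).2 1 (hy i)] with z hz
  simp [fromClosed, hz]

theorem continuous_toClosedCube : Continuous (toClosedCube (d := d)) := by
  refine continuous_pi fun i => Continuous.subtype_mk (by fun_prop) _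

/-- The quantile function of the image of `μ` under the key `h`. -/
def keyQuantile (h : (Fin d → unitInterval) → unitInterval) (μ : Measure (Cube d)) (v : ℝ) :
    unitInterval :=
  sInf {s | v ≤ μ.real {x | h (toClosedCube x) ≤ s}}

/-- The inverse Rosenblatt transform of `μ` along the curve `H`. -/
def curveQuantile (H : unitInterval → Fin d → unitInterval)
    (h : (Fin d → unitInterval) → unitInterval) (μ : Measure (Cube d)) (v : ℝ) : Cube d :=
  fromClosed (H (keyQuantile h μ v))

/-- The infimum is attained because distribution functions are right continuous; `v ≤ 1` puts `1`
into the set. This Galois connection reduces measurability, laws and limits of quantiles to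
statements on distribution functions. -/
theorem keyQuantile_le_iff (hm : Measurable h) (μ : Measure (Cube d)) [IsProbabilityMeasure μ]
    {v : ℝ} (hv : v ≤ 1) (s : unitInterval) :
    keyQuantile h μ v ≤ s ↔ v ≤ μ.real {x | h (toClosedCube x) ≤ s} := by
  have hkm : Measurable fun x : Cube d => (h (toClosedCube x) : ℝ) :=
    measurable_subtype_coe.comp (hm.comp continuous_toClosedCube.measurable)
  have : IsProbabilityMeasure (μ.map fun x : Cube d => (h (toClosedCube x) : ℝ)) :=
    Measure.isProbabilityMeasure_map hkm.aemeasurable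
  have hF : ∀ s : unitInterval, μ.real {x | h (toClosedCube x) ≤ s} =
      cdf (μ.map fun x : Cube d => (h (toClosedCube x) : ℝ)) s := by
    intro s
    rw [cdf_eq_real, map_measureReal_apply hkm measurableSet_Iic]
    rfl
  set S := {s : unitInterval | v ≤ μ.real {x | h (toClosedCube x) ≤ s}} with hS
  have hne : (1 : unitInterval) ∈ S := by
    have : {x : Cube d | h (toClosedCube x) ≤ 1} = Set.univ :=
      Set.eq_univ_of_forall fun x => unitInterval.le_one'
    simpa [hS, this] using hv
  have hmem : v ≤ μ.real {x | h (toClosedCube x) ≤ keyQuantile h μ v} := by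
    rw [hF]
    have h1 := (cdf (μ.map fun x : Cube d => (h (toClosedCube x) : ℝ))).right_continuous
      (keyQuantile h μ v)
    have h2 := h1.tendsto.mono_left (nhdsWithin_mono _ Set.Ioi_subset_Ici_self)
    refine ge_of_tendsto h2 ?_
    filter_upwards [self_mem_nhdsWithin] with t ht
    rcases lt_or_ge t 1 with ht1 | ht1
    · have ht0 : 0 ≤ t := (keyQuantile h μ v).2.1.trans (le_of_lt ht)
      obtain ⟨s, hs, hst⟩ := sInf_lt_iff.1
        (show sInf S < (⟨t, ht0, ht1.le⟩ : unitInterval) from ht)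
      have h3 : v ≤ cdf (μ.map fun x : Cube d => (h (toClosedCube x) : ℝ)) s := by
        rw [← hF]
        exact hs
      exact h3.trans (monotone_cdf _ (le_of_lt hst))
    · have h3 : v ≤ cdf (μ.map fun x : Cube d => (h (toClosedCube x) : ℝ)) (1 : unitInterval) := by
        rw [← hF]
        exact hne
      exact h3.trans (monotone_cdf _ ht1)
  constructor
  · intro hle
    exact hmem.trans (measureReal_mono fun x hx => le_trans hx hle)
  · intro hle
    exact sInf_le hle

theorem measurable_keyQuantile {Y : Type*} [MeasurableSpace Y] (hm : Measurable h)
    {μ : Y → Measure (Cube d)} (hμ : Measurable μ) (hp : ∀ y, IsProbabilityMeasure (μ y)) :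
    Measurable fun p : Y × Set.Ico (0 : ℝ) 1 => keyQuantile h (μ p.1) p.2 := by
  refine measurable_of_Iic fun s => ?_
  have : (fun p : Y × Set.Ico (0 : ℝ) 1 => keyQuantile h (μ p.1) p.2) ⁻¹' Set.Iic s =
      {p | (p.2 : ℝ) ≤ (μ p.1).real {x | h (toClosedCube x) ≤ s}} := by
    ext p
    have := hp p.1
    exact keyQuantile_le_iff hm (μ p.1) p.2.2.2.le s
  rw [this]
  refine measurableSet_le (by fun_prop) ?_
  exact ((Measure.measurable_coe ((hm.comp continuous_toClosedCube.measurable)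
    measurableSet_Iic)).comp (hμ.comp measurable_fst)).ennreal_toReal

theorem measurable_curveQuantile {Y : Type*} [MeasurableSpace Y] (hH : Continuous H)
    (hm : Measurable h) {μ : Y → Measure (Cube d)} (hμ : Measurable μ)
    (hp : ∀ y, IsProbabilityMeasure (μ y)) :
    Measurable fun p : Y × Set.Ico (0 : ℝ) 1 => curveQuantile H h (μ p.1) p.2 :=
  measurable_fromClosed.comp (hH.measurable.comp (measurable_keyQuantile hm hμ hp))

theorem lebesgueIco_setOf_le {c : ℝ} (h0 : 0 ≤ c) (h1 : c ≤ 1) :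
    lebesgueIco {v | (v : ℝ) ≤ c} = ENNReal.ofReal c := by
  rcases h1.lt_or_eq with h1 | rfl
  · have : {v : Set.Ico (0 : ℝ) 1 | (v : ℝ) ≤ c} =
        Set.Icc ⟨0, le_rfl, one_pos⟩ ⟨c, h0, h1⟩ := by
      ext v
      exact ⟨fun hv => ⟨v.2.1, hv⟩, fun hv => hv.2⟩
    rw [this, lebesgueIco_Icc]
    simp
  · have : {v : Set.Ico (0 : ℝ) 1 | (v : ℝ) ≤ 1} = Set.univ :=
      Set.eq_univ_of_forall fun v => v.2.2.le
    rw [this]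
    simp

theorem measurable_curveQuantile_right (hH : Continuous H) (hm : Measurable h)
    (μ : Measure (Cube d)) [IsProbabilityMeasure μ] :
    Measurable fun v : Set.Ico (0 : ℝ) 1 => curveQuantile H h μ v :=
  (measurable_curveQuantile hH hm (measurable_const (a := μ)) (fun _ : Unit => inferInstance)).comp
    (measurable_const.prodMk measurable_id (f := fun _ => ()))

theorem map_keyQuantile (hm : Measurable h) (μ : Measure (Cube d)) [IsProbabilityMeasure μ] :
    lebesgueIco.map (fun v : Set.Ico (0 : ℝ) 1 => keyQuantile h μ v) = μ.map fun x => h (toClosedCube x) := by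
  have hq : Measurable fun v : Set.Ico (0 : ℝ) 1 => keyQuantile h μ v :=
    (measurable_keyQuantile hm (measurable_const (a := μ)) (fun _ : Unit => inferInstance)).comp
      (measurable_const.prodMk measurable_id (f := fun _ => ()))
  have hk : Measurable fun x : Cube d => h (toClosedCube x) :=
    hm.comp continuous_toClosedCube.measurable
  refine Measure.ext_of_Iic _ _ fun s => ?_
  rw [Measure.map_apply hq measurableSet_Iic, Measure.map_apply hk measurableSet_Iic]
  have : (fun v : Set.Ico (0 : ℝ) 1 => keyQuantile h μ v) ⁻¹' Set.Iic s =
      {v : Set.Ico (0 : ℝ) 1 | (v : ℝ) ≤ μ.real {x | h (toClosedCube x) ≤ s}} := by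
    ext v
    exact keyQuantile_le_iff hm μ v.2.2.le s
  rw [this, lebesgueIco_setOf_le measureReal_nonneg measureReal_le_one, ofReal_measureReal]
  rfl

/-- Inverse transform sampling on [0,1] yields the law of the key, and `H` undoes the key. -/
theorem map_curveQuantile (hH : Continuous H) (hh : ∀ x, H (h x) = x) (hm : Measurable h)
    (μ : Measure (Cube d)) [IsProbabilityMeasure μ] :
    lebesgueIco.map (fun v : Set.Ico (0 : ℝ) 1 => curveQuantile H h μ v) = μ := by
  have hk : Measurable fun x : Cube d => h (toClosedCube x) :=
    hm.comp continuous_toClosedCube.measurable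
  have hq : Measurable fun v : Set.Ico (0 : ℝ) 1 => keyQuantile h μ v :=
    (measurable_keyQuantile hm (measurable_const (a := μ)) (fun _ : Unit => inferInstance)).comp
      (measurable_const.prodMk measurable_id (f := fun _ => ()))
  have h1 := congrArg (Measure.map fun s => fromClosed (H s)) (map_keyQuantile hm μ)
  have hf : Measurable fun s => fromClosed (H s) := measurable_fromClosed.comp hH.measurable
  rw [Measure.map_map hf hq, Measure.map_map hf hk] at h1
  refine h1.trans ?_
  have : (fun s => fromClosed (H s)) ∘ (fun x : Cube d => h (toClosedCube x)) = id := by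
    funext x
    simp [hh, fromClosed_toClosedCube]
  rw [this, Measure.map_id]

/-- At a uniform variate the quantile is distributed as the key of a point of [0,1)^d, which `H`
maps back to that point. So the upper faces, where `fromClosed` may jump, are almost surely avoided.
-/
theorem ae_keyQuantile_lt_one (hH : Continuous H) (hh : ∀ x, H (h x) = x) (hm : Measurable h)
    (μ : Measure (Cube d)) [IsProbabilityMeasure μ] :
    ∀ᵐ v : Set.Ico (0 : ℝ) 1 ∂lebesgueIco, ∀ i, (H (keyQuantile h μ v) i : ℝ) < 1 := by
  have hk : Measurable fun x : Cube d => h (toClosedCube x) :=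
    hm.comp continuous_toClosedCube.measurable
  have hq : Measurable fun v : Set.Ico (0 : ℝ) 1 => keyQuantile h μ v :=
    (measurable_keyQuantile hm (measurable_const (a := μ)) (fun _ : Unit => inferInstance)).comp
      (measurable_const.prodMk measurable_id (f := fun _ => ()))
  have hs : MeasurableSet {s : unitInterval | ∀ i, (H s i : ℝ) < 1} := by
    simp only [Set.ofPred_forall]
    refine MeasurableSet.iInter fun i => measurableSet_lt ?_ measurable_const
    exact (by fun_prop : Continuous fun s => (H s i : ℝ)).measurable
  have h1 : ∀ᵐ s ∂(μ.map fun x => h (toClosedCube x)), ∀ i, (H s i : ℝ) < 1 := by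
    rw [ae_map_iff hk.aemeasurable hs]
    refine Eventually.of_forall fun x i => ?_
    rw [hh]
    exact (x i).2.2
  rw [← map_keyQuantile hm μ, ae_map_iff hq.aemeasurable hs] at h1
  exact h1

/-! ### Resampling -/

theorem invIndex_spec {N : ℕ} {w : Fin N → ℝ} {u : ℝ} (n₀ : Fin N) (hu : u ≤ ∑ n, w n) :
    u ≤ ∑ m ∈ Finset.Iic (invIndex w u n₀), w m ∧
      ∀ j < invIndex w u n₀, ∑ m ∈ Finset.Iic j, w m < u := by
  have hne : (Finset.univ.filter fun i : Fin N => u ≤ ∑ m ∈ Finset.Iic i, w m).Nonempty := by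
    have hN : 0 < N := n₀.pos
    refine ⟨⟨N - 1, by omega⟩, ?_⟩
    have : Finset.Iic (⟨N - 1, by omega⟩ : Fin N) = Finset.univ := by
      ext m
      have := m.2
      simp only [Finset.mem_Iic, Finset.mem_univ, iff_true, Fin.le_def]
      omega
    simpa [this] using hu
  rw [invIndex, dif_pos hne]
  refine ⟨(Finset.mem_filter.1 (Finset.min'_mem _ hne)).2, fun j hj => ?_⟩
  by_contra hcon
  have hle : u ≤ ∑ m ∈ Finset.Iic j, w m := not_lt.1 hcon
  have := Finset.min'_le (Finset.univ.filter fun i : Fin N => u ≤ ∑ m ∈ Finset.Iic i, w m) j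
    (Finset.mem_filter.2 ⟨Finset.mem_univ j, hle⟩)
  exact absurd hj (not_lt.2 this)

/-- The two inequalities say that the key of the resampled point is a `u`-quantile of the weighted
keys. They mention neither the sorting nor ties, so only distribution functions of keys enter the
limit. -/
theorem resample_spec {N : ℕ} (k : Cube d → ℝ) (x : Fin N → Cube d) {w : Fin N → ℝ}
    (hw : ∀ n, 0 ≤ w n) {u : ℝ} (h0 : 0 ≤ u) (hu : u ≤ ∑ n, w n) (n₀ : Fin N) :
    u ≤ ∑ n with k (x n) ≤ k (resample k x w u n₀), w n ∧
      ∑ n with k (x n) < k (resample k x w u n₀), w n ≤ u := by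
  set σ := Tuple.sort fun n => k (x n) with hσ
  have hmono : Monotone ((fun n => k (x n)) ∘ σ) := Tuple.monotone_sort _
  have hu' : u ≤ ∑ n, w (σ n) := by rwa [Equiv.sum_comp σ w]
  set i := invIndex (fun i => w (σ i)) u n₀ with hi
  obtain ⟨h1, h2⟩ := invIndex_spec n₀ hu'
  have hres : resample k x w u n₀ = x (σ i) := rfl
  rw [hres]
  have hsum : ∀ p : ℝ → Prop, [DecidablePred p] →
      ∑ n with p (k (x n)), w n = ∑ n with p (k (x (σ n))), w (σ n) := by
    intro p _
    rw [Finset.sum_filter, Finset.sum_filter]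
    exact (Equiv.sum_comp σ fun n => if p (k (x n)) then w n else 0).symm
  constructor
  · rw [hsum fun t => t ≤ k (x (σ i))]
    refine h1.trans (Finset.sum_le_sum_of_subset_of_nonneg (fun m hm => ?_) fun _ _ _ => hw _)
    exact Finset.mem_filter.2 ⟨Finset.mem_univ _, hmono (Finset.mem_Iic.1 hm)⟩
  · rw [hsum fun t => t < k (x (σ i))]
    have hsub : (Finset.univ.filter fun n => k (x (σ n)) < k (x (σ i))) ⊆ Finset.Iio i := by
      intro m hm
      by_contra hcon
      exact absurd (Finset.mem_filter.1 hm).2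
        (not_lt.2 (hmono (not_lt.1 fun hlt => hcon (Finset.mem_Iio.2 hlt))))
    refine (Finset.sum_le_sum_of_subset_of_nonneg hsub fun _ _ _ => hw _).trans ?_
    -- No rank precedes zero, and there `0 ≤ u` is what is needed; otherwise minimality of `i` is
    -- applied at rank `i - 1`.
    by_cases hi0 : (i : ℕ) = 0
    · have : Finset.Iio i = ∅ := by
        ext m
        simp [Fin.lt_def, hi0]
      simpa [this] using h0
    · have hlt : (⟨i - 1, by omega⟩ : Fin N) < i := by
        rw [Fin.lt_def]
        simp only
        omega
      have : Finset.Iio i = Finset.Iic (⟨i - 1, by omega⟩ : Fin N) := by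
        ext m
        simp only [Finset.mem_Iio, Finset.mem_Iic, Fin.lt_def, Fin.le_def]
        omega
      rw [this]
      exact (h2 _ hlt).le

theorem ae_lebesgue_coord_ne (i : Fin d) (c : ℝ) : ∀ᵐ x ∂lebesgue d, (x i : ℝ) ≠ c := by
  have h1 : ∀ᵐ t : Set.Ico (0 : ℝ) 1 ∂lebesgueIco, (t : ℝ) ≠ c := by
    have : {t : Set.Ico (0 : ℝ) 1 | (t : ℝ) = c}.Subsingleton :=
      fun a ha b hb => Subtype.ext (ha.trans hb.symm)
    simpa [ae_iff] using this.measure_zero lebesgueIco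
  exact (measurePreserving_eval (fun _ : Fin d => lebesgueIco) i).quasiMeasurePreserving.ae h1

/-- The indicator of `{key ≤ a}` is continuous wherever the key is continuous and differs from `a`.
The key equals `a` at most at the point `H a`, so the exceptional points are Lebesgue null, hence
`μ`-null. -/
theorem tendsto_sum_key_le {ι : Type*} {l : Filter ι} {N : ι → ℕ} (hN : ∀ i, 0 < N i)
    (hd : 1 ≤ d) (hH : IsHilbertCurve H) (hh : ∀ x, H (h x) = x) (hm : Measurable h)
    {x : ∀ i, Fin (N i) → Cube d} {w : ∀ i, Fin (N i) → ℝ} (hw : ∀ i n, 0 ≤ w i n)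
    {μ : Measure (Cube d)} [IsFiniteMeasure μ] (hac : μ ≪ lebesgue d)
    (hx : WTendsto l x w μ) (a : unitInterval) :
    Tendsto (fun i => ∑ n with (h (toClosedCube (x i n)) : ℝ) ≤ a, w i n) l
      (𝓝 (μ.real {x | h (toClosedCube x) ≤ a})) := by
  have hk : Measurable fun x : Cube d => h (toClosedCube x) :=
    hm.comp continuous_toClosedCube.measurable
  have hms : MeasurableSet {x : Cube d | h (toClosedCube x) ≤ a} := hk measurableSet_Iic
  have h1 := hx.tendsto_sum hN hw
    (g := fun _ => {x : Cube d | h (toClosedCube x) ≤ a}.indicator fun _ => (1 : ℝ))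
    (g₀ := {x : Cube d | h (toClosedCube x) ≤ a}.indicator fun _ => (1 : ℝ))
    (measurable_const.indicator hms) (B := 1)
    (fun _ e => by by_cases he : h (toClosedCube e) ≤ a <;> simp [he]) ?_
  · rw [integral_indicator hms] at h1
    simp only [integral_const, smul_eq_mul, mul_one, measureReal_restrict_apply_univ] at h1
    refine h1.congr fun i => ?_
    rw [Finset.sum_filter]
    refine Finset.sum_congr rfl fun n _ => ?_
    by_cases he : h (toClosedCube (x i n)) ≤ a
    · have he' : (h (toClosedCube (x i n)) : ℝ) ≤ a := he
      simp [he, he']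
    · have he' : ¬ (h (toClosedCube (x i n)) : ℝ) ≤ a := he
      simp [he, he']
  · have hae : ∀ᵐ e ∂lebesgue d, (∀ (i : Fin d) (m j : ℕ), (e i : ℝ) ≠ j / 2 ^ m) ∧
        (e ⟨0, hd⟩ : ℝ) ≠ H a ⟨0, hd⟩ := by
      refine Eventually.and ?_ (ae_lebesgue_coord_ne _ _)
      simp only [ae_all_iff]
      exact fun i m j => ae_lebesgue_coord_ne i _
    filter_upwards [hac.ae_le hae] with e he
    have hcont := hH.continuousAt_key hd hh he.1
    have hne : h (toClosedCube e) ≠ a := fun hea => he.2 (by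
      rw [← hea, hh]
      rfl)
    suffices hs : Tendsto ({x : Cube d | h (toClosedCube x) ≤ a}.indicator fun _ => (1 : ℝ)) (𝓝 e)
        (𝓝 ({x : Cube d | h (toClosedCube x) ≤ a}.indicator (fun _ => (1 : ℝ)) e)) from
      hs.comp tendsto_snd
    refine tendsto_const_nhds.congr' ?_
    rcases lt_or_gt_of_ne hne with hlt | hgt
    · filter_upwards [(tendsto_order.1 hcont.tendsto).2 a hlt] with e' he'
      simp [hlt.le, he'.le]
    · filter_upwards [(tendsto_order.1 hcont.tendsto).1 a hgt] with e' he'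
      simp [not_le.2 hgt, not_le.2 he']

/-- Hilbert-sorted resampling converges to the quantile of the limit distribution along the
curve. -/
theorem tendsto_resample {ι : Type*} {l : Filter ι} {N : ι → ℕ} (hN : ∀ i, 0 < N i)
    (hd : 1 ≤ d) (hH : IsHilbertCurve H) (hh : ∀ x, H (h x) = x) (hm : Measurable h)
    {x : ∀ i, Fin (N i) → Cube d} {w : ∀ i, Fin (N i) → ℝ} (hw : ∀ i n, 0 ≤ w i n)
    (hsum : ∀ᶠ i in l, ∑ n, w i n = 1)
    {μ : Measure (Cube d)} [IsProbabilityMeasure μ] (hac : μ ≪ lebesgue d)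
    (hpos : μ.IsOpenPosMeasure) (hx : WTendsto l x w μ) {v : ι → Set.Ico (0 : ℝ) 1}
    {v₀ : Set.Ico (0 : ℝ) 1} (hv : Tendsto v l (𝓝 v₀)) (n₀ : ∀ i, Fin (N i))
    (hgood : ∀ i, (H (keyQuantile h μ v₀) i : ℝ) < 1) :
    Tendsto (fun i => resample (fun x => (h (toClosedCube x) : ℝ)) (x i) (w i) (v i) (n₀ i)) l
      (𝓝 (curveQuantile H h μ v₀)) := by
  have hk : Measurable fun x : Cube d => h (toClosedCube x) :=
    hm.comp continuous_toClosedCube.measurable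
  set y := fun i => resample (fun x => (h (toClosedCube x) : ℝ)) (x i) (w i) (v i) (n₀ i) with hy
  have hF := tendsto_sum_key_le hN hd hH hh hm hw hac hx
  have hv' : Tendsto (fun i => (v i : ℝ)) l (𝓝 (v₀ : ℝ)) :=
    (continuous_subtype_val.tendsto v₀).comp hv
  have hspec : ∀ᶠ i in l,
      (v i : ℝ) ≤ ∑ n with (h (toClosedCube (x i n)) : ℝ) ≤ h (toClosedCube (y i)), w i n ∧
      ∑ n with (h (toClosedCube (x i n)) : ℝ) < h (toClosedCube (y i)), w i n ≤ v i := by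
    filter_upwards [hsum] with i hi
    exact resample_spec (fun x => (h (toClosedCube x) : ℝ)) (x i) (hw i) (v i).2.1
      (by rw [hi]; exact (v i).2.2.le) (n₀ i)
  have hkey : Tendsto (fun i => h (toClosedCube (y i))) l (𝓝 (keyQuantile h μ v₀)) := by
    refine tendsto_order.2 ⟨fun a ha => ?_, fun b hb => ?_⟩
    -- Below the quantile the limiting mass is less than `v₀`, so the weight of keys up to `a` is
    -- eventually less than `v i`: too small for resampling to stop there.
    · have h1 : μ.real {x | h (toClosedCube x) ≤ a} < v₀ :=
        not_le.1 fun hle => absurd ha (not_lt.2 ((keyQuantile_le_iff hm μ v₀.2.2.le a).2 hle))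
      filter_upwards [hspec, (hF a).eventually_lt hv' h1] with i hi hlt
      by_contra hcon
      have h2 : h (toClosedCube (y i)) ≤ a := not_lt.1 hcon
      refine absurd hi.1 (not_le.2 (lt_of_le_of_lt ?_ hlt))
      refine Finset.sum_le_sum_of_subset_of_nonneg (fun n hn => ?_) fun _ _ _ => hw _ _
      exact Finset.mem_filter.2 ⟨Finset.mem_univ _, (Finset.mem_filter.1 hn).2.trans h2⟩
    · obtain ⟨c, hc, hcb⟩ := exists_between hb
      -- Up to the quantile the mass is only known to be at least `v₀`. The open set `V` of keys
      -- between `b'` and `c` has positive mass, which leaves room for `v i` and the weights to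
      -- fluctuate.
      obtain ⟨b', hb', hbc⟩ := exists_between hc
      have h1 : (v₀ : ℝ) ≤ μ.real {x | h (toClosedCube x) ≤ b'} :=
        (keyQuantile_le_iff hm μ v₀.2.2.le b').1 hb'.le
      obtain ⟨V, hVo, hVne, hV⟩ := hH.exists_isOpen_key hd hh hbc
      have h2 : 0 < μ.real V :=
        ENNReal.toReal_pos (hVo.measure_pos μ hVne).ne' (measure_ne_top _ _)
      have h3 : μ.real {x | h (toClosedCube x) ≤ b'} + μ.real V ≤
          μ.real {x | h (toClosedCube x) ≤ c} := by
        have hdisj : Disjoint {x : Cube d | h (toClosedCube x) ≤ b'} V :=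
          Set.disjoint_left.2 fun x hx hxV => absurd (hV x hxV).1 (not_lt.2 hx)
        rw [← measureReal_union hdisj hVo.measurableSet]
        refine measureReal_mono (Set.union_subset (fun x hx => le_trans hx hbc.le) fun x hx => ?_)
        exact (hV x hx).2.le
      filter_upwards [hspec, hv'.eventually_lt (hF c) (by linarith)] with i hi hlt
      by_contra hcon
      have h4 : c < h (toClosedCube (y i)) := hcb.trans_le (not_lt.1 hcon)
      refine absurd hi.2 (not_le.2 (lt_of_lt_of_le hlt ?_))
      refine Finset.sum_le_sum_of_subset_of_nonneg (fun n hn => ?_) fun _ _ _ => hw _ _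
      exact Finset.mem_filter.2 ⟨Finset.mem_univ _, (Finset.mem_filter.1 hn).2.trans_lt h4⟩
  -- A point is recovered from its key through `H`, so convergence of the keys suffices.
  have hcomp := (continuousAt_fromClosed hgood).tendsto.comp ((hH.continuous.tendsto _).comp hkey)
  refine hcomp.congr fun i => ?_
  simp only [Function.comp, hh, fromClosed_toClosedCube]

end Quantile

/-! ### Rosenblatt transforms -/

section Rosenblatt

variable {d : ℕ}

/-- Boxes in the first `k` coordinates have positive mass by induction: the conditional probability
of `a i < x i ≤ b i` is positive by strict monotonicity, and it is integrated over a set of positive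
mass. -/
theorem IsRosenblatt.isOpenPosMeasure {π : Measure (Cube d)} [IsProbabilityMeasure π]
    {F : Cube d → Fin d → ℝ} (hR : IsRosenblatt π F)
    (hmono : ∀ i x, StrictMono fun c => F (Function.update x i c) i) : π.IsOpenPosMeasure := by
  have key : ∀ (a b : Cube d), (∀ i, a i < b i) → ∀ k ≤ d,
      π {x | ∀ i : Fin d, i.val < k → a i < x i ∧ x i ≤ b i} ≠ 0 := by
    intro a b hab k
    induction k with
    | zero => simp
    | succ k ih =>
      intro hk
      have ih := ih (by omega)
      set i : Fin d := ⟨k, by omega⟩ with hi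
      obtain ⟨-, -, -, -, hmeas, hint⟩ := hR i
      set A : Set ({j : Fin d // j < i} → Set.Ico (0 : ℝ) 1) :=
        {y | ∀ j : {j : Fin d // j < i}, a j < y j ∧ y j ≤ b j} with hA
      have hAm : MeasurableSet A := by
        simp only [hA, Set.ofPred_forall]
        exact MeasurableSet.iInter fun j => (measurableSet_lt measurable_const
          (by fun_prop)).inter (measurableSet_le (by fun_prop) measurable_const)
      have hAeq : {x : Cube d | (fun j : {j : Fin d // j < i} => x j) ∈ A} =
          {x | ∀ i : Fin d, i.val < k → a i < x i ∧ x i ≤ b i} := by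
        ext x
        exact ⟨fun h j hj => h ⟨j, hj⟩, fun h j => h j j.2⟩
      have hlt := setLIntegral_strict_mono (μ := π)
        (s := {x : Cube d | (fun j : {j : Fin d // j < i} => x j) ∈ A})
        (f := fun x => ENNReal.ofReal (F (Function.update x i (a i)) i))
        (g := fun x => ENNReal.ofReal (F (Function.update x i (b i)) i))
        ((by fun_prop : Measurable fun (x : Cube d) (j : {j : Fin d // j < i}) => x j) hAm)
        (by rw [hAeq]; exact ih) (hmeas (b i)).ennreal_ofReal
        (by rw [hint A hAm]; exact measure_ne_top _ _)
        (Eventually.of_forall fun x _ => by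
          have h1 := hmono i x (hab i)
          have h2 := ((hR i).2.1 (Function.update x i (a i))).1
          exact (ENNReal.ofReal_lt_ofReal_iff (h2.trans_lt h1)).2 h1)
      rw [hint A hAm, hint A hAm] at hlt
      intro h0
      refine absurd hlt (not_lt.2 ?_)
      refine (measure_mono (t := {x : Cube d | (fun j : {j : Fin d // j < i} => x j) ∈ A ∧
        x i ≤ a i} ∪ {x | ∀ i : Fin d, i.val < k + 1 → a i < x i ∧ x i ≤ b i}) ?_).trans
        ((measure_union_le _ _).trans (by rw [h0, add_zero]))
      rintro x ⟨hxA, hxb⟩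
      by_cases hxa : x i ≤ a i
      · exact Or.inl ⟨hxA, hxa⟩
      · refine Or.inr fun j hj => ?_
        rcases Nat.lt_succ_iff_lt_or_eq.1 hj with hj | hj
        · exact hxA ⟨j, hj⟩
        · have : j = i := Fin.ext hj
          rw [this]
          exact ⟨not_le.1 hxa, hxb⟩
  refine ⟨fun U hU hne => ?_⟩
  obtain ⟨x, hx⟩ := hne
  obtain ⟨a, b, hab, -, hsub⟩ := Cube.exists_Icc_subset hU hx
  refine fun h0 => key a b hab d le_rfl (measure_mono_null (fun y hy => hsub ?_) h0)
  exact ⟨fun i => (hy i i.2).1.le, fun i => (hy i i.2).2⟩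

theorem JointlyHolder.continuous {F : Cube d → Cube d → Fin d → ℝ} (hF : JointlyHolder F) :
    Continuous fun p : Cube d × Cube d => F p.1 p.2 := by
  obtain ⟨C, r, hr, h⟩ := hF
  exact h.continuous hr

/-- A conditional law with a density has no atom at zero. This is the lower end of the intermediate
value argument for surjectivity. -/
theorem BoundedCondDensities.apply_zero {F : Cube d → Cube d → Fin d → ℝ}
    (hF : BoundedCondDensities F) (x' x : Cube d) (i : Fin d) :
    F x' (Function.update x i ⟨0, le_rfl, one_pos⟩) i = 0 := by
  obtain ⟨p, C, -, h⟩ := hF i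
  rw [(h x' x).2]
  have : Set.Iic (⟨0, le_rfl, one_pos⟩ : Set.Ico (0 : ℝ) 1) = {⟨0, le_rfl, one_pos⟩} := by
    ext s
    exact ⟨fun hs => Subtype.ext (le_antisymm hs s.2.1), fun hs => le_of_eq hs⟩
  rw [this, Measure.restrict_eq_zero.2 (measure_singleton _), integral_zero_measure]

/-- The defining identities see the conditional distribution functions only through integrals, but
the supremum one is needed at every `x₀`. A deficit `ε` at `x₀` spreads, by uniform continuity, as a
deficit `ε / 2` for all `c` simultaneously on a ball of positive mass; then the mass of `x i ≤ c`
stays away from one as `c` increases to one. -/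
theorem IsRosenblatt.exists_one_sub_lt {π : Measure (Cube d)} [IsProbabilityMeasure π]
    {F : Cube d → Fin d → ℝ} (hR : IsRosenblatt π F)
    (hmono : ∀ i x, StrictMono fun c => F (Function.update x i c) i)
    (hF : UniformContinuous F) (x₀ : Cube d) (i : Fin d) {ε : ℝ} (hε : 0 < ε) :
    ∃ c, 1 - ε < F (Function.update x₀ i c) i := by
  by_contra! hcon
  have hpos := hR.isOpenPosMeasure hmono
  obtain ⟨-, h01, -, -, hmeas, hint⟩ := hR i
  have hε1 : ε ≤ 1 := by
    have h1 := (h01 (Function.update x₀ i (x₀ i))).1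
    have h2 := hcon (x₀ i)
    linarith
  obtain ⟨δ, hδ, hFδ⟩ := Metric.uniformContinuous_iff.1 hF (ε / 2) (by linarith)
  set U := Metric.ball x₀ δ with hU
  have hb : ∀ x ∈ U, ∀ c, F (Function.update x i c) i ≤ 1 - ε / 2 := by
    intro x hx c
    have h1 : dist (Function.update x i c) (Function.update x₀ i c) < δ := by
      refine lt_of_le_of_lt ((dist_pi_le_iff dist_nonneg).2 fun j => ?_) (Metric.mem_ball.1 hx)
      by_cases hj : j = i
      · subst hj
        simp
      · simp only [Function.update_of_ne hj]
        exact dist_le_pi_dist x x₀ j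
    have h2 := (dist_le_pi_dist _ _ i).trans_lt (hFδ h1)
    rw [Real.dist_eq] at h2
    have := hcon c
    linarith [(abs_lt.1 h2).2]
  have hUm : MeasurableSet U := Metric.isOpen_ball.measurableSet
  have hUpos : π U ≠ 0 := (Metric.isOpen_ball.measure_pos π ⟨x₀, Metric.mem_ball_self hδ⟩).ne'
  set q := π Uᶜ + ENNReal.ofReal (1 - ε / 2) * π U with hq
  have hle : ∀ c, π {x | x i ≤ c} ≤ q := by
    intro c
    have h1 := hint Set.univ MeasurableSet.univ c
    simp only [Set.mem_univ, true_and, Set.ofPred_true, Measure.restrict_univ] at h1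
    rw [← h1, ← lintegral_add_compl _ hUm, add_comm, hq]
    refine add_le_add ?_ ?_
    · refine (setLIntegral_mono measurable_const (g := fun _ => 1) fun x _ => ?_).trans (by simp)
      exact ENNReal.ofReal_le_one.2 (h01 _).2
    · refine (setLIntegral_mono measurable_const
        (g := fun _ => ENNReal.ofReal (1 - ε / 2)) fun x hx => ?_).trans (by simp)
      exact ENNReal.ofReal_le_ofReal (hb x hx c)
  have hq1 : 1 ≤ q := by
    have hc : ∀ n : ℕ, (0 : ℝ) ≤ 1 - 1 / (n + 1) ∧ (1 : ℝ) - 1 / (n + 1) < 1 := fun n => by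
      have h1 : (0 : ℝ) < 1 / (n + 1) := by positivity
      have h2 : (1 : ℝ) / (n + 1) ≤ 1 := by
        rw [div_le_one (by positivity)]
        linarith [(Nat.cast_nonneg n : (0 : ℝ) ≤ n)]
      constructor <;> linarith
    have hmon : Monotone fun n : ℕ => {x : Cube d | x i ≤ ⟨1 - 1 / (n + 1), hc n⟩} := by
      intro m n hmn x hx
      refine le_trans (show x i ≤ _ from hx) (Subtype.mk_le_mk.2 ?_)
      have : (m : ℝ) ≤ n := by exact_mod_cast hmn
      gcongr
    have huniv : ⋃ n : ℕ, {x : Cube d | x i ≤ ⟨1 - 1 / (n + 1), hc n⟩} = Set.univ := by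
      refine Set.eq_univ_of_forall fun x => Set.mem_iUnion.2 ?_
      obtain ⟨n, hn⟩ := exists_nat_one_div_lt (show (0 : ℝ) < 1 - x i by linarith [(x i).2.2])
      have hle : (x i : ℝ) ≤ 1 - 1 / (n + 1) := by linarith
      exact ⟨n, hle⟩
    rw [← measure_univ (μ := π), ← huniv, hmon.measure_iUnion]
    exact iSup_le fun n => hle _
  have hsum : q + ENNReal.ofReal (ε / 2) * π U = 1 := by
    rw [hq, add_assoc, ← add_mul, ← ENNReal.ofReal_add (by linarith) (by linarith)]
    simp only [sub_add_cancel, ENNReal.ofReal_one, one_mul]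
    rw [add_comm, measure_add_measure_compl hUm, measure_univ]
  have hpos' : 0 < ENNReal.ofReal (ε / 2) * π U :=
    ENNReal.mul_pos (by simpa using hε) hUpos
  have : (1 : ℝ≥0∞) < 1 := calc
    (1 : ℝ≥0∞) < 1 + ENNReal.ofReal (ε / 2) * π U :=
      ENNReal.lt_add_right ENNReal.one_ne_top hpos'.ne'
    _ ≤ q + ENNReal.ofReal (ε / 2) * π U := by gcongr
    _ = 1 := hsum
  exact lt_irrefl _ this

/-- The equations are solved one coordinate at a time by the intermediate value theorem; changing a
later coordinate does not disturb earlier equations. -/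
theorem exists_forall_rosenblatt_eq {F : Cube d → Fin d → ℝ}
    (hdep : ∀ i (x y : Cube d), (∀ j ≤ i, x j = y j) → F x i = F y i)
    (hF : Continuous F) (h0 : ∀ x i, F (Function.update x i ⟨0, le_rfl, one_pos⟩) i = 0)
    (h1 : ∀ x i (ε : ℝ), 0 < ε → ∃ c, 1 - ε < F (Function.update x i c) i) (v : Cube d) :
    ∃ x, ∀ i, F x i = v i := by
  have key : ∀ k ≤ d, ∃ x, ∀ i : Fin d, i.val < k → F x i = v i := by
    intro k
    induction k with
    | zero => exact fun _ => ⟨v, by simp⟩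
    | succ k ih =>
      intro hk
      obtain ⟨x, hx⟩ := ih (by omega)
      set i : Fin d := ⟨k, by omega⟩ with hi
      obtain ⟨b, hb⟩ := h1 x i (1 - v i) (by linarith [(v i).2.2])
      have hc : Continuous fun c => F (Function.update x i c) i :=
        (continuous_apply i).comp (hF.comp (continuous_const.update i continuous_id))
      have : PreconnectedSpace (Set.Ico (0 : ℝ) 1) :=
        Subtype.preconnectedSpace isPreconnected_Ico
      obtain ⟨c, hc⟩ := mem_range_of_exists_le_of_exists_ge (c := (v i : ℝ)) hc
        ⟨⟨0, le_rfl, one_pos⟩, (h0 x i).trans_le (v i).2.1⟩ ⟨b, by linarith⟩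
      refine ⟨Function.update x i c, fun j hj => ?_⟩
      rcases Nat.lt_succ_iff_lt_or_eq.1 hj with hj | hj
      · rw [← hx j hj]
        refine hdep j _ _ fun k hk => Function.update_of_ne (fun hki => ?_) _ _
        rw [hki] at hk
        exact absurd hj (not_lt.2 hk)
      · have : j = i := Fin.ext hj
        rw [this]
        exact hc
  obtain ⟨x, hx⟩ := key d le_rfl
  exact ⟨x, fun i => hx i i.2⟩

/-- This is continuity of the inverse, jointly in the parameter and without compactness: inductively
in `i`, strict monotonicity traps `x n i` between any `a < x₀ i < b`. -/
theorem tendsto_of_tendsto_rosenblatt {X ι : Type*} [TopologicalSpace X]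
    {F : X → Cube d → Fin d → ℝ}
    (hdep : ∀ x' i (x y : Cube d), (∀ j ≤ i, x j = y j) → F x' x i = F x' y i)
    (hF : Continuous fun p : X × Cube d => F p.1 p.2)
    (hmono : ∀ x' i x, StrictMono fun c => F x' (Function.update x i c) i) {l : Filter ι}
    {x' : ι → X} {x : ι → Cube d} {x'₀ : X} {x₀ : Cube d} (hx' : Tendsto x' l (𝓝 x'₀))
    (hFx : Tendsto (fun n => F (x' n) (x n)) l (𝓝 (F x'₀ x₀))) : Tendsto x l (𝓝 x₀) := by
  rw [tendsto_pi_nhds]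
  intro i
  induction i using WellFoundedLT.induction with
  | ind i ih =>
    -- Coordinates not yet known to converge are frozen at those of `x₀`; after coordinate `i` is
    -- set to `b`, its transform does not see the later ones.
    have hz : Tendsto (fun n j => if j < i then x n j else x₀ j) l (𝓝 x₀) := by
      refine tendsto_pi_nhds.2 fun j => ?_
      by_cases hj : j < i
      · simpa [hj] using ih j hj
      · simpa [hj] using tendsto_const_nhds
    have hlim : ∀ b, Tendsto (fun n => F (x' n) (Function.update (x n) i b) i) l
        (𝓝 (F x'₀ (Function.update x₀ i b) i)) := by
      intro b
      have h1 := (hF.tendsto _).comp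
        (hx'.prodMk_nhds (hz.update i (tendsto_const_nhds (x := b))))
      refine (tendsto_pi_nhds.1 h1 i).congr fun n => hdep _ _ _ _ fun j hj => ?_
      rcases hj.lt_or_eq with hj | rfl
      · simp [Function.update_of_ne hj.ne, hj]
      · simp
    have hFi := tendsto_pi_nhds.1 hFx i
    have hself : ∀ x' (x : Cube d), F x' x i = F x' (Function.update x i (x i)) i := by simp
    refine tendsto_order.2 ⟨fun a ha => ?_, fun b hb => ?_⟩
    · have h1 : F x'₀ (Function.update x₀ i a) i < F x'₀ x₀ i := by
        rw [hself x'₀ x₀]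
        exact hmono x'₀ i x₀ ha
      filter_upwards [(hlim a).eventually_lt hFi h1] with n hn
      rw [hself _ (x n)] at hn
      exact (hmono (x' n) i (x n)).lt_iff_lt.1 hn
    · have h1 : F x'₀ x₀ i < F x'₀ (Function.update x₀ i b) i := by
        rw [hself x'₀ x₀]
        exact hmono x'₀ i x₀ hb
      filter_upwards [hFi.eventually_lt (hlim b) h1] with n hn
      rw [hself _ (x n)] at hn
      exact (hmono (x' n) i (x n)).lt_iff_lt.1 hn

/-! ### Inverse Rosenblatt transforms: existence, joint continuity, image of the uniform law -/

variable {π : Cube d → Measure (Cube d)} {F : Cube d → Cube d → Fin d → ℝ}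

theorem rosenblatt_rosenblattInv (hp : ∀ x', IsProbabilityMeasure (π x'))
    (hR : ∀ x', IsRosenblatt (π x') (F x')) (hmono : CoordStrictMono F) (hH : JointlyHolder F)
    (hB : BoundedCondDensities F) (x' v : Cube d) (i : Fin d) :
    F x' (rosenblattInv (F x') v) i = v i := by
  have hex : ∃ x, ∀ i, F x' x i = v i := by
    have hu : UniformContinuous (F x') := by
      obtain ⟨C, r, hr, h⟩ := hH
      have hpair : UniformContinuous fun x : Cube d => (x', x) :=
        uniformContinuous_const.prodMk uniformContinuous_id
      exact (h.uniformContinuous hr).comp hpair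
    refine exists_forall_rosenblatt_eq (fun i => (hR x' i).1) hu.continuous
      (fun x i => hB.apply_zero x' x i) (fun x i ε hε => ?_) v
    have := hp x'
    exact (hR x').exists_one_sub_lt (fun i x => hmono i x' x) hu x i hε
  rw [rosenblattInv, dif_pos hex]
  exact hex.choose_spec i

theorem continuous_rosenblattInv (hp : ∀ x', IsProbabilityMeasure (π x'))
    (hR : ∀ x', IsRosenblatt (π x') (F x')) (hmono : CoordStrictMono F) (hH : JointlyHolder F)
    (hB : BoundedCondDensities F) :
    Continuous fun p : Cube d × Cube d => rosenblattInv (F p.1) p.2 := by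
  refine continuous_iff_continuousAt.2 fun p => ?_
  refine tendsto_of_tendsto_rosenblatt (F := F) (fun x' i => (hR x' i).1) hH.continuous
    (fun x' i x => hmono i x' x) (continuous_fst.tendsto p) ?_
  refine tendsto_pi_nhds.2 fun i => ?_
  simp only [rosenblatt_rosenblattInv hp hR hmono hH hB]
  exact (by fun_prop : Continuous fun p : Cube d × Cube d => (p.2 i : ℝ)).tendsto p

theorem measure_pi_ext_Iic {ι : Type*} [Fintype ι] {μ ν : Measure (ι → Set.Ico (0 : ℝ) 1)}
    [IsProbabilityMeasure μ] [IsProbabilityMeasure ν]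
    (h : ∀ a : ι → Set.Ico (0 : ℝ) 1, μ {y | ∀ j, y j ≤ a j} = ν {y | ∀ j, y j ≤ a j}) : μ = ν := by
  have hspan : IsCountablySpanning (Set.range (Set.Iic : Set.Ico (0 : ℝ) 1 → _)) := by
    have hc : ∀ n : ℕ, (0 : ℝ) ≤ 1 - 1 / (n + 1) ∧ (1 : ℝ) - 1 / (n + 1) < 1 := fun n => by
      have h1 : (0 : ℝ) < 1 / (n + 1) := by positivity
      have h2 : (1 : ℝ) / (n + 1) ≤ 1 := by
        rw [div_le_one (by positivity)]
        linarith [(Nat.cast_nonneg n : (0 : ℝ) ≤ n)]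
      constructor <;> linarith
    refine ⟨fun n => Set.Iic ⟨1 - 1 / (n + 1), hc n⟩, fun n => ⟨_, rfl⟩, ?_⟩
    refine Set.eq_univ_of_forall fun x => Set.mem_iUnion.2 ?_
    obtain ⟨n, hn⟩ := exists_nat_one_div_lt (show (0 : ℝ) < 1 - x by linarith [x.2.2])
    have hle : (x : ℝ) ≤ 1 - 1 / (n + 1) := by linarith
    exact ⟨n, hle⟩
  have hgen : (MeasurableSpace.pi : MeasurableSpace (ι → Set.Ico (0 : ℝ) 1)) =
      MeasurableSpace.generateFrom (Set.pi Set.univ ''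
        Set.pi Set.univ fun _ : ι => Set.range (Set.Iic : Set.Ico (0 : ℝ) 1 → _)) := by
    rw [← generateFrom_pi_eq fun _ => hspan]
    congr 1
    funext _
    rw [← borel_eq_generateFrom_Iic]
    exact BorelSpace.measurable_eq
  refine ext_of_generate_finite _ hgen (IsPiSystem.pi fun _ => isPiSystem_Iic) ?_ (by simp)
  rintro _ ⟨s, hs, rfl⟩
  choose a ha using fun i => hs i (Set.mem_univ i)
  have : Set.pi Set.univ s = {y | ∀ j, y j ≤ a j} := by
    ext y
    simp [Set.mem_pi, ← ha]
  rw [this]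
  exact h a

/-- Coordinate `i` is integrated out first: neither `B` nor `g` depends on it, and a uniform variate
lies below `g v` with probability `g v`. -/
theorem lebesgue_setOf_coord_le (i : Fin d) {B : Set (Cube d)} (hB : MeasurableSet B)
    {g : Cube d → ℝ} (hg : Measurable g) (hg0 : ∀ v, 0 ≤ g v ∧ g v ≤ 1)
    (hBi : ∀ v s, Function.update v i s ∈ B ↔ v ∈ B)
    (hgi : ∀ v s, g (Function.update v i s) = g v) :
    lebesgue d {v | v ∈ B ∧ (v i : ℝ) ≤ g v} = ∫⁻ v in B, ENNReal.ofReal (g v) ∂lebesgue d := by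
  have hm : MeasurableSet {v | v ∈ B ∧ (v i : ℝ) ≤ g v} :=
    hB.inter (measurableSet_le (by fun_prop) hg)
  rw [← lintegral_indicator_one hm, ← lintegral_indicator hB]
  refine lintegral_eq_of_lmarginal_eq {i} (measurable_one.indicator hm)
    (hg.ennreal_ofReal.indicator hB) ?_
  funext v
  rw [lmarginal_singleton, lmarginal_singleton]
  by_cases hv : v ∈ B
  · have h1 : ∀ s, {v | v ∈ B ∧ (v i : ℝ) ≤ g v}.indicator (1 : Cube d → ℝ≥0∞)
        (Function.update v i s) =
        {s : Set.Ico (0 : ℝ) 1 | (s : ℝ) ≤ g v}.indicator (1 : Set.Ico (0 : ℝ) 1 → ℝ≥0∞) s := by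
      intro s
      by_cases hs : (s : ℝ) ≤ g v
      · rw [Set.indicator_of_mem, Set.indicator_of_mem]
        · rfl
        · exact hs
        · exact ⟨(hBi v s).2 hv, by simpa [hgi] using hs⟩
      · rw [Set.indicator_of_notMem, Set.indicator_of_notMem]
        · exact hs
        · exact fun hcon => hs (by simpa [hgi] using hcon.2)
    have h2 : ∀ s, B.indicator (fun v => ENNReal.ofReal (g v)) (Function.update v i s) =
        ENNReal.ofReal (g v) := by
      intro s
      rw [Set.indicator_of_mem ((hBi v s).2 hv), hgi]
    simp only [h1, h2]
    rw [lintegral_indicator_one (measurableSet_le (by fun_prop) measurable_const),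
      lebesgueIco_setOf_le (hg0 v).1 (hg0 v).2]
    simp
  · have h1 : ∀ s, {v | v ∈ B ∧ (v i : ℝ) ≤ g v}.indicator (1 : Cube d → ℝ≥0∞)
        (Function.update v i s) = 0 := fun s =>
      Set.indicator_of_notMem (fun hcon => hv ((hBi v s).1 hcon.1)) _
    have h2 : ∀ s, B.indicator (fun v => ENNReal.ofReal (g v)) (Function.update v i s) = 0 :=
      fun s => Set.indicator_of_notMem (fun hcon => hv ((hBi v s).1 hcon)) _
    simp only [h1, h2]

/-- The inverse Rosenblatt transform maps the uniform distribution to `π`. -/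
theorem map_rosenblattInv (hp : ∀ x', IsProbabilityMeasure (π x'))
    (hR : ∀ x', IsRosenblatt (π x') (F x')) (hmono : CoordStrictMono F) (hH : JointlyHolder F)
    (hB : BoundedCondDensities F) (x' : Cube d) :
    (lebesgue d).map (rosenblattInv (F x')) = π x' := by
  have := hp x'
  set T := rosenblattInv (F x') with hT
  have hTF : ∀ v i, F x' (T v) i = v i := rosenblatt_rosenblattInv hp hR hmono hH hB x'
  have hTm : Measurable T := ((continuous_rosenblattInv hp hR hmono hH hB).comp
    (continuous_const.prodMk continuous_id (f := fun _ => x'))).measurable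
  have : IsProbabilityMeasure ((lebesgue d).map T) :=
    Measure.isProbabilityMeasure_map hTm.aemeasurable
  have hself : ∀ (x : Cube d) i, F x' x i = F x' (Function.update x i (x i)) i := by simp
  have hTle : ∀ v i c, T v i ≤ c ↔ (v i : ℝ) ≤ F x' (Function.update (T v) i c) i := by
    intro v i c
    rw [← hTF v i, hself (T v) i]
    exact ((hmono i x' (T v)).le_iff_le).symm
  -- The inverse is triangular because `F` is triangular and injective in each coordinate.
  have hTdep : ∀ (v w : Cube d) (i : Fin d), (∀ j ≤ i, v j = w j) → T v i = T w i := by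
    intro v w i
    induction i using WellFoundedLT.induction with
    | ind i ih =>
      intro hvw
      refine (hmono i x' (T w)).injective ?_
      have h1 : F x' (Function.update (T w) i (T v i)) i = F x' (T v) i := by
        refine (hR x' i).1 _ _ fun j hj => ?_
        rcases hj.lt_or_eq with hj' | rfl
        · rw [Function.update_of_ne hj'.ne]
          exact (ih j hj' fun k hk => hvw k (hk.trans hj)).symm
        · simp
      have h2 : F x' (Function.update (T w) i (T w i)) i = F x' (T w) i := (hself _ _).symm
      rw [h1, h2, hTF, hTF, hvw i le_rfl]
  -- Induction on the number of coordinates: agreement on lower orthants identifies the marginal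
  -- laws, against which the conditional distribution function of the next coordinate is then
  -- integrated.
  have key : ∀ k ≤ d, ∀ a : Cube d, lebesgue d {v | ∀ j : Fin d, j.val < k → T v j ≤ a j} =
      π x' {x | ∀ j : Fin d, j.val < k → x j ≤ a j} := by
    intro k
    induction k with
    | zero => simp
    | succ k ih =>
      intro hk a
      set i : Fin d := ⟨k, by omega⟩ with hi
      -- Padding by zeros turns a function of the cube that depends only on coordinates below `i`
      -- into a function on the marginal space.
      let e : ({j : Fin d // j < i} → Set.Ico (0 : ℝ) 1) → Cube d :=
        fun y j => if hj : j < i then y ⟨j, hj⟩ else ⟨0, le_rfl, one_pos⟩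
      let R : Cube d → ({j : Fin d // j < i} → Set.Ico (0 : ℝ) 1) := fun x j => x j
      have hRm : Measurable R := by fun_prop
      have hem : Measurable e := by
        refine measurable_pi_lambda _ fun j => ?_
        by_cases hj : j < i
        · simpa [e, hj] using measurable_pi_apply _
        · simp [e, hj]
      have heR : ∀ x j, j < i → e (R x) j = x j := fun x j hj => by simp [e, R, hj]
      have hlaw : ((lebesgue d).map T).map R = (π x').map R := by
        have := Measure.isProbabilityMeasure_map (μ := π x') hRm.aemeasurable
        have := Measure.isProbabilityMeasure_map (μ := (lebesgue d).map T) hRm.aemeasurable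
        refine measure_pi_ext_Iic fun b => ?_
        have hbm : MeasurableSet {y : {j : Fin d // j < i} → Set.Ico (0 : ℝ) 1 | ∀ j, y j ≤ b j} := by
          simp only [Set.ofPred_forall]
          exact MeasurableSet.iInter fun j => measurableSet_le (by fun_prop) measurable_const
        rw [Measure.map_apply hRm hbm, Measure.map_apply hRm hbm,
          Measure.map_apply hTm (hRm hbm)]
        have h1 := ih (by omega) (e b)
        have hb : ∀ x : Cube d, (∀ j : Fin d, j.val < k → x j ≤ e b j) ↔ ∀ j, R x j ≤ b j := by
          intro x
          constructor
          · intro h j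
            have := h j j.2
            simpa [e, R, j.2] using this
          · intro h j hj
            have hj' : j < i := hj
            simpa [e, R, hj'] using h ⟨j, hj'⟩
        have h2 : ∀ f : Cube d → Cube d, {v | ∀ j : Fin d, j.val < k → f v j ≤ e b j} =
            f ⁻¹' (R ⁻¹' {y | ∀ j, y j ≤ b j}) := fun f => Set.ext fun v => hb (f v)
        rw [h2] at h1
        exact h1.trans (congrArg (π x') (h2 id))
      obtain ⟨hdep, h01, -, -, hmeas, hint⟩ := hR x' i
      set A : Set ({j : Fin d // j < i} → Set.Ico (0 : ℝ) 1) := {y | ∀ j : {j : Fin d // j < i}, y j ≤ a j} with hA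
      have hAm : MeasurableSet A := by
        simp only [hA, Set.ofPred_forall]
        exact MeasurableSet.iInter fun j => measurableSet_le (by fun_prop) measurable_const
      set Φ : Cube d → ℝ := fun x => F x' (Function.update x i (a i)) i with hΦ
      have hΦm : Measurable Φ := hmeas (a i)
      have hΦdep : ∀ x y : Cube d, (∀ j < i, x j = y j) → Φ x = Φ y := by
        intro x y hxy
        refine hdep _ _ fun j hj => ?_
        rcases hj.lt_or_eq with hj | rfl
        · rw [Function.update_of_ne hj.ne, Function.update_of_ne hj.ne, hxy j hj]
        · simp
      have hTu : ∀ v s, ∀ j < i, T (Function.update v i s) j = T v j := fun v s j hj =>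
        hTdep _ _ j fun k hk => Function.update_of_ne (hk.trans_lt hj).ne _ _
      have hsplit : ∀ x : Cube d, (∀ j : Fin d, j.val < k + 1 → x j ≤ a j) ↔
          R x ∈ A ∧ x i ≤ a i := by
        intro x
        constructor
        · exact fun h => ⟨fun j => h j (Nat.lt_succ_of_lt j.2), h i (Nat.lt_succ_self _)⟩
        · rintro ⟨h1, h2⟩ j hj
          rcases Nat.lt_succ_iff_lt_or_eq.1 hj with hj | hj
          · exact h1 ⟨j, hj⟩
          · have : j = i := Fin.ext hj
            rwa [this]
      have hR' : ∀ v s, R (T (Function.update v i s)) = R (T v) := fun v s => by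
        funext j
        exact hTu v s j j.2
      have hΦe : Measurable fun y => ENNReal.ofReal (Φ (e y)) := (hΦm.comp hem).ennreal_ofReal
      have hΦR : Measurable fun x => ENNReal.ofReal (Φ (e (R x))) := hΦe.comp hRm
      calc lebesgue d {v | ∀ j : Fin d, j.val < k + 1 → T v j ≤ a j}
          = lebesgue d {v | v ∈ (R ∘ T) ⁻¹' A ∧ (v i : ℝ) ≤ Φ (T v)} := by
            congr 1
            ext v
            exact (hsplit (T v)).trans (and_congr_right fun _ => hTle v i (a i))
        _ = ∫⁻ v in (R ∘ T) ⁻¹' A, ENNReal.ofReal (Φ (T v)) ∂lebesgue d := by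
            refine lebesgue_setOf_coord_le i ((hRm.comp hTm) hAm) (hΦm.comp hTm)
              (fun v => h01 _) (fun v s => ?_) fun v s => hΦdep _ _ (hTu v s)
            simp only [Set.mem_preimage, Function.comp, hR']
        _ = ∫⁻ y in A, ENNReal.ofReal (Φ (e y)) ∂((lebesgue d).map T).map R := by
            rw [setLIntegral_map hAm hΦe hRm, setLIntegral_map (hRm hAm) hΦR hTm]
            refine lintegral_congr fun v => ?_
            rw [hΦdep _ _ (heR (T v))]
        _ = ∫⁻ x in R ⁻¹' A, ENNReal.ofReal (Φ x) ∂π x' := by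
            rw [hlaw, setLIntegral_map hAm hΦe hRm]
            refine lintegral_congr fun v => ?_
            rw [hΦdep _ _ (heR v)]
        _ = π x' {x | R x ∈ A ∧ x i ≤ a i} := hint A hAm (a i)
        _ = _ := by
            congr 1
            ext x
            exact (hsplit x).symm
  refine measure_pi_ext_Iic fun a => ?_
  rw [Measure.map_apply hTm]
  · have := key d le_rfl a
    simpa using this
  · simp only [Set.ofPred_forall]
    exact MeasurableSet.iInter fun j => measurableSet_le (by fun_prop) measurable_const

end Rosenblatt

/-! ### The uniform distribution on a product -/

instance (k : ℕ) : (lebesgue k).IsOpenPosMeasure := by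
  have : lebesgueIco.IsOpenPosMeasure := by
    refine ⟨fun U hU hne h0 => ?_⟩
    obtain ⟨x, hx⟩ := hne
    obtain ⟨a, b, hab, -, hsub⟩ := Cube.exists_Icc_subset (k := 1)
      (U := (fun v : Cube 1 => v 0) ⁻¹' U) (hU.preimage (continuous_apply 0)) (x := fun _ => x) hx
    have h1 : lebesgueIco (Set.Icc (a 0) (b 0)) = 0 := by
      refine measure_mono_null (fun y hy => ?_) h0
      refine hsub (a := fun _ => y) ⟨fun i => ?_, fun i => ?_⟩
      · rw [Subsingleton.elim i 0]
        exact hy.1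
      · rw [Subsingleton.elim i 0]
        exact hy.2
    rw [lebesgueIco_Icc, ENNReal.ofReal_eq_zero] at h1
    exact absurd (Subtype.coe_lt_coe.2 (hab 0)) (not_lt.2 (sub_nonpos.1 h1))
  unfold lebesgue
  infer_instance

theorem measurePreserving_last_init (k : ℕ) :
    MeasurePreserving (fun v : Cube (k + 1) => (v (Fin.last k), (Fin.init v : Cube k)))
      (lebesgue (k + 1)) (lebesgueIco.prod (lebesgue k)) := by
  have h := measurePreserving_piFinSuccAbove (fun _ : Fin (k + 1) => lebesgueIco) (Fin.last k)
  have he : (fun v : Cube (k + 1) => (v (Fin.last k), (Fin.init v : Cube k))) =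
      MeasurableEquiv.piFinSuccAbove (fun _ : Fin (k + 1) => Set.Ico (0 : ℝ) 1) (Fin.last k) := by
    funext v
    exact Prod.ext rfl (Fin.removeNth_last v).symm
  rw [he]
  exact h

theorem measurePreserving_head_tail (k : ℕ) :
    MeasurePreserving (fun v : Cube (k + 1) => (v 0, (Fin.tail v : Cube k)))
      (lebesgue (k + 1)) (lebesgueIco.prod (lebesgue k)) :=
  measurePreserving_piFinSuccAbove (fun _ : Fin (k + 1) => lebesgueIco) 0

theorem measurable_coord {d n : ℕ} (j : Fin n) : Measurable fun x : Fin n → Cube d => x j :=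
  measurable_pi_apply j

theorem measurable_snoc {d t : ℕ} : Measurable fun p : (Fin t → Cube d) × Cube d =>
    (Fin.snoc p.1 p.2 : Fin (t + 1) → Cube d) := by
  refine measurable_pi_lambda _ fun j => ?_
  induction j using Fin.lastCases with
  | last => simpa using measurable_snd
  | cast j =>
    simp only [Fin.snoc_castSucc]
    exact (measurable_coord j).comp measurable_fst

namespace Model

variable {d : ℕ} (M : Model d)

instance : IsProbabilityMeasure M.m0 := M.prob_m0
instance (t : ℕ) : IsMarkovKernel (M.m t) := M.markov_m t

/-! ### Recursions for the smoothing and filtering distributions -/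

instance (t : ℕ) : IsProbabilityMeasure (M.pathLaw t) := by
  induction t with
  | zero => exact Measure.isProbabilityMeasure_map (by fun_prop)
  | succ t ih => exact Measure.isProbabilityMeasure_map measurable_snoc.aemeasurable

theorem lintegral_pathLaw_succ (t : ℕ) {f : (Fin (t + 2) → Cube d) → ℝ≥0∞} (hf : Measurable f) :
    ∫⁻ x, f x ∂M.pathLaw (t + 1) =
      ∫⁻ p, ∫⁻ y, f (Fin.snoc p y) ∂M.m (t + 1) (p (Fin.last t)) ∂M.pathLaw t := by
  have h : Measurable fun p : (Fin (t + 1) → Cube d) × Cube d =>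
      f (Fin.snoc p.1 p.2 : Fin (t + 2) → Cube d) := hf.comp measurable_snoc
  rw [pathLaw, lintegral_map hf measurable_snoc, Measure.lintegral_compProd h]
  rfl

theorem measurable_pathWeight (t : ℕ) : Measurable (M.pathWeight t) := by
  refine (M.measurable_G0.comp (measurable_pi_apply 0)).mul (Finset.measurable_fun_prod _ fun s _ => ?_)
  exact (M.measurable_G _).comp ((measurable_coord s.castSucc).prodMk (measurable_coord s.succ))

theorem pathWeight_nonneg (t : ℕ) (x : Fin (t + 1) → Cube d) : 0 ≤ M.pathWeight t x :=
  mul_nonneg (M.G0_nonneg _) (Finset.prod_nonneg fun _ _ => M.G_nonneg _ _ _)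

theorem pathWeight_snoc (t : ℕ) (p : Fin (t + 1) → Cube d) (y : Cube d) :
    M.pathWeight (t + 1) (Fin.snoc p y) = M.pathWeight t p * M.G (t + 1) (p (Fin.last t)) y := by
  have h0 : (Fin.snoc p y : Fin (t + 2) → Cube d) 0 = p 0 := by
    rw [← Fin.castSucc_zero, Fin.snoc_castSucc (α := fun _ => Cube d)]
  have h1 : ∀ s : Fin t, (Fin.snoc p y : Fin (t + 2) → Cube d) s.castSucc.succ = p s.succ := by
    intro s
    rw [Fin.succ_castSucc, Fin.snoc_castSucc (α := fun _ => Cube d)]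
  simp only [pathWeight, Fin.prod_univ_castSucc, Fin.snoc_castSucc (α := fun _ => Cube d), h0, h1,
    Fin.succ_last, Fin.snoc_last, Fin.val_castSucc, Fin.val_last, mul_assoc]

theorem lintegral_smooth (t : ℕ) {f : (Fin (t + 1) → Cube d) → ℝ≥0∞} (hf : Measurable f) :
    ∫⁻ x, f x ∂M.smooth t =
      (M.Z t)⁻¹ * ∫⁻ x, ENNReal.ofReal (M.pathWeight t x) * f x ∂M.pathLaw t := by
  rw [smooth, lintegral_smul_measure,
    lintegral_withDensity_eq_lintegral_mul _ (M.measurable_pathWeight t).ennreal_ofReal hf]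
  rfl

theorem measurable_lintegral_G (t : ℕ) {f : (Fin (t + 2) → Cube d) → ℝ≥0∞} (hf : Measurable f) :
    Measurable fun p : Fin (t + 1) → Cube d => ∫⁻ y, ENNReal.ofReal
      (M.G (t + 1) (p (Fin.last t)) y) * f (Fin.snoc p y) ∂M.m (t + 1) (p (Fin.last t)) := by
  have hg : Measurable fun q : (Fin (t + 1) → Cube d) × Cube d =>
      ENNReal.ofReal (M.G (t + 1) (q.1 (Fin.last t)) q.2) * f (Fin.snoc q.1 q.2) := by
    refine Measurable.mul ?_ (hf.comp measurable_snoc)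
    exact ((M.measurable_G (t + 1)).comp
      (((measurable_coord (Fin.last t)).comp measurable_fst).prodMk measurable_snd)).ennreal_ofReal
  exact Measurable.lintegral_kernel_prod_right' (κ := (M.m (t + 1)).comap
    (fun x : Fin (t + 1) → Cube d => x (Fin.last t)) (measurable_coord _)) hg

/-- The unnormalised path measures satisfy the recursion without a constant; the factor exchanges
the two normalisations, and cancelling `M.Z t` requires it to be neither zero nor infinite. -/
theorem lintegral_smooth_succ (t : ℕ) (h0 : M.Z t ≠ 0) (h1 : M.Z t ≠ ∞)
    {f : (Fin (t + 2) → Cube d) → ℝ≥0∞} (hf : Measurable f) :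
    ∫⁻ x, f x ∂M.smooth (t + 1) = M.Z t / M.Z (t + 1) *
      ∫⁻ p, ∫⁻ y, ENNReal.ofReal (M.G (t + 1) (p (Fin.last t)) y) * f (Fin.snoc p y)
        ∂M.m (t + 1) (p (Fin.last t)) ∂M.smooth t := by
  have hwf : Measurable fun x => ENNReal.ofReal (M.pathWeight (t + 1) x) * f x :=
    (M.measurable_pathWeight _).ennreal_ofReal.mul hf
  rw [lintegral_smooth _ _ hf, lintegral_smooth _ _ (M.measurable_lintegral_G t hf),
    lintegral_pathLaw_succ _ _ hwf]
  have : ∀ p : Fin (t + 1) → Cube d, ∫⁻ y, ENNReal.ofReal (M.pathWeight (t + 1) (Fin.snoc p y)) *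
      f (Fin.snoc p y) ∂M.m (t + 1) (p (Fin.last t)) = ENNReal.ofReal (M.pathWeight t p) *
      ∫⁻ y, ENNReal.ofReal (M.G (t + 1) (p (Fin.last t)) y) * f (Fin.snoc p y)
        ∂M.m (t + 1) (p (Fin.last t)) := by
    intro p
    rw [← lintegral_const_mul']
    · refine lintegral_congr fun y => ?_
      rw [pathWeight_snoc, ENNReal.ofReal_mul (M.pathWeight_nonneg t p), mul_assoc]
    · exact ENNReal.ofReal_ne_top
  simp only [this]
  rw [← mul_assoc, ENNReal.div_eq_inv_mul, mul_assoc, mul_assoc, ← mul_assoc (M.Z t) (M.Z t)⁻¹,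
    ENNReal.mul_inv_cancel h0 h1, one_mul]

theorem lintegral_filt_succ (t : ℕ) (h0 : M.Z t ≠ 0) (h1 : M.Z t ≠ ∞)
    {f : Cube d → ℝ≥0∞} (hf : Measurable f) :
    ∫⁻ x, f x ∂M.filt (t + 1) = M.Z t / M.Z (t + 1) *
      ∫⁻ x', ∫⁻ y, ENNReal.ofReal (M.G (t + 1) x' y) * f y ∂M.m (t + 1) x' ∂M.filt t := by
  have hm : Measurable fun x' => ∫⁻ y, ENNReal.ofReal (M.G (t + 1) x' y) * f y ∂M.m (t + 1) x' :=
    Measurable.lintegral_kernel_prod_right' (κ := M.m (t + 1))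
      ((M.measurable_G (t + 1)).ennreal_ofReal.mul (hf.comp measurable_snd))
  have hf' : Measurable fun x : Fin (t + 2) → Cube d => f (x (Fin.last (t + 1))) :=
    hf.comp (measurable_coord _)
  rw [filt, filt, lintegral_map hf (measurable_coord _), lintegral_map hm (measurable_coord _),
    lintegral_smooth_succ _ _ h0 h1 hf']
  simp [Fin.snoc_last]

/-! ### Normalising constants and total masses -/

theorem smooth_apply_univ (t : ℕ) : M.smooth t Set.univ = (M.Z t)⁻¹ * M.Z t := by
  simp [smooth, Z]

/-- In `ℝ≥0∞` the total mass `Z⁻¹ * Z` is zero both for `Z = 0` and for `Z = ∞`, so a nonzero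
filtering distribution excludes both. -/
theorem Z_ne_of_filt_ne_zero {t : ℕ} (h : M.filt t ≠ 0) : M.Z t ≠ 0 ∧ M.Z t ≠ ∞ := by
  have hu : M.smooth t Set.univ ≠ 0 := by
    intro h0
    rw [Measure.measure_univ_eq_zero] at h0
    exact h (by rw [filt, h0, Measure.map_zero])
  rw [smooth_apply_univ] at hu
  constructor
  · rintro h0
    simp [h0] at hu
  · rintro h0
    simp [h0] at hu

theorem isProbabilityMeasure_smooth {t : ℕ} (h0 : M.Z t ≠ 0) (h1 : M.Z t ≠ ∞) :
    IsProbabilityMeasure (M.smooth t) :=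
  ⟨by rw [smooth_apply_univ, ENNReal.inv_mul_cancel h0 h1]⟩

theorem isProbabilityMeasure_filt {t : ℕ} (h0 : M.Z t ≠ 0) (h1 : M.Z t ≠ ∞) :
    IsProbabilityMeasure (M.filt t) := by
  have := M.isProbabilityMeasure_smooth h0 h1
  exact Measure.isProbabilityMeasure_map (measurable_coord _).aemeasurable

theorem filt_zero : M.filt 0 =
    (M.Z 0)⁻¹ • M.m0.withDensity fun x => ENNReal.ofReal (M.G0 x) := by
  ext s hs
  have hm : Measurable fun x : Fin (0 + 1) → Cube d => x (Fin.last 0) := measurable_coord _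
  have hc : Measurable fun (x : Cube d) (_ : Fin (0 + 1)) => x := by fun_prop
  rw [filt, Measure.map_apply hm hs, ← lintegral_indicator_one (hm hs),
    lintegral_smooth _ _ (measurable_one.indicator (hm hs)), pathLaw, lintegral_map _ hc,
    Measure.smul_apply, withDensity_apply _ hs, ← lintegral_indicator hs, smul_eq_mul]
  · congr 1
    refine lintegral_congr fun x => ?_
    by_cases hx : x ∈ s
    · rw [Set.indicator_of_mem hx, Set.indicator_of_mem (by exact hx)]
      simp [pathWeight]
    · rw [Set.indicator_of_notMem hx, Set.indicator_of_notMem (by exact hx), mul_zero]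
  · exact (M.measurable_pathWeight 0).ennreal_ofReal.mul (measurable_one.indicator (hm hs))

theorem lintegral_m (t : ℕ) (x' : Cube d) {f : Cube d → ℝ≥0∞} (hf : Measurable f) :
    ∫⁻ y, f y ∂M.m t x' = ∫⁻ y, ENNReal.ofReal (M.dens t x' y) * f y ∂lebesgue d := by
  rw [M.m_eq, lintegral_withDensity_eq_lintegral_mul _ _ hf]
  · rfl
  · exact ((M.measurable_dens t).comp (measurable_const.prodMk measurable_id)).ennreal_ofReal

theorem measurable_densG (t : ℕ) :
    Measurable fun p : Cube d × Cube d => M.dens t p.1 p.2 * M.G t p.1 p.2 :=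
  (M.measurable_dens t).mul (M.measurable_G t)

theorem densG_nonneg (t : ℕ) (x' x : Cube d) : 0 ≤ M.dens t x' x * M.G t x' x :=
  mul_nonneg (M.dens_pos t x' x).le (M.G_nonneg t x' x)

/-- The filtering recursion, with the integral over the past inside. -/
theorem lintegral_lintegral_G_swap (t : ℕ) (π : Measure (Cube d)) [SFinite π]
    {f : Cube d → Cube d → ℝ≥0∞} (hf : Measurable fun p : Cube d × Cube d => f p.1 p.2) :
    ∫⁻ x', ∫⁻ y, ENNReal.ofReal (M.G t x' y) * f x' y ∂M.m t x' ∂π =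
      ∫⁻ y, ∫⁻ x', ENNReal.ofReal (M.dens t x' y * M.G t x' y) * f x' y ∂π ∂lebesgue d := by
  rw [lintegral_lintegral_swap]
  · refine lintegral_congr fun x' => ?_
    rw [M.lintegral_m t x']
    · refine lintegral_congr fun y => ?_
      rw [ENNReal.ofReal_mul (M.dens_pos t x' y).le, mul_assoc]
    · have h2 : Measurable fun y : Cube d => (x', y) := measurable_prodMk_left
      exact ((M.measurable_G t).comp h2).ennreal_ofReal.mul (hf.comp h2)
  · have h2 : Measurable fun p : Cube d × Cube d => (p.2, p.1) := measurable_swap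
    exact (((M.measurable_densG t).comp h2).ennreal_ofReal.mul (hf.comp h2)).aemeasurable

/-! ### The backward kernels -/

/-- Consequences of the assumptions on the model up to time `T`. -/
structure Regular (M : Model d) (T : ℕ) : Prop where
  Z_ne_zero : ∀ t ≤ T, M.Z t ≠ 0
  Z_ne_top : ∀ t ≤ T, M.Z t ≠ ∞
  filt_ac : ∀ t ≤ T, M.filt t ≪ lebesgue d
  filt_pos : ∀ t ≤ T, (M.filt t).IsOpenPosMeasure
  normalizer_pos : ∀ t, t + 1 ≤ T → ∀ y,
    0 < ∫ x', M.dens (t + 1) x' y * M.G (t + 1) x' y ∂M.filt t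
  continuous_Gtilde : ∀ t, t + 1 ≤ T →
    Continuous fun p : Cube d × Cube d => M.Gtilde (t + 1) (M.filt t) p.1 p.2
  bounded_Gtilde : ∀ t, t + 1 ≤ T → ∃ B : ℝ, ∀ x' x, |M.Gtilde (t + 1) (M.filt t) x' x| ≤ B
  back_prob : ∀ t, t + 1 ≤ T → ∀ y,
    IsProbabilityMeasure (M.backKernel (t + 1) (M.filt t) y)
  back_pos : ∀ t, t + 1 ≤ T → ∀ y, (M.backKernel (t + 1) (M.filt t) y).IsOpenPosMeasure

theorem Gtilde_nonneg (t : ℕ) (π : Measure (Cube d)) (x' x : Cube d) : 0 ≤ M.Gtilde t π x' x :=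
  div_nonneg (M.densG_nonneg t x' x) (integral_nonneg fun y => M.densG_nonneg t y x)

theorem isOpenPosMeasure_of_density {p : Cube d → ℝ} (hp : Measurable p) (hpos : ∀ x, 0 < p x) :
    ((lebesgue d).withDensity fun x => ENNReal.ofReal (p x)).IsOpenPosMeasure := by
  refine (withDensity_absolutelyContinuous' hp.ennreal_ofReal.aemeasurable
    (Eventually.of_forall fun x => ?_)).isOpenPosMeasure
  simpa using hpos x

/-- By the filtering recursion the normaliser of `Gtilde` is, up to a constant, the density of the
next filtering distribution; hence it is positive and finite almost everywhere, and there the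
integral is one. By dominated convergence the integral is continuous in `y`, and Lebesgue measure
charges open sets, so equality holds at every `y`. -/
theorem integral_Gtilde_eq_one {t : ℕ}
    (h0 : M.Z t ≠ 0) (h1 : M.Z t ≠ ∞)
    (h0' : M.Z (t + 1) ≠ 0) (h1' : M.Z (t + 1) ≠ ∞) {p : Cube d → ℝ} (hpm : Measurable p)
    (hp : ∀ x, 0 < p x)
    (hdens : M.filt (t + 1) = (lebesgue d).withDensity fun x => ENNReal.ofReal (p x))
    (hc : Continuous fun p : Cube d × Cube d => M.Gtilde (t + 1) (M.filt t) p.1 p.2)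
    {B : ℝ} (hB : ∀ x' x, |M.Gtilde (t + 1) (M.filt t) x' x| ≤ B) (y : Cube d) :
    ∫ x', M.Gtilde (t + 1) (M.filt t) x' y ∂M.filt t = 1 := by
  have := M.isProbabilityMeasure_filt h0 h1
  have := M.isProbabilityMeasure_filt h0' h1'
  set D : Cube d → ℝ≥0∞ :=
    fun y => ∫⁻ x', ENNReal.ofReal (M.dens (t + 1) x' y * M.G (t + 1) x' y) ∂M.filt t with hD
  have hDm : Measurable D :=
    Measurable.lintegral_prod_left' ((M.measurable_densG (t + 1)).ennreal_ofReal)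
  set c := M.Z t / M.Z (t + 1) with hcdef
  have hc0 : c ≠ 0 := ENNReal.div_ne_zero.2 ⟨h0, h1'⟩
  have hct : c ≠ ∞ := ENNReal.div_ne_top h1 h0'
  have hfilt : M.filt (t + 1) = (lebesgue d).withDensity fun y => c * D y := by
    ext s hs
    rw [← lintegral_indicator_one hs, M.lintegral_filt_succ t h0 h1 (measurable_one.indicator hs),
      M.lintegral_lintegral_G_swap (t + 1) (M.filt t)
        (f := fun _ y => s.indicator 1 y) ((measurable_one.indicator hs).comp measurable_snd),
      withDensity_apply _ hs, lintegral_const_mul _ hDm, ← lintegral_indicator hs]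
    congr 1
    refine lintegral_congr fun y => ?_
    by_cases hy : y ∈ s
    · simp [hy, hD]
    · simp [hy]
  have hae : ∀ᵐ y ∂lebesgue d, c * D y = ENNReal.ofReal (p y) := by
    refine (withDensity_eq_iff_of_sigmaFinite (hDm.const_mul c).aemeasurable
      hpm.ennreal_ofReal.aemeasurable).1 ?_
    rw [← hfilt, hdens]
  have hgood : ∀ᵐ y ∂lebesgue d, ∫ x', M.Gtilde (t + 1) (M.filt t) x' y ∂M.filt t = 1 := by
    filter_upwards [hae] with y hy
    have hDt : D y ≠ ∞ := by
      intro h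
      rw [h, ENNReal.mul_top hc0] at hy
      exact ENNReal.ofReal_ne_top hy.symm
    have hD0 : D y ≠ 0 := by
      intro h
      rw [h, mul_zero] at hy
      exact absurd (ENNReal.ofReal_eq_zero.1 hy.symm) (not_le.2 (hp y))
    have hint : ∫ x', M.dens (t + 1) x' y * M.G (t + 1) x' y ∂M.filt t = (D y).toReal := by
      rw [integral_eq_lintegral_of_nonneg_ae]
      · exact Eventually.of_forall fun x' => M.densG_nonneg _ _ _
      · exact ((M.measurable_densG (t + 1)).comp measurable_prodMk_right).aestronglyMeasurable
    simp only [Gtilde]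
    rw [integral_div, hint, div_self]
    exact (ENNReal.toReal_pos hD0 hDt).ne'
  have hA : Continuous fun y => ∫ x', M.Gtilde (t + 1) (M.filt t) x' y ∂M.filt t := by
    refine continuous_of_dominated (bound := fun _ => B) (fun y => ?_) (fun y => ?_)
      (integrable_const _) ?_
    · exact (hc.comp (continuous_id.prodMk continuous_const)).aestronglyMeasurable
    · exact Eventually.of_forall fun x' => hB x' y
    · exact Eventually.of_forall fun x' => hc.comp (continuous_const.prodMk continuous_id)
  exact congrFun (Continuous.ae_eq_iff_eq (lebesgue d) hA continuous_const |>.1 hgood) y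

variable {M} {T : ℕ}

theorem Regular.isProbabilityMeasure_filt (hM : M.Regular T) {t : ℕ} (ht : t ≤ T) :
    IsProbabilityMeasure (M.filt t) :=
  M.isProbabilityMeasure_filt (hM.Z_ne_zero t ht) (hM.Z_ne_top t ht)

theorem Regular.measurable_Gtilde (hM : M.Regular T) {t : ℕ} (ht : t + 1 ≤ T) :
    Measurable fun p : Cube d × Cube d => M.Gtilde (t + 1) (M.filt t) p.1 p.2 :=
  (hM.continuous_Gtilde t ht).measurable

theorem Regular.lintegral_backKernel (hM : M.Regular T) {t : ℕ} (ht : t + 1 ≤ T) (y : Cube d)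
    {f : Cube d → ℝ≥0∞} (hf : Measurable f) :
    ∫⁻ x', f x' ∂M.backKernel (t + 1) (M.filt t) y =
      ∫⁻ x', ENNReal.ofReal (M.Gtilde (t + 1) (M.filt t) x' y) * f x' ∂M.filt t := by
  rw [backKernel, lintegral_withDensity_eq_lintegral_mul _ _ hf]
  · rfl
  · exact ((hM.measurable_Gtilde ht).comp measurable_prodMk_right).ennreal_ofReal

theorem Regular.measurable_backKernel (hM : M.Regular T) {t : ℕ} (ht : t + 1 ≤ T) :
    Measurable (M.backKernel (t + 1) (M.filt t)) := by
  have := hM.isProbabilityMeasure_filt (Nat.le_of_succ_le ht)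
  refine Measure.measurable_of_measurable_coe _ fun s hs => ?_
  have : ∀ y, M.backKernel (t + 1) (M.filt t) y s =
      ∫⁻ x', ENNReal.ofReal (M.Gtilde (t + 1) (M.filt t) x' y) * s.indicator 1 x' ∂M.filt t :=
    fun y => by
      rw [← hM.lintegral_backKernel ht y (measurable_one.indicator hs), lintegral_indicator_one hs]
  simp only [this]
  exact Measurable.lintegral_prod_left' ((hM.measurable_Gtilde ht).ennreal_ofReal.mul
    ((measurable_one.indicator hs).comp measurable_fst))

theorem Regular.back_ac (hM : M.Regular T) {t : ℕ} (ht : t + 1 ≤ T) (y : Cube d) :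
    M.backKernel (t + 1) (M.filt t) y ≪ lebesgue d :=
  (withDensity_absolutelyContinuous _ _).trans (hM.filt_ac t (Nat.le_of_succ_le ht))

theorem Regular.densG_eq (hM : M.Regular T) {t : ℕ} (ht : t + 1 ≤ T) (x' y : Cube d) :
    M.dens (t + 1) x' y * M.G (t + 1) x' y = M.Gtilde (t + 1) (M.filt t) x' y *
      ∫ x', M.dens (t + 1) x' y * M.G (t + 1) x' y ∂M.filt t := by
  rw [Gtilde, div_mul_cancel₀ _ (hM.normalizer_pos t ht y).ne']

/-- Reversal of the joint distribution of two successive states. -/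
theorem Regular.lintegral_backKernel_filt (hM : M.Regular T) {t : ℕ} (ht : t + 1 ≤ T)
    {f : Cube d → Cube d → ℝ≥0∞} (hf : Measurable fun p : Cube d × Cube d => f p.1 p.2) :
    ∫⁻ y, ∫⁻ x', f x' y ∂M.backKernel (t + 1) (M.filt t) y ∂M.filt (t + 1) =
      M.Z t / M.Z (t + 1) *
        ∫⁻ x', ∫⁻ y, ENNReal.ofReal (M.G (t + 1) x' y) * f x' y ∂M.m (t + 1) x' ∂M.filt t := by
  have := hM.isProbabilityMeasure_filt (Nat.le_of_succ_le ht)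
  have hfy : ∀ y, Measurable fun x' => f x' y := fun y =>
    hf.comp (measurable_id.prodMk measurable_const)
  have hm : Measurable fun y => ∫⁻ x', ENNReal.ofReal (M.Gtilde (t + 1) (M.filt t) x' y) * f x' y
      ∂M.filt t :=
    Measurable.lintegral_prod_left' ((hM.measurable_Gtilde ht).ennreal_ofReal.mul hf)
  simp only [fun y => hM.lintegral_backKernel ht y (hfy y)]
  rw [M.lintegral_filt_succ t (hM.Z_ne_zero t (Nat.le_of_succ_le ht))
    (hM.Z_ne_top t (Nat.le_of_succ_le ht)) hm,
    M.lintegral_lintegral_G_swap (t + 1) (M.filt t) (hm.comp measurable_snd),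
    M.lintegral_lintegral_G_swap (t + 1) (M.filt t) hf]
  congr 1
  refine lintegral_congr fun y => ?_
  have hDm : Measurable fun x' => ENNReal.ofReal (M.dens (t + 1) x' y * M.G (t + 1) x' y) :=
    ((M.measurable_densG (t + 1)).comp measurable_prodMk_right).ennreal_ofReal
  -- The integral of a non-integrable function is zero by convention, which a positive normaliser
  -- rules out.
  have hint : Integrable (fun x' => M.dens (t + 1) x' y * M.G (t + 1) x' y) (M.filt t) := by
    by_contra hcon
    have := hM.normalizer_pos t ht y
    rw [integral_undef hcon] at this
    exact lt_irrefl _ this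
  rw [lintegral_mul_const _ hDm, ← ofReal_integral_eq_lintegral_ofReal hint
    (Eventually.of_forall fun x' => M.densG_nonneg _ _ _), ← lintegral_const_mul']
  · refine lintegral_congr fun x' => ?_
    rw [← mul_assoc, ← ENNReal.ofReal_mul (hM.normalizer_pos t ht y).le, hM.densG_eq ht x' y,
      mul_comm (M.Gtilde _ _ _ _)]
  · exact ENNReal.ofReal_ne_top

end Model

/-! ### Limits of the backward trajectories -/

section LimitPath

variable {d : ℕ} {M : Model d} {T : ℕ} {H : unitInterval → Fin d → unitInterval}
  {h : (Fin d → unitInterval) → unitInterval}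

theorem measurable_init (t : ℕ) : Measurable fun v : Cube (t + 1) => (Fin.init v : Cube t) :=
  (measurable_snd.comp (measurePreserving_last_init t).measurable)

/-- The limit of the backward trajectories `x̃_0, …, x̃_t` with `x̃_t = y`. -/
def limitPath (M : Model d) (H : unitInterval → Fin d → unitInterval)
    (h : (Fin d → unitInterval) → unitInterval) :
    (t : ℕ) → Cube d → Cube t → (Fin (t + 1) → Cube d)
  | 0, y, _ => fun _ => y
  | t + 1, y, v =>
      Fin.snoc (limitPath M H h t
        (curveQuantile H h (M.backKernel (t + 1) (M.filt t) y) (v (Fin.last t))) (Fin.init v)) y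

theorem limitPath_last (t : ℕ) (y : Cube d) (v : Cube t) :
    limitPath M H h t y v (Fin.last t) = y := by
  cases t with
  | zero => rfl
  | succ t => simp [limitPath]

/-- The limit of the backward trajectories. -/
def limitTrajectory (M : Model d) (H : unitInterval → Fin d → unitInterval)
    (h : (Fin d → unitInterval) → unitInterval) (T : ℕ) (v : Cube (T + 1)) :
    Fin (T + 1) → Cube d :=
  limitPath M H h T (curveQuantile H h (M.filt T) (v (Fin.last T))) (Fin.init v)

/-- Along the limit trajectory the curve `H` does not meet the upper faces of the closed cube. -/
def GoodPath (M : Model d) (H : unitInterval → Fin d → unitInterval)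
    (h : (Fin d → unitInterval) → unitInterval) : (t : ℕ) → Cube d → Cube t → Prop
  | 0, _, _ => True
  | t + 1, y, v =>
      (∀ i, (H (keyQuantile h (M.backKernel (t + 1) (M.filt t) y) (v (Fin.last t))) i : ℝ) < 1) ∧
      GoodPath M H h t
        (curveQuantile H h (M.backKernel (t + 1) (M.filt t) y) (v (Fin.last t))) (Fin.init v)

/-- The backward step of the limit trajectory, as a function of the present state. -/
theorem Model.Regular.measurable_step (hM : M.Regular T) (hH : Continuous H) (hm : Measurable h)
    {t : ℕ} (ht : t + 1 ≤ T) : Measurable fun p : Cube d × Cube (t + 1) =>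
      (curveQuantile H h (M.backKernel (t + 1) (M.filt t) p.1) (p.2 (Fin.last t)),
        (Fin.init p.2 : Cube t)) := by
  have h1 := measurable_curveQuantile hH hm (hM.measurable_backKernel ht) (hM.back_prob t ht)
  have h2 : Measurable fun p : Cube d × Cube (t + 1) => (p.1, p.2 (Fin.last t)) := by fun_prop
  exact (h1.comp h2).prodMk ((measurable_init t).comp measurable_snd)

theorem Model.Regular.measurable_limitPath (hM : M.Regular T) (hH : Continuous H)
    (hm : Measurable h) {t : ℕ} (ht : t ≤ T) :
    Measurable fun p : Cube d × Cube t => limitPath M H h t p.1 p.2 := by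
  induction t with
  | zero => exact measurable_pi_lambda _ fun _ => measurable_fst
  | succ t ih =>
    exact measurable_snoc.comp (((ih (Nat.le_of_succ_le ht)).comp
      (hM.measurable_step hH hm ht)).prodMk measurable_fst)

theorem Model.Regular.measurableSet_goodPath (hM : M.Regular T) (hH : Continuous H)
    (hm : Measurable h) {t : ℕ} (ht : t ≤ T) :
    MeasurableSet {p : Cube d × Cube t | GoodPath M H h t p.1 p.2} := by
  induction t with
  | zero => simp [GoodPath]
  | succ t ih =>
    have h1 := (ih (Nat.le_of_succ_le ht)).preimage (hM.measurable_step hH hm ht)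
    have h2 := measurable_keyQuantile hm (hM.measurable_backKernel ht) (hM.back_prob t ht)
    have h3 : Measurable fun p : Cube d × Cube (t + 1) => (p.1, p.2 (Fin.last t)) := by fun_prop
    have h4 : MeasurableSet {p : Cube d × Cube (t + 1) | ∀ i, (H (keyQuantile h
        (M.backKernel (t + 1) (M.filt t) p.1) (p.2 (Fin.last t))) i : ℝ) < 1} := by
      simp only [Set.ofPred_forall]
      refine MeasurableSet.iInter fun i => measurableSet_lt ?_ measurable_const
      exact (by fun_prop : Continuous fun s => (H s i : ℝ)).measurable.comp (h2.comp h3)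
    exact h4.inter h1

/-- Fubini in the last coordinate of `v`. The statement is needed for every `y`, because the last
coordinate determines the state from which the remaining path starts. -/
theorem Model.Regular.ae_goodPath (hM : M.Regular T) (hH : Continuous H)
    (hh : ∀ x, H (h x) = x) (hm : Measurable h) {t : ℕ} (ht : t ≤ T) (y : Cube d) :
    ∀ᵐ v ∂lebesgue t, GoodPath M H h t y v := by
  induction t generalizing y with
  | zero => exact Eventually.of_forall fun _ => trivial
  | succ t ih =>
    have hp := hM.back_prob t ht y
    have hms : MeasurableSet {p : Set.Ico (0 : ℝ) 1 × Cube t |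
        (∀ i, (H (keyQuantile h (M.backKernel (t + 1) (M.filt t) y) p.1) i : ℝ) < 1) ∧
        GoodPath M H h t (curveQuantile H h (M.backKernel (t + 1) (M.filt t) y) p.1) p.2} := by
      have h2 := measurable_keyQuantile hm (hM.measurable_backKernel ht) (hM.back_prob t ht)
      have h1 := measurable_curveQuantile_right hH hm (M.backKernel (t + 1) (M.filt t) y)
      have h4 : MeasurableSet {p : Set.Ico (0 : ℝ) 1 × Cube t | ∀ i, (H (keyQuantile h
          (M.backKernel (t + 1) (M.filt t) y) p.1) i : ℝ) < 1} := by
        simp only [Set.ofPred_forall]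
        refine MeasurableSet.iInter fun i => measurableSet_lt ?_ measurable_const
        have h3 : Measurable fun p : Set.Ico (0 : ℝ) 1 × Cube t => (y, p.1) := by fun_prop
        exact (by fun_prop : Continuous fun s => (H s i : ℝ)).measurable.comp (h2.comp h3)
      exact h4.inter ((hM.measurableSet_goodPath hH hm (Nat.le_of_succ_le ht)).preimage
        ((h1.comp measurable_fst).prodMk measurable_snd))
    refine (measurePreserving_last_init t).quasiMeasurePreserving.ae
      (p := fun p => (∀ i, (H (keyQuantile h (M.backKernel (t + 1) (M.filt t) y) p.1) i : ℝ) < 1) ∧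
        GoodPath M H h t (curveQuantile H h (M.backKernel (t + 1) (M.filt t) y) p.1) p.2) ?_
    rw [Measure.ae_prod_iff_ae_ae hms]
    filter_upwards [ae_keyQuantile_lt_one hH hh hm (M.backKernel (t + 1) (M.filt t) y)] with s hs
    filter_upwards [ih (Nat.le_of_succ_le ht) _] with v hv
    exact ⟨hs, hv⟩

theorem lintegral_lebesgue_succ (t : ℕ) {f : Set.Ico (0 : ℝ) 1 → Cube t → ℝ≥0∞}
    (hf : Measurable fun p : Set.Ico (0 : ℝ) 1 × Cube t => f p.1 p.2) :
    ∫⁻ v : Cube (t + 1), f (v (Fin.last t)) (Fin.init v) ∂lebesgue (t + 1) =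
      ∫⁻ s, ∫⁻ v, f s v ∂lebesgue t ∂lebesgueIco := by
  rw [(measurePreserving_last_init t).lintegral_comp hf, lintegral_prod _ hf.aemeasurable]

theorem lintegral_curveQuantile (hH : Continuous H) (hh : ∀ x, H (h x) = x) (hm : Measurable h)
    (μ : Measure (Cube d)) [IsProbabilityMeasure μ] {f : Cube d → ℝ≥0∞} (hf : Measurable f) :
    ∫⁻ s : Set.Ico (0 : ℝ) 1, f (curveQuantile H h μ s) ∂lebesgueIco = ∫⁻ x, f x ∂μ := by
  rw [← lintegral_map hf (measurable_curveQuantile_right hH hm μ), map_curveQuantile hH hh hm]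

/-- Time reversal: under the smoothing distribution the path is a Markov chain run backwards from
the filtering distribution. In the induction step a uniform coordinate becomes a draw from the
backward kernel, and `lintegral_backKernel_filt` rewrites the law of two successive states in
forward form, where the recursion for `smooth` applies. -/
theorem Model.Regular.lintegral_limitPath (hM : M.Regular T) (hH : Continuous H)
    (hh : ∀ x, H (h x) = x) (hm : Measurable h) {t : ℕ} (ht : t ≤ T)
    {f : (Fin (t + 1) → Cube d) → ℝ≥0∞} (hf : Measurable f) :
    ∫⁻ y, ∫⁻ v, f (limitPath M H h t y v) ∂lebesgue t ∂M.filt t = ∫⁻ x, f x ∂M.smooth t := by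
  induction t with
  | zero =>
    have hc : Measurable fun (x : Cube d) => f fun _ : Fin (0 + 1) => x :=
      hf.comp (by fun_prop : Measurable fun (x : Cube d) (_ : Fin (0 + 1)) => x)
    simp only [limitPath, lintegral_const, measure_univ, mul_one]
    rw [Model.filt, lintegral_map hc (measurable_coord _)]
    refine lintegral_congr fun x => ?_
    congr 1
    funext i
    rw [show i = Fin.last 0 from Fin.ext (by simp)]
  | succ t ih =>
    have ht' := Nat.le_of_succ_le ht
    have hp := hM.isProbabilityMeasure_filt ht
    have hpath := hM.measurable_limitPath hH hm ht'
    have hfp : Measurable fun p : (Cube d × Cube t) × Cube d =>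
        f (Fin.snoc (limitPath M H h t p.1.1 p.1.2) p.2 : Fin (t + 2) → Cube d) :=
      hf.comp (measurable_snoc.comp ((hpath.comp measurable_fst).prodMk measurable_snd))
    have hinner : Measurable fun q : Cube d × Cube d =>
        ∫⁻ v, f (Fin.snoc (limitPath M H h t q.1 v) q.2 : Fin (t + 2) → Cube d) ∂lebesgue t := by
      refine Measurable.lintegral_prod_right' (f := fun p : (Cube d × Cube d) × Cube t =>
        f (Fin.snoc (limitPath M H h t p.1.1 p.2) p.1.2 : Fin (t + 2) → Cube d)) ?_
      have h1 : Measurable fun p : (Cube d × Cube d) × Cube t => ((p.1.1, p.2), p.1.2) := by fun_prop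
      exact hfp.comp h1
    have step : ∀ y, ∫⁻ v, f (limitPath M H h (t + 1) y v) ∂lebesgue (t + 1) =
        ∫⁻ x', ∫⁻ v, f (Fin.snoc (limitPath M H h t x' v) y : Fin (t + 2) → Cube d) ∂lebesgue t
          ∂M.backKernel (t + 1) (M.filt t) y := by
      intro y
      have hpb := hM.back_prob t ht y
      have hq := measurable_curveQuantile_right hH hm (M.backKernel (t + 1) (M.filt t) y)
      have h1 : Measurable fun p : Set.Ico (0 : ℝ) 1 × Cube t => f (Fin.snoc (limitPath M H h t
          (curveQuantile H h (M.backKernel (t + 1) (M.filt t) y) p.1) p.2) y :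
            Fin (t + 2) → Cube d) :=
        hfp.comp (((hq.comp measurable_fst).prodMk measurable_snd).prodMk measurable_const)
      have h2 : Measurable fun x' => ∫⁻ v, f (Fin.snoc (limitPath M H h t x' v) y :
          Fin (t + 2) → Cube d) ∂lebesgue t :=
        hinner.comp (measurable_id.prodMk measurable_const)
      rw [← lintegral_curveQuantile hH hh hm _ h2]
      exact lintegral_lebesgue_succ t (f := fun s v => f (Fin.snoc (limitPath M H h t
        (curveQuantile H h (M.backKernel (t + 1) (M.filt t) y) s) v) y)) h1
    simp only [step]
    rw [hM.lintegral_backKernel_filt ht hinner,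
      M.lintegral_smooth_succ t (hM.Z_ne_zero t ht') (hM.Z_ne_top t ht') hf,
      ← ih ht' (M.measurable_lintegral_G t hf)]
    congr 1
    refine lintegral_congr fun x' => ?_
    -- The potential in the recursion is evaluated at the last state of the path, which is `x'`, so
    -- it does not depend on `v`.
    simp only [limitPath_last]
    have hG : Measurable fun p : Cube d × Cube t => ENNReal.ofReal (M.G (t + 1) x' p.1) *
        f (Fin.snoc (limitPath M H h t x' p.2) p.1 : Fin (t + 2) → Cube d) := by
      refine Measurable.mul ?_ ?_
      · have h1 : Measurable fun p : Cube d × Cube t => (x', p.1) := by fun_prop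
        exact ((M.measurable_G (t + 1)).comp h1).ennreal_ofReal
      · have h1 : Measurable fun p : Cube d × Cube t => ((x', p.2), p.1) := by fun_prop
        exact hfp.comp h1
    rw [lintegral_lintegral_swap (by exact (hG.comp measurable_swap).aemeasurable)]
    refine lintegral_congr fun y => ?_
    rw [lintegral_const_mul']
    exact ENNReal.ofReal_ne_top

theorem Model.Regular.measurable_limitTrajectory (hM : M.Regular T) (hH : Continuous H)
    (hm : Measurable h) : Measurable (limitTrajectory M H h T) := by
  have hp := hM.isProbabilityMeasure_filt le_rfl
  have h1 := measurable_curveQuantile_right hH hm (M.filt T)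
  exact (hM.measurable_limitPath hH hm le_rfl).comp
    ((h1.comp (measurable_pi_apply (Fin.last T))).prodMk (measurable_init T))

theorem Model.Regular.map_limitTrajectory (hM : M.Regular T) (hH : Continuous H)
    (hh : ∀ x, H (h x) = x) (hm : Measurable h) :
    (lebesgue (T + 1)).map (limitTrajectory M H h T) = M.smooth T := by
  have hp := hM.isProbabilityMeasure_filt le_rfl
  refine Measure.ext_of_lintegral _ fun f hf => ?_
  rw [lintegral_map hf (hM.measurable_limitTrajectory hH hm), ← hM.lintegral_limitPath hH hh hm le_rfl hf]
  have hq := measurable_curveQuantile_right hH hm (M.filt T)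
  have hfp : Measurable fun p : Cube d × Cube T => f (limitPath M H h T p.1 p.2) :=
    hf.comp (hM.measurable_limitPath hH hm le_rfl)
  have h1 : Measurable fun p : Set.Ico (0 : ℝ) 1 × Cube T =>
      f (limitPath M H h T (curveQuantile H h (M.filt T) p.1) p.2) :=
    hfp.comp ((hq.comp measurable_fst).prodMk measurable_snd)
  rw [← lintegral_curveQuantile hH hh hm (M.filt T) (Measurable.lintegral_prod_right' hfp)]
  exact lintegral_lebesgue_succ T (f := fun s v => f (limitPath M H h T
    (curveQuantile H h (M.filt T) s) v)) h1

theorem Model.Regular.ae_goodTrajectory (hM : M.Regular T) (hH : Continuous H)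
    (hh : ∀ x, H (h x) = x) (hm : Measurable h) : ∀ᵐ v ∂lebesgue (T + 1),
    (∀ i, (H (keyQuantile h (M.filt T) (v (Fin.last T))) i : ℝ) < 1) ∧
      GoodPath M H h T (curveQuantile H h (M.filt T) (v (Fin.last T))) (Fin.init v) := by
  have hp := hM.isProbabilityMeasure_filt le_rfl
  have h1 := measurable_curveQuantile_right hH hm (M.filt T)
  have h2 := measurable_keyQuantile hm (measurable_const (a := M.filt T)) (fun _ : Unit => hp)
  have hms : MeasurableSet {p : Set.Ico (0 : ℝ) 1 × Cube T |
      (∀ i, (H (keyQuantile h (M.filt T) p.1) i : ℝ) < 1) ∧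
      GoodPath M H h T (curveQuantile H h (M.filt T) p.1) p.2} := by
    have h4 : MeasurableSet {p : Set.Ico (0 : ℝ) 1 × Cube T | ∀ i, (H (keyQuantile h
        (M.filt T) p.1) i : ℝ) < 1} := by
      simp only [Set.ofPred_forall]
      refine MeasurableSet.iInter fun i => measurableSet_lt ?_ measurable_const
      have h3 : Measurable fun p : Set.Ico (0 : ℝ) 1 × Cube T => ((), p.1) := by fun_prop
      exact (by fun_prop : Continuous fun s => (H s i : ℝ)).measurable.comp (h2.comp h3)
    exact h4.inter ((hM.measurableSet_goodPath hH hm le_rfl).preimage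
      ((h1.comp measurable_fst).prodMk measurable_snd))
  refine (measurePreserving_last_init T).quasiMeasurePreserving.ae
    (p := fun p => (∀ i, (H (keyQuantile h (M.filt T) p.1) i : ℝ) < 1) ∧
      GoodPath M H h T (curveQuantile H h (M.filt T) p.1) p.2) ?_
  rw [Measure.ae_prod_iff_ae_ae hms]
  filter_upwards [ae_keyQuantile_lt_one hH hh hm (M.filt T)] with s hs
  filter_upwards [hM.ae_goodPath hH hh hm le_rfl _] with v hv
  exact ⟨hs, hv⟩

end LimitPath

/-! ### Weighted point sets approximating a distribution -/

section Approximates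

theorem normalize_nonneg {N : ℕ} {a : Fin N → ℝ} (ha : ∀ n, 0 ≤ a n) (n : Fin N) :
    0 ≤ normalize a n :=
  div_nonneg (ha n) (Finset.sum_nonneg fun m _ => ha m)

theorem normalize_const_mul {N : ℕ} {c : ℝ} (hc : c ≠ 0) (a : Fin N → ℝ) :
    normalize (fun n => c * a n) = normalize a := by
  funext n
  rw [normalize, normalize, ← Finset.mul_sum, mul_div_mul_left _ _ hc]

/-- The weighted points `(x i n, w i n)` approximate `μ` for `i → l`. -/
structure Approximates {ι E : Type*} [TopologicalSpace E] [MeasurableSpace E] (l : Filter ι)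
    {N : ι → ℕ} (x : ∀ i, Fin (N i) → E) (w : ∀ i, Fin (N i) → ℝ) (μ : Measure E) : Prop where
  nonneg : ∀ i n, 0 ≤ w i n
  sum_eq_one : ∀ᶠ i in l, ∑ n, w i n = 1
  wTendsto : WTendsto l x w μ

variable {ι κ E : Type*} [TopologicalSpace E] [MeasurableSpace E] {l : Filter ι} {N : ι → ℕ}
  {x : ∀ i, Fin (N i) → E} {μ : Measure E}

theorem Approximates.comp {w : ∀ i, Fin (N i) → ℝ} (h : Approximates l x w μ) {l' : Filter κ}
    {i : κ → ι} (hi : Tendsto i l' l) :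
    Approximates l' (fun k => x (i k)) (fun k => w (i k)) μ :=
  ⟨fun k => h.nonneg (i k), hi.eventually h.sum_eq_one, fun f => (h.wTendsto f).comp hi⟩

/-- Self-normalised weights. -/
theorem approximates_normalize [IsProbabilityMeasure μ] {b : ∀ i, Fin (N i) → ℝ}
    (hb : ∀ i n, 0 ≤ b i n) {c : ℝ} (hc : c ≠ 0)
    (h : ∀ f : BoundedContinuousFunction E ℝ,
      Tendsto (fun i => ∑ n, b i n * f (x i n)) l (𝓝 (c * ∫ e, f e ∂μ))) :
    Approximates l x (fun i => normalize (b i)) μ := by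
  have h1 : Tendsto (fun i => ∑ n, b i n) l (𝓝 c) := by
    simpa using h (BoundedContinuousFunction.const E 1)
  refine ⟨fun i => normalize_nonneg (hb i), ?_, fun f => ?_⟩
  · filter_upwards [h1.eventually_ne hc] with i hi
    simp only [normalize]
    rw [← Finset.sum_div, div_self hi]
  · have h2 := (h f).div h1 hc
    rw [mul_div_cancel_left₀ _ hc] at h2
    refine h2.congr fun i => ?_
    simp only [normalize, div_mul_eq_mul_div, Pi.div_apply]
    rw [Finset.sum_div]

end Approximates

/-! ### Convergence of the forward pass -/

section Forward

variable {d : ℕ} {M : Model d} {T : ℕ} {H : unitInterval → Fin d → unitInterval}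
  {h : (Fin d → unitInterval) → unitInterval}

theorem Model.Regular.integral_filt_zero (hM : M.Regular T) (f : Cube d → ℝ) :
    (M.Z 0).toReal * ∫ x, f x ∂M.filt 0 = ∫ x, M.G0 x * f x ∂M.m0 := by
  have h0 : M.Z 0 ≠ 0 := hM.Z_ne_zero 0 (Nat.zero_le _)
  have h1 : M.Z 0 ≠ ∞ := hM.Z_ne_top 0 (Nat.zero_le _)
  rw [M.filt_zero, integral_smul_measure, integral_withDensity_eq_integral_toReal_smul₀
    M.measurable_G0.ennreal_ofReal.aemeasurable (Eventually.of_forall fun x => ENNReal.ofReal_lt_top),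
    ENNReal.toReal_inv, smul_eq_mul, mul_inv_cancel_left₀ (ENNReal.toReal_pos h0 h1).ne']
  refine integral_congr_ae (Eventually.of_forall fun x => ?_)
  simp [ENNReal.toReal_ofReal (M.G0_nonneg x)]

theorem Model.Regular.integral_filt_succ (hM : M.Regular T) {t : ℕ} (ht : t + 1 ≤ T)
    {f : Cube d → ℝ} (hf : Measurable f) :
    (M.Z (t + 1) / M.Z t).toReal * ∫ x, f x ∂M.filt (t + 1) =
      ∫ p, M.G (t + 1) p.1 p.2 * f p.2 ∂(M.filt t ⊗ₘ M.m (t + 1)) := by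
  have hp := hM.isProbabilityMeasure_filt (Nat.le_of_succ_le ht)
  have h0 := hM.Z_ne_zero t (Nat.le_of_succ_le ht)
  have h1 := hM.Z_ne_top t (Nat.le_of_succ_le ht)
  have h0' := hM.Z_ne_zero _ ht
  have h1' := hM.Z_ne_top _ ht
  have hG : Measurable fun p : Cube d × Cube d => ENNReal.ofReal (M.G (t + 1) p.1 p.2) :=
    (M.measurable_G (t + 1)).ennreal_ofReal
  have hfilt : M.filt (t + 1) = (M.Z t / M.Z (t + 1)) •
      ((M.filt t ⊗ₘ M.m (t + 1)).withDensity fun p =>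
        ENNReal.ofReal (M.G (t + 1) p.1 p.2)).map Prod.snd := by
    refine Measure.ext_of_lintegral _ fun g hg => ?_
    have hg' : Measurable fun p : Cube d × Cube d => g p.2 := hg.comp measurable_snd
    rw [M.lintegral_filt_succ t h0 h1 hg, lintegral_smul_measure, lintegral_map hg measurable_snd,
      lintegral_withDensity_eq_lintegral_mul _ hG hg', Measure.lintegral_compProd (hG.mul hg')]
    rfl
  rw [hfilt, integral_smul_measure, integral_map measurable_snd.aemeasurable
      hf.aestronglyMeasurable, integral_withDensity_eq_integral_toReal_smul₀
    hG.aemeasurable (Eventually.of_forall fun x => ENNReal.ofReal_lt_top), smul_eq_mul, ← mul_assoc,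
    ← ENNReal.toReal_mul]
  have : M.Z (t + 1) / M.Z t * (M.Z t / M.Z (t + 1)) = 1 := by
    rw [← ENNReal.inv_div (Or.inr h1) (Or.inr h0)]
    exact ENNReal.inv_mul_cancel (ENNReal.div_ne_zero.2 ⟨h0, h1'⟩) (ENNReal.div_ne_top h1 h0')
  rw [this, ENNReal.toReal_one, one_mul]
  refine integral_congr_ae (Eventually.of_forall fun x => ?_)
  simp [ENNReal.toReal_ofReal (M.G_nonneg _ x.1 x.2)]

theorem forward_zero_approximates (hM : M.Regular T) (hG0 : Continuous M.G0) {B : ℝ}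
    (hB : ∀ x, M.G0 x ≤ B) {T0 : Cube d → Cube d} (hT0 : Continuous T0)
    (hmap : (lebesgue d).map T0 = M.m0)
    {ι : Type*} {l : Filter ι} [l.IsCountablyGenerated] {N : ι → ℕ} (hN : ∀ i, 0 < N i)
    {u : ∀ i, Fin (N i) → Cube d} (hu : Tendsto (fun i => discrepancy (u i)) l (𝓝 0)) :
    Approximates l (fun i n => T0 (u i n)) (fun i => normalize fun n => M.G0 (T0 (u i n)))
      (M.filt 0) := by
  have hp := hM.isProbabilityMeasure_filt (Nat.zero_le _)
  have h0 : M.Z 0 ≠ 0 := hM.Z_ne_zero 0 (Nat.zero_le _)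
  have h1 : M.Z 0 ≠ ∞ := hM.Z_ne_top 0 (Nat.zero_le _)
  have hw := wTendsto_of_discrepancy hN hu
  -- Normalisation absorbs the factor `1 / N i`, which brings in the equal weights of the input
  -- points.
  have hres : ∀ i, (normalize fun n => M.G0 (T0 (u i n))) =
      normalize fun n => 1 / (N i : ℝ) * M.G0 (T0 (u i n)) := fun i =>
    (normalize_const_mul (one_div_ne_zero (Nat.cast_ne_zero.2 (hN i).ne')) _).symm
  simp only [hres]
  refine approximates_normalize (fun i n => mul_nonneg (by positivity) (M.G0_nonneg _))
    (ENNReal.toReal_pos h0 h1).ne' fun f => ?_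
  have hGf : Continuous fun x => M.G0 x * f x := hG0.mul f.continuous
  rw [hM.integral_filt_zero, ← hmap, integral_map hT0.measurable.aemeasurable
    hGf.aestronglyMeasurable]
  let g : BoundedContinuousFunction (Cube d) ℝ :=
    BoundedContinuousFunction.ofNormedAddCommGroup (fun v => M.G0 (T0 v) * f (T0 v))
      ((hG0.comp hT0).mul (f.continuous.comp hT0)) (B * ‖f‖) fun v => by
        rw [norm_mul, Real.norm_of_nonneg (M.G0_nonneg _)]
        exact mul_le_mul (hB _) (f.norm_coe_le_norm _) (norm_nonneg _)
          ((M.G0_nonneg (T0 v)).trans (hB _))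
  simpa [g, mul_assoc] using hw g

/-- This is the limit of one forward step at a uniform point: the first coordinate draws from the
filtering distribution, the others move the draw by the transition kernel. -/
theorem map_forward_step (hM : M.Regular T) (hH : Continuous H) (hh : ∀ x, H (h x) = x)
    (hm : Measurable h) {t : ℕ} (ht : t + 1 ≤ T) {S : Cube d → Cube d → Cube d}
    (hS : Continuous fun p : Cube d × Cube d => S p.1 p.2)
    (hmap : ∀ x', (lebesgue d).map (S x') = M.m (t + 1) x') :
    (lebesgue (d + 1)).map (fun e => (curveQuantile H h (M.filt t) (e 0),
      S (curveQuantile H h (M.filt t) (e 0)) (Fin.tail e))) = M.filt t ⊗ₘ M.m (t + 1) := by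
  have hp := hM.isProbabilityMeasure_filt (Nat.le_of_succ_le ht)
  have hq := measurable_curveQuantile_right hH hm (M.filt t)
  have hmeas : Measurable fun p : Set.Ico (0 : ℝ) 1 × Cube d =>
      (curveQuantile H h (M.filt t) p.1, S (curveQuantile H h (M.filt t) p.1) p.2) :=
    (hq.comp measurable_fst).prodMk
      (hS.measurable.comp ((hq.comp measurable_fst).prodMk measurable_snd))
  have hht := measurePreserving_head_tail d
  have hcomp : Measurable fun e : Cube (d + 1) => (curveQuantile H h (M.filt t) (e 0),
      S (curveQuantile H h (M.filt t) (e 0)) (Fin.tail e)) := hmeas.comp hht.measurable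
  refine Measure.ext_of_lintegral _ fun f hf => ?_
  rw [lintegral_map hf hcomp, Measure.lintegral_compProd hf]
  have h1 := hht.lintegral_comp (hf.comp hmeas)
  simp only [Function.comp_def] at h1
  have h3 := lintegral_prod (μ := lebesgueIco) (ν := lebesgue d) _ (hf.comp hmeas).aemeasurable
  simp only [Function.comp_def] at h3
  rw [h1]
  refine h3.trans ?_
  have h2 : Measurable fun x' => ∫⁻ y, f (x', y) ∂M.m (t + 1) x' :=
    Measurable.lintegral_kernel_prod_right' (κ := M.m (t + 1)) hf
  rw [← lintegral_curveQuantile hH hh hm _ h2]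
  refine lintegral_congr fun s => ?_
  have h4 : ∀ x', Measurable (S x') := fun x' =>
    (hS.comp (continuous_const.prodMk continuous_id)).measurable
  have h5 : ∀ x', Measurable fun y => f (x', y) := fun x' => hf.comp measurable_prodMk_left
  rw [← hmap, lintegral_map (h5 _) (h4 _)]

/-- With the particles held fixed, one step is a function of a single input point, indexed by the
pair `(i, n)`, where `n` is only the default index of the resampling. These functions converge at
almost every point even along moving arguments, so the extended continuous mapping theorem applies
to the low-discrepancy points. -/
theorem forward_succ_approximates (hM : M.Regular T) (hd : 1 ≤ d) (hH : IsHilbertCurve H)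
    (hh : ∀ x, H (h x) = x) (hm : Measurable h) {t : ℕ} (ht : t + 1 ≤ T)
    (hG : Continuous fun p : Cube d × Cube d => M.G (t + 1) p.1 p.2)
    {B : ℝ} (hB : ∀ x' x, M.G (t + 1) x' x ≤ B) {S : Cube d → Cube d → Cube d}
    (hS : Continuous fun p : Cube d × Cube d => S p.1 p.2)
    (hmap : ∀ x', (lebesgue d).map (S x') = M.m (t + 1) x')
    {ι : Type*} {l : Filter ι} [l.IsCountablyGenerated] {N : ι → ℕ} (hN : ∀ i, 0 < N i)
    {x : ∀ i, Fin (N i) → Cube d} {w : ∀ i, Fin (N i) → ℝ} (hx : Approximates l x w (M.filt t))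
    {v : ∀ i, Fin (N i) → Cube (d + 1)} (hv : Tendsto (fun i => discrepancy (v i)) l (𝓝 0))
    {xhat : ∀ i, Fin (N i) → Cube d}
    (hxhat : ∀ i n, xhat i n =
      resample (fun x => (h (toClosedCube x) : ℝ)) (x i) (w i) (v i n 0) n) :
    Approximates l (fun i n => S (xhat i n) (Fin.tail (v i n)))
      (fun i => normalize fun n => M.G (t + 1) (xhat i n) (S (xhat i n) (Fin.tail (v i n))))
      (M.filt (t + 1)) := by
  have hp := hM.isProbabilityMeasure_filt (Nat.le_of_succ_le ht)
  have hp' := hM.isProbabilityMeasure_filt ht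
  have hw := wTendsto_of_discrepancy hN hv
  have hres : ∀ i, (normalize fun n => M.G (t + 1) (xhat i n) (S (xhat i n) (Fin.tail (v i n)))) =
      normalize fun n => 1 / (N i : ℝ) * M.G (t + 1) (xhat i n) (S (xhat i n) (Fin.tail (v i n))) :=
    fun i => (normalize_const_mul (one_div_ne_zero (Nat.cast_ne_zero.2 (hN i).ne')) _).symm
  simp only [hres]
  have hc : M.Z (t + 1) / M.Z t ≠ 0 :=
    ENNReal.div_ne_zero.2 ⟨hM.Z_ne_zero _ ht, hM.Z_ne_top t (Nat.le_of_succ_le ht)⟩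
  have hc' : M.Z (t + 1) / M.Z t ≠ ∞ :=
    ENNReal.div_ne_top (hM.Z_ne_top _ ht) (hM.Z_ne_zero t (Nat.le_of_succ_le ht))
  refine approximates_normalize (fun i n => mul_nonneg (by positivity) (M.G_nonneg _ _ _))
    (ENNReal.toReal_pos hc hc').ne' fun f => ?_
  have hq := measurable_curveQuantile_right hH.continuous hm (M.filt t)
  have hmeas : Measurable fun e : Cube (d + 1) => (curveQuantile H h (M.filt t) (e 0),
      S (curveQuantile H h (M.filt t) (e 0)) (Fin.tail e)) := by
    have h1 : Measurable fun p : Set.Ico (0 : ℝ) 1 × Cube d =>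
        (curveQuantile H h (M.filt t) p.1, S (curveQuantile H h (M.filt t) p.1) p.2) :=
      (hq.comp measurable_fst).prodMk
        (hS.measurable.comp ((hq.comp measurable_fst).prodMk measurable_snd))
    exact h1.comp (measurePreserving_head_tail d).measurable
  have hGf : Measurable fun p : Cube d × Cube d => M.G (t + 1) p.1 p.2 * f p.2 :=
    (M.measurable_G (t + 1)).mul (f.continuous.measurable.comp measurable_snd)
  rw [hM.integral_filt_succ ht f.continuous.measurable,
    ← map_forward_step hM hH.continuous hh hm ht hS hmap,
    integral_map hmeas.aemeasurable hGf.aestronglyMeasurable]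
  have hgood : ∀ᵐ e ∂lebesgue (d + 1), ∀ i, (H (keyQuantile h (M.filt t) (e 0)) i : ℝ) < 1 := by
    have h1 := ae_keyQuantile_lt_one hH.continuous hh hm (M.filt t)
    have h2 := (Measure.quasiMeasurePreserving_fst (μ := lebesgueIco) (ν := lebesgue d)).ae h1
    exact (measurePreserving_head_tail d).quasiMeasurePreserving.ae h2
  have key := hw.tendsto_sum hN (fun i n => by positivity)
    (g := fun j e => M.G (t + 1)
      (resample (fun x => (h (toClosedCube x) : ℝ)) (x j.1) (w j.1) (e 0) j.2)
      (S (resample (fun x => (h (toClosedCube x) : ℝ)) (x j.1) (w j.1) (e 0) j.2) (Fin.tail e)) *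
      f (S (resample (fun x => (h (toClosedCube x) : ℝ)) (x j.1) (w j.1) (e 0) j.2) (Fin.tail e)))
    (g₀ := fun e => M.G (t + 1) (curveQuantile H h (M.filt t) (e 0))
      (S (curveQuantile H h (M.filt t) (e 0)) (Fin.tail e)) *
      f (S (curveQuantile H h (M.filt t) (e 0)) (Fin.tail e))) (hGf.comp hmeas) (B := B * ‖f‖)
    (fun j e => ?_) ?_
  · refine key.congr fun i => Finset.sum_congr rfl fun n _ => ?_
    simp only [hxhat, mul_assoc]
  · rw [abs_mul, abs_of_nonneg (M.G_nonneg _ _ _)]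
    exact mul_le_mul (hB _ _) (f.norm_coe_le_norm _) (abs_nonneg _)
      ((M.G_nonneg (t + 1) (x j.1 j.2) (x j.1 j.2)).trans (hB _ _))
  · filter_upwards [hgood] with e he
    have hfst : Tendsto (fun p : (Σ i, Fin (N i)) × Cube (d + 1) => p.1.1)
        (comap Sigma.fst l ×ˢ 𝓝 e) l := tendsto_comap.comp tendsto_fst
    have hx' := hx.comp hfst
    have hsnd : Tendsto (fun p : (Σ i, Fin (N i)) × Cube (d + 1) => p.2)
        (comap Sigma.fst l ×ˢ 𝓝 e) (𝓝 e) := tendsto_snd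
    have hv0 : Tendsto (fun p : (Σ i, Fin (N i)) × Cube (d + 1) => p.2 0)
        (comap Sigma.fst l ×ˢ 𝓝 e) (𝓝 (e 0)) := ((continuous_apply 0).tendsto e).comp hsnd
    have htail : Continuous fun e : Cube (d + 1) => (Fin.tail e : Cube d) :=
      continuous_pi fun i => continuous_apply i.succ
    have hvt := (htail.tendsto e).comp hsnd
    have hr := tendsto_resample (fun p : (Σ i, Fin (N i)) × Cube (d + 1) => hN p.1.1) hd hH hh hm
      hx'.nonneg hx'.sum_eq_one (hM.filt_ac t (Nat.le_of_succ_le ht))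
      (hM.filt_pos t (Nat.le_of_succ_le ht)) hx'.wTendsto hv0 (fun p => p.1.2) he
    have hS' := (hS.tendsto _).comp (hr.prodMk_nhds hvt)
    exact ((hG.tendsto _).comp (hr.prodMk_nhds hS')).mul ((f.continuous.tendsto _).comp hS')

/-- Convergence of the forward pass. -/
theorem forward_approximates (hM : M.Regular T) (hd : 1 ≤ d) (hH : IsHilbertCurve H)
    (hh : ∀ x, H (h x) = x) (hm : Measurable h)
    {F0 : Cube d → Fin d → ℝ} {F : ℕ → Cube d → Cube d → Fin d → ℝ}
    (hG0 : Continuous M.G0 ∧ ∃ B : ℝ, ∀ x, M.G0 x ≤ B)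
    (hG : ∀ t, 1 ≤ t → t ≤ T → (Continuous fun p : Cube d × Cube d => M.G t p.1 p.2) ∧
      ∃ B : ℝ, ∀ x' x, M.G t x' x ≤ B)
    (hT0 : Continuous (rosenblattInv F0)) (hmap0 : (lebesgue d).map (rosenblattInv F0) = M.m0)
    (hT : ∀ t, 1 ≤ t → t ≤ T →
      Continuous fun p : Cube d × Cube d => rosenblattInv (F t p.1) p.2)
    (hmap : ∀ t, 1 ≤ t → t ≤ T → ∀ x', (lebesgue d).map (rosenblattInv (F t x')) = M.m t x')
    {ι : Type*} {l : Filter ι} [l.IsCountablyGenerated] {N : ι → ℕ} (hN : ∀ i, 0 < N i)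
    {u : ∀ i, (t : ℕ) → Fin (N i) → Cube (dimAt d t)}
    (hu : ∀ t ≤ T, Tendsto (fun i => discrepancy (u i t)) l (𝓝 0)) {t : ℕ} (ht : t ≤ T) :
    Approximates l (fun i => (forward M (fun x => h (toClosedCube x)) F0 F (u i) t).1)
      (fun i => (forward M (fun x => h (toClosedCube x)) F0 F (u i) t).2) (M.filt t) := by
  induction t with
  | zero =>
    obtain ⟨hc, B, hB⟩ := hG0
    exact forward_zero_approximates hM hc hB hT0 hmap0 hN (hu 0 ht)
  | succ t ih =>
    obtain ⟨hc, B, hB⟩ := hG (t + 1) (Nat.succ_le_succ (Nat.zero_le _)) ht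
    exact forward_succ_approximates hM hd hH hh hm ht hc hB
      (hT (t + 1) (Nat.succ_le_succ (Nat.zero_le _)) ht)
      (hmap (t + 1) (Nat.succ_le_succ (Nat.zero_le _)) ht) hN (ih (Nat.le_of_succ_le ht))
      (hu (t + 1) ht) (fun i n => rfl)

end Forward

/-! ### Convergence of the backward pass -/

section Backward

variable {d : ℕ} {M : Model d} {T : ℕ} {H : unitInterval → Fin d → unitInterval}
  {h : (Fin d → unitInterval) → unitInterval}

/-- The normaliser of `Gtilde` depends only on `y`, so it cancels from the weights, and the bounded
continuous `Gtilde` may replace density times potential. Joint continuity lets `y` move towards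
`y₀`. -/
theorem backWeight_approximates (hM : M.Regular T) {t : ℕ} (ht : t + 1 ≤ T)
    {ι : Type*} {l : Filter ι} {N : ι → ℕ} (hN : ∀ i, 0 < N i)
    {x : ∀ i, Fin (N i) → Cube d} {w : ∀ i, Fin (N i) → ℝ} (hx : Approximates l x w (M.filt t))
    {y : ι → Cube d} {y₀ : Cube d} (hy : Tendsto y l (𝓝 y₀)) :
    Approximates l x (fun i => backWeight M t (x i) (w i) (y i))
      (M.backKernel (t + 1) (M.filt t) y₀) := by
  have hp := hM.isProbabilityMeasure_filt (Nat.le_of_succ_le ht)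
  have hp' := hM.back_prob t ht y₀
  have hres : ∀ i, backWeight M t (x i) (w i) (y i) =
      normalize fun n => w i n * M.Gtilde (t + 1) (M.filt t) (x i n) (y i) := fun i => by
    rw [← normalize_const_mul (hM.normalizer_pos t ht (y i)).ne', backWeight]
    congr 1
    funext n
    rw [mul_assoc, hM.densG_eq ht]
    ring
  simp only [hres]
  obtain ⟨B, hB⟩ := hM.bounded_Gtilde t ht
  have hc := hM.continuous_Gtilde t ht
  refine approximates_normalize (fun i n => mul_nonneg (hx.nonneg i n) (M.Gtilde_nonneg _ _ _ _))
    one_ne_zero fun f => ?_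
  have hcy : Continuous fun x' => M.Gtilde (t + 1) (M.filt t) x' y₀ :=
    hc.comp (continuous_id.prodMk continuous_const)
  rw [one_mul, Model.backKernel, integral_withDensity_eq_integral_toReal_smul₀
    hcy.measurable.ennreal_ofReal.aemeasurable
    (Eventually.of_forall fun x => ENNReal.ofReal_lt_top)]
  simp only [ENNReal.toReal_ofReal (M.Gtilde_nonneg _ _ _ _), smul_eq_mul]
  have key := hx.wTendsto.tendsto_sum hN hx.nonneg
    (g := fun j e => M.Gtilde (t + 1) (M.filt t) e (y j.1) * f e)
    (g₀ := fun e => M.Gtilde (t + 1) (M.filt t) e y₀ * f e)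
    (hcy.mul f.continuous).measurable (B := B * ‖f‖) (fun j e => ?_) ?_
  · simpa only [mul_assoc] using key
  · rw [abs_mul]
    exact mul_le_mul (hB _ _) (f.norm_coe_le_norm _) (abs_nonneg _)
      ((abs_nonneg _).trans (hB e (y j.1)))
  · refine Eventually.of_forall fun e => ?_
    have h1 : Tendsto (fun p : (Σ i, Fin (N i)) × Cube d => y p.1.1)
        (comap Sigma.fst l ×ˢ 𝓝 e) (𝓝 y₀) := hy.comp (tendsto_comap.comp tendsto_fst)
    have h2 : Tendsto (fun p : (Σ i, Fin (N i)) × Cube d => p.2)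
        (comap Sigma.fst l ×ˢ 𝓝 e) (𝓝 e) := tendsto_snd
    exact ((hc.tendsto _).comp (h2.prodMk_nhds h1)).mul ((f.continuous.tendsto _).comp h2)

theorem continuous_init (t : ℕ) : Continuous fun v : Cube (t + 1) => (Fin.init v : Cube t) :=
  continuous_pi fun i => continuous_apply i.castSucc

/-- Induction with a moving state: after each step the state reached is merely convergent.
Resampling converges because the backward kernel at the limit state is absolutely continuous and
charges open sets. -/
theorem tendsto_backPath (hM : M.Regular T) (hd : 1 ≤ d) (hH : IsHilbertCurve H)
    (hh : ∀ x, H (h x) = x) (hm : Measurable h) {ι : Type*} {l : Filter ι} {N : ι → ℕ}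
    (hN : ∀ i, 0 < N i) {s : ∀ i, ℕ → (Fin (N i) → Cube d) × (Fin (N i) → ℝ)}
    (hs : ∀ t ≤ T, Approximates l (fun i => (s i t).1) (fun i => (s i t).2) (M.filt t))
    (n₀ : ∀ i, Fin (N i)) {t : ℕ} (ht : t ≤ T) {y : ι → Cube d} {y₀ : Cube d}
    (hy : Tendsto y l (𝓝 y₀)) {v : ι → Cube t} {v₀ : Cube t} (hv : Tendsto v l (𝓝 v₀))
    (hgood : GoodPath M H h t y₀ v₀) :
    Tendsto (fun i => backPath M (fun x => h (toClosedCube x)) (s i) (n₀ i) t (y i) (v i)) l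
      (𝓝 (limitPath M H h t y₀ v₀)) := by
  induction t generalizing y y₀ with
  | zero => exact tendsto_pi_nhds.2 fun _ => hy
  | succ t ih =>
    have hp := hM.back_prob t ht y₀
    have hb := backWeight_approximates hM ht hN (hs t (Nat.le_of_succ_le ht)) hy
    have hvl : Tendsto (fun i => v i (Fin.last t)) l (𝓝 (v₀ (Fin.last t))) :=
      ((continuous_apply (Fin.last t)).tendsto v₀).comp hv
    have hr := tendsto_resample hN hd hH hh hm hb.nonneg hb.sum_eq_one (hM.back_ac ht y₀)
      (hM.back_pos t ht y₀) hb.wTendsto hvl n₀ hgood.1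
    exact (ih (Nat.le_of_succ_le ht) hr (((continuous_init t).tendsto v₀).comp hv)
      hgood.2).finSnoc hy

/-- Almost everywhere convergence of the backward trajectories. -/
theorem ae_tendsto_backPath (hM : M.Regular T) (hd : 1 ≤ d) (hH : IsHilbertCurve H)
    (hh : ∀ x, H (h x) = x) (hm : Measurable h) {ι : Type*} {l : Filter ι} {N : ι → ℕ}
    (hN : ∀ i, 0 < N i) {s : ∀ i, ℕ → (Fin (N i) → Cube d) × (Fin (N i) → ℝ)}
    (hs : ∀ t ≤ T, Approximates l (fun i => (s i t).1) (fun i => (s i t).2) (M.filt t)) :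
    ∀ᵐ v ∂lebesgue (T + 1), Tendsto (fun p : (Σ i, Fin (N i)) × Cube (T + 1) =>
      backPath M (fun x => h (toClosedCube x)) (s p.1.1) p.1.2 T
        (resample (fun x => (h (toClosedCube x) : ℝ)) (s p.1.1 T).1 (s p.1.1 T).2
          (p.2 (Fin.last T)) p.1.2) (Fin.init p.2))
      (comap Sigma.fst l ×ˢ 𝓝 v) (𝓝 (limitTrajectory M H h T v)) := by
  have hp := hM.isProbabilityMeasure_filt le_rfl
  filter_upwards [hM.ae_goodTrajectory hH.continuous hh hm] with v hv
  have hfst : Tendsto (fun p : (Σ i, Fin (N i)) × Cube (T + 1) => p.1.1)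
      (comap Sigma.fst l ×ˢ 𝓝 v) l := tendsto_comap.comp tendsto_fst
  have hsnd : Tendsto (fun p : (Σ i, Fin (N i)) × Cube (T + 1) => p.2)
      (comap Sigma.fst l ×ˢ 𝓝 v) (𝓝 v) := tendsto_snd
  have hvl : Tendsto (fun p : (Σ i, Fin (N i)) × Cube (T + 1) => p.2 (Fin.last T))
      (comap Sigma.fst l ×ˢ 𝓝 v) (𝓝 (v (Fin.last T))) :=
    ((continuous_apply (Fin.last T)).tendsto v).comp hsnd
  have hs' := fun t ht => (hs t ht).comp hfst
  have hT := hs' T le_rfl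
  have hr := tendsto_resample (fun p : (Σ i, Fin (N i)) × Cube (T + 1) => hN p.1.1) hd hH hh hm
    hT.nonneg hT.sum_eq_one (hM.filt_ac T le_rfl) (hM.filt_pos T le_rfl) hT.wTendsto hvl
    (fun p => p.1.2) hv.1
  exact tendsto_backPath hM hd hH hh hm (fun p : (Σ i, Fin (N i)) × Cube (T + 1) => hN p.1.1)
    hs' (fun p => p.1.2) le_rfl hr (((continuous_init T).tendsto v).comp hsnd) hv.2

end Backward

/-! ### Measurability of the algorithms -/

section Measurability

variable {Ω : Type*} [MeasurableSpace Ω] {d N : ℕ}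

/-- A function that is measurable in `ω` for every value of a countable-valued parameter. -/
theorem measurable_countable_param {J β : Type*} [Countable J] [MeasurableSpace β] {c : Ω → J}
    (hc : ∀ j, MeasurableSet {ω | c ω = j}) {f : J → Ω → β} (hf : ∀ j, Measurable (f j)) :
    Measurable fun ω => f (c ω) ω := by
  intro s hs
  have : (fun ω => f (c ω) ω) ⁻¹' s = ⋃ j, {ω | c ω = j} ∩ f j ⁻¹' s := by
    ext ω
    simp
  rw [this]
  exact MeasurableSet.iUnion fun j => (hc j).inter (hf j hs)

theorem measurable_normalize {a : Ω → Fin N → ℝ} (ha : ∀ n, Measurable fun ω => a ω n) (n : Fin N) :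
    Measurable fun ω => normalize (a ω) n :=
  (ha n).div (Finset.measurable_sum _ fun m _ => ha m)

/-- The sorting permutation is characterised by finitely many comparisons of keys, ties being broken
by the index. -/
theorem measurableSet_sort_eq {a : Ω → Fin N → ℝ} (ha : ∀ n, Measurable fun ω => a ω n)
    (τ : Equiv.Perm (Fin N)) : MeasurableSet {ω | Tuple.sort (a ω) = τ} := by
  have : {ω | Tuple.sort (a ω) = τ} = {ω | (∀ i j, i ≤ j → a ω (τ i) ≤ a ω (τ j)) ∧
      ∀ i j, i < j → a ω (τ i) = a ω (τ j) → τ i < τ j} := by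
    ext ω
    exact eq_comm.trans Tuple.eq_sort_iff
  rw [this]
  have h1 : MeasurableSet {ω | ∀ i j, i ≤ j → a ω (τ i) ≤ a ω (τ j)} := by
    simp only [Set.ofPred_forall]
    exact MeasurableSet.iInter fun i => MeasurableSet.iInter fun j => MeasurableSet.iInter fun _ =>
      measurableSet_le (ha _) (ha _)
  have h2 : MeasurableSet {ω | ∀ i j, i < j → a ω (τ i) = a ω (τ j) → τ i < τ j} := by
    simp only [Set.ofPred_forall]
    refine MeasurableSet.iInter fun i => MeasurableSet.iInter fun j => MeasurableSet.iInter fun _ =>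
      ?_
    exact (measurableSet_eq_fun (ha (τ i)) (ha (τ j))).imp (MeasurableSet.const _)
  exact h1.inter h2

open Classical in
theorem measurableSet_invIndex_eq {w : Ω → Fin N → ℝ} (hw : ∀ n, Measurable fun ω => w ω n)
    {u : Ω → ℝ} (hu : Measurable u) (n₀ j : Fin N) :
    MeasurableSet {ω | invIndex (w ω) (u ω) n₀ = j} := by
  -- The index depends on weights and variate only through finitely many truth values.
  let Φ : (Fin N → Prop) → Fin N := fun b =>
    if hne : (Finset.univ.filter b).Nonempty then Finset.min' _ hne else n₀
  have hb : Measurable fun ω => fun i : Fin N => u ω ≤ ∑ m ∈ Finset.Iic i, w ω m :=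
    measurable_pi_iff.2 fun i => measurableSet_setOfPred.1
      (measurableSet_le hu (Finset.measurable_sum _ fun m _ => hw m))
  have hΦ : ∀ ω, invIndex (w ω) (u ω) n₀ = Φ fun i => u ω ≤ ∑ m ∈ Finset.Iic i, w ω m := by
    intro ω
    simp only [invIndex, Φ]
  simp only [hΦ]
  exact hb (Set.to_countable (Φ ⁻¹' {j})).measurableSet

/-- Permutation and rank take finitely many values, and on each such event the output is one fixed
particle. -/
theorem measurable_resample {k : Cube d → ℝ} (hk : Measurable k) {x : Ω → Fin N → Cube d}
    (hx : ∀ n, Measurable fun ω => x ω n) {w : Ω → Fin N → ℝ} (hw : ∀ n, Measurable fun ω => w ω n)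
    {u : Ω → ℝ} (hu : Measurable u) (n₀ : Fin N) :
    Measurable fun ω => resample k (x ω) (w ω) (u ω) n₀ := by
  refine measurable_countable_param (c := fun ω => Tuple.sort fun n => k (x ω n))
    (f := fun τ ω => x ω (τ (invIndex (fun i => w ω (τ i)) (u ω) n₀)))
    (fun τ => measurableSet_sort_eq (fun n => hk.comp (hx n)) τ) fun τ => ?_
  exact measurable_countable_param (c := fun ω => invIndex (fun i => w ω (τ i)) (u ω) n₀)
    (f := fun i ω => x ω (τ i)) (fun i => measurableSet_invIndex_eq (fun n => hw (τ n)) hu n₀ i)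
    fun i => hx (τ i)

theorem measurable_forward {M : Model d} {T : ℕ} {k : Cube d → ℝ} (hk : Measurable k)
    {F0 : Cube d → Fin d → ℝ} {F : ℕ → Cube d → Cube d → Fin d → ℝ}
    (hT0 : Measurable (rosenblattInv F0))
    (hT : ∀ t, 1 ≤ t → t ≤ T →
      Measurable fun p : Cube d × Cube d => rosenblattInv (F t p.1) p.2)
    {u : Ω → (t : ℕ) → Fin N → Cube (dimAt d t)}
    (hu : ∀ t ≤ T, ∀ n, Measurable fun ω => u ω t n) {t : ℕ} (ht : t ≤ T) :
    (∀ n, Measurable fun ω => (forward M k F0 F (u ω) t).1 n) ∧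
      ∀ n, Measurable fun ω => (forward M k F0 F (u ω) t).2 n := by
  induction t with
  | zero =>
    have hx : ∀ n, Measurable fun ω => rosenblattInv F0 (u ω 0 n) :=
      fun n => hT0.comp (hu 0 ht n)
    exact ⟨hx, measurable_normalize fun n => M.measurable_G0.comp (hx n)⟩
  | succ t ih =>
    obtain ⟨ih1, ih2⟩ := ih (Nat.le_of_succ_le ht)
    let v : Ω → Fin N → Cube (d + 1) := fun ω => u ω (t + 1)
    have hv : ∀ n, Measurable fun ω => v ω n := hu (t + 1) ht
    have hv0 : ∀ n, Measurable fun ω => ((v ω n 0 : Set.Ico (0 : ℝ) 1) : ℝ) :=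
      fun n => measurable_subtype_coe.comp ((measurable_pi_apply 0).comp (hv n))
    have htl : Measurable fun v : Cube (d + 1) => (Fin.tail v : Cube d) :=
      measurable_pi_lambda _ fun i => measurable_pi_apply i.succ
    have hxh : ∀ n, Measurable fun ω => resample k (forward M k F0 F (u ω) t).1
        (forward M k F0 F (u ω) t).2 (v ω n 0) n := fun n =>
      measurable_resample hk ih1 ih2 (hv0 n) n
    have hx : ∀ n, Measurable fun ω => (forward M k F0 F (u ω) (t + 1)).1 n := fun n =>
      (hT (t + 1) (Nat.succ_le_succ (Nat.zero_le _)) ht).comp ((hxh n).prodMk (htl.comp (hv n)))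
    exact ⟨hx, measurable_normalize fun n => (M.measurable_G (t + 1)).comp ((hxh n).prodMk (hx n))⟩

theorem measurable_backWeight {M : Model d} (t : ℕ) {x : Ω → Fin N → Cube d}
    (hx : ∀ n, Measurable fun ω => x ω n) {w : Ω → Fin N → ℝ} (hw : ∀ n, Measurable fun ω => w ω n)
    {y : Ω → Cube d} (hy : Measurable y) (n : Fin N) :
    Measurable fun ω => backWeight M t (x ω) (w ω) (y ω) n :=
  measurable_normalize (fun n => ((hw n).mul ((M.measurable_dens (t + 1)).comp
    ((hx n).prodMk hy))).mul ((M.measurable_G (t + 1)).comp ((hx n).prodMk hy))) n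

theorem measurable_backPath {M : Model d} {k : Cube d → ℝ} (hk : Measurable k) {T : ℕ}
    {s : Ω → ℕ → (Fin N → Cube d) × (Fin N → ℝ)}
    (hs : ∀ t ≤ T, (∀ n, Measurable fun ω => (s ω t).1 n) ∧ ∀ n, Measurable fun ω => (s ω t).2 n)
    (n₀ : Fin N) {t : ℕ} (ht : t ≤ T) {y : Ω → Cube d} (hy : Measurable y) {v : Ω → Cube t}
    (hv : Measurable v) : Measurable fun ω => backPath M k (s ω) n₀ t (y ω) (v ω) := by
  induction t generalizing y with
  | zero => exact measurable_pi_lambda _ fun _ => hy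
  | succ t ih =>
    obtain ⟨h1, h2⟩ := hs t (Nat.le_of_succ_le ht)
    have hvl : Measurable fun ω => ((v ω (Fin.last t) : Set.Ico (0 : ℝ) 1) : ℝ) :=
      measurable_subtype_coe.comp ((measurable_pi_apply (Fin.last t)).comp hv)
    have hr := measurable_resample hk h1 (measurable_backWeight (M := M) t h1 h2 hy) hvl n₀
    exact measurable_snoc.comp ((ih (Nat.le_of_succ_le ht) hr
      ((measurable_init t).comp hv)).prodMk hy)

theorem measurable_backward {M : Model d} {k : Cube d → ℝ} (hk : Measurable k) {T : ℕ}
    {s : Ω → ℕ → (Fin N → Cube d) × (Fin N → ℝ)}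
    (hs : ∀ t ≤ T, (∀ n, Measurable fun ω => (s ω t).1 n) ∧ ∀ n, Measurable fun ω => (s ω t).2 n)
    {v : Ω → Fin N → Cube (T + 1)} (hv : ∀ n, Measurable fun ω => v ω n) (n : Fin N) :
    Measurable fun ω => backward M k T (s ω) (v ω) n := by
  obtain ⟨h1, h2⟩ := hs T le_rfl
  have hvl : Measurable fun ω => ((v ω n (Fin.last T) : Set.Ico (0 : ℝ) 1) : ℝ) :=
    measurable_subtype_coe.comp ((measurable_pi_apply (Fin.last T)).comp (hv n))
  exact measurable_backPath hk hs n le_rfl (measurable_resample hk h1 h2 hvl n)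
    ((measurable_init T).comp (hv n))

end Measurability

/-! ### Convergence in mean -/

section Mean

variable {Ω E : Type*} [MeasurableSpace Ω] [MeasurableSpace E] {P : Measure Ω}
  [IsProbabilityMeasure P]

theorem integral_abs_le_sqrt {X : Ω → ℝ} (hX : MemLp X 2 P) :
    ∫ ω, |X ω| ∂P ≤ √(∫ ω, X ω ^ 2 ∂P) := by
  refine Real.le_sqrt_of_sq_le ?_
  -- Nonnegativity of the variance of `|X|` is the required case of the Cauchy-Schwarz inequality.
  have h1 := variance_nonneg |X| P
  rw [variance_eq_sub hX.abs] at h1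
  refine (sub_nonneg.1 h1).trans (le_of_eq ?_)
  simp

/-- Convergence in mean of averages whose variance vanishes. -/
theorem tendsto_integral_abs_average {μ : Measure E} [IsProbabilityMeasure μ]
    {ub : Ω → (N : ℕ) → Fin N → E} (hub : ∀ N n, Measurable fun ω => ub ω N n)
    (hunif : ∀ N n, P.map (fun ω => ub ω N n) = μ) {ψ : E → ℝ} (hψ : Measurable ψ) {B : ℝ}
    (hB : ∀ e, |ψ e| ≤ B) {r : ℕ → ℝ} (hr : Tendsto r atTop (𝓝 0))
    (hvar : ∀ N : ℕ, 1 ≤ N → variance (fun ω => (1 / (N : ℝ)) * ∑ n, ψ (ub ω N n)) P ≤ r N) :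
    Tendsto (fun N : ℕ => ∫ ω, |(1 / (N : ℝ)) * ∑ n, ψ (ub ω N n) - ∫ e, ψ e ∂μ| ∂P) atTop
      (𝓝 0) := by
  have hint : ∀ N n, Integrable (fun ω => ψ (ub ω N n)) P := fun N n =>
    Integrable.of_bound (hψ.comp (hub N n)).aestronglyMeasurable B
      (Eventually.of_forall fun ω => hB _)
  -- Marginal uniformity makes the average exactly unbiased, so its variance is the second moment of
  -- the error.
  have hmean : ∀ N : ℕ, 1 ≤ N →
      ∫ ω, (1 / (N : ℝ)) * ∑ n, ψ (ub ω N n) ∂P = ∫ e, ψ e ∂μ := by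
    intro N hN
    rw [integral_const_mul, integral_finsetSum _ fun n _ => hint N n]
    have h1 : ∀ n, ∫ ω, ψ (ub ω N n) ∂P = ∫ e, ψ e ∂μ := fun n => by
      rw [← hunif N n, integral_map (hub N n).aemeasurable hψ.aestronglyMeasurable]
    have h2 : (N : ℝ) ≠ 0 := Nat.cast_ne_zero.2 (by omega)
    simp only [h1, Finset.sum_const, Finset.card_univ, Fintype.card_fin, nsmul_eq_mul]
    field_simp
  have hm1 : ∀ N n, MemLp (fun ω => ψ (ub ω N n)) 2 P := fun N n =>
    MemLp.of_bound (hψ.comp (hub N n)).aestronglyMeasurable B (Eventually.of_forall fun ω => hB _)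
  have hm : ∀ N : ℕ, MemLp (fun ω => (1 / (N : ℝ)) * ∑ n, ψ (ub ω N n)) 2 P := fun N =>
    (memLp_finsetSum _ fun n _ => hm1 N n).const_mul _
  have hsq : Tendsto (fun N => √(r N)) atTop (𝓝 0) := by
    simpa [Function.comp_def] using (Real.continuous_sqrt.tendsto 0).comp hr
  refine tendsto_of_tendsto_of_tendsto_of_le_of_le' tendsto_const_nhds hsq
    (Eventually.of_forall fun N => integral_nonneg fun ω => abs_nonneg _) ?_
  filter_upwards [eventually_ge_atTop 1] with N hN
  have hX : MemLp (fun ω => (1 / (N : ℝ)) * ∑ n, ψ (ub ω N n) - ∫ e, ψ e ∂μ) 2 P :=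
    (hm N).sub (memLp_const _)
  refine (integral_abs_le_sqrt hX).trans (Real.sqrt_le_sqrt ?_)
  refine le_trans (le_of_eq ?_) (hvar N hN)
  rw [variance_eq_integral (hm N).aemeasurable, hmean N hN]

/-- Convergence in mean of `est` to averages that agree with it up to a small proportion of the
points. -/
theorem tendsto_integral_abs_sub_average {μ : Measure E} [IsProbabilityMeasure μ]
    {ub : Ω → (N : ℕ) → Fin N → E} (hub : ∀ N n, Measurable fun ω => ub ω N n)
    (hunif : ∀ N n, P.map (fun ω => ub ω N n) = μ) {ψ : E → ℝ} {B : ℝ} (hB : 0 ≤ B)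
    {g : (N : ℕ) → Ω → Fin N → ℝ}
    (happ : ∀ ε : ℝ, 0 < ε → ∃ K : Set E, MeasurableSet K ∧ μ.real Kᶜ < ε ∧
      ∀ᶠ N in atTop, ∀ᵐ ω ∂P, ∀ n, |g N ω n - ψ (ub ω N n)| ≤
        ε + B * Kᶜ.indicator (fun _ => (1 : ℝ)) (ub ω N n)) :
    Tendsto (fun N : ℕ => ∫ ω, |(1 / (N : ℝ)) * ∑ n, g N ω n - (1 / (N : ℝ)) * ∑ n, ψ (ub ω N n)| ∂P)
      atTop (𝓝 0) := by
  have key : ∀ ε : ℝ, 0 < ε → ∀ᶠ N : ℕ in atTop,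
      ∫ ω, |(1 / (N : ℝ)) * ∑ n, g N ω n - (1 / (N : ℝ)) * ∑ n, ψ (ub ω N n)| ∂P ≤ ε + B * ε := by
    intro ε hε
    obtain ⟨K, hK, hKε, hev⟩ := happ ε hε
    filter_upwards [hev, eventually_ge_atTop 1] with N hN h1
    have h2 : (N : ℝ) ≠ 0 := Nat.cast_ne_zero.2 (by omega)
    have hind : Measurable (Kᶜ.indicator fun _ : E => (1 : ℝ)) := measurable_const.indicator hK.compl
    have hint : ∀ n, Integrable (fun ω => Kᶜ.indicator (fun _ => (1 : ℝ)) (ub ω N n)) P := fun n =>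
      Integrable.of_bound (hind.comp (hub N n)).aestronglyMeasurable 1
        (Eventually.of_forall fun ω => by
          by_cases h : ub ω N n ∈ K <;> simp [h])
    -- Only the law of each single point enters, so the expected proportion of points outside `K` is
    -- `μ.real Kᶜ` whatever the dependence among the points and with `g`.
    have hval : ∀ n, ∫ ω, Kᶜ.indicator (fun _ => (1 : ℝ)) (ub ω N n) ∂P = μ.real Kᶜ := fun n => by
      rw [← integral_map (hub N n).aemeasurable hind.aestronglyMeasurable, hunif,
        integral_indicator_const _ hK.compl, smul_eq_mul, mul_one]
    have hint1 : ∀ n, Integrable (fun ω => ε + B * Kᶜ.indicator (fun _ => (1 : ℝ)) (ub ω N n)) P :=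
      fun n => (integrable_const ε).add ((hint n).const_mul B)
    have hint' : Integrable (fun ω => (1 / (N : ℝ)) *
        ∑ n, (ε + B * Kᶜ.indicator (fun _ => (1 : ℝ)) (ub ω N n))) P :=
      (integrable_finsetSum _ fun n _ => hint1 n).const_mul _
    calc _ ≤ ∫ ω, (1 / (N : ℝ)) *
          ∑ n, (ε + B * Kᶜ.indicator (fun _ => (1 : ℝ)) (ub ω N n)) ∂P := by
          refine integral_mono_of_nonneg (Eventually.of_forall fun ω => abs_nonneg _) hint' ?_
          filter_upwards [hN] with ω hω
          rw [← mul_sub, ← Finset.sum_sub_distrib, abs_mul, abs_of_nonneg (by positivity)]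
          refine mul_le_mul_of_nonneg_left ((Finset.abs_sum_le_sum_abs _ _).trans
            (Finset.sum_le_sum fun n _ => hω n)) (by positivity)
      _ = ε + B * μ.real Kᶜ := by
          rw [integral_const_mul, integral_finsetSum _ fun n _ => hint1 n]
          have : ∀ n, ∫ ω, (ε + B * Kᶜ.indicator (fun _ => (1 : ℝ)) (ub ω N n)) ∂P =
              ε + B * μ.real Kᶜ := fun n => by
            rw [integral_add (integrable_const ε) ((hint n).const_mul B), integral_const_mul,
              hval]
            simp
          simp only [this, Finset.sum_const, Finset.card_univ, Fintype.card_fin, nsmul_eq_mul]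
          field_simp
      _ ≤ ε + B * ε := by gcongr
  refine tendsto_order.2 ⟨fun c hc => Eventually.of_forall fun N =>
    hc.trans_le (integral_nonneg fun ω => abs_nonneg _), fun c hc => ?_⟩
  -- With this `ε` the bound `ε + B * ε` equals `c / 2`.
  have hε : 0 < c / (2 * (1 + B)) := by positivity
  filter_upwards [key _ hε] with N hN
  refine hN.trans_lt ?_
  have : c / (2 * (1 + B)) + B * (c / (2 * (1 + B))) = c / 2 := by field_simp
  rw [this]
  exact half_lt_self hc

/-- The variance is at most the second moment about any constant `c`, and the square of an error
bounded by `B` is at most `B` times its absolute value. -/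
theorem tendsto_variance_of_tendsto_integral_abs {X : ℕ → Ω → ℝ}
    (hX : ∀ N, AEStronglyMeasurable (X N) P) {B c : ℝ} (hB : ∀ N ω, |X N ω - c| ≤ B)
    (h : Tendsto (fun N => ∫ ω, |X N ω - c| ∂P) atTop (𝓝 0)) :
    Tendsto (fun N => variance (X N) P) atTop (𝓝 0) := by
  have h2 : Tendsto (fun N => B * ∫ ω, |X N ω - c| ∂P) atTop (𝓝 0) := by
    simpa using h.const_mul B
  refine squeeze_zero (fun N => variance_nonneg _ _) (fun N => ?_) h2
  have hm : AEStronglyMeasurable (fun ω => X N ω - c) P := (hX N).sub aestronglyMeasurable_const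
  rw [← variance_sub_const (hX N) c, ← integral_const_mul]
  refine (variance_le_expectation_sq hm).trans ?_
  refine integral_mono_of_nonneg (Eventually.of_forall fun ω => sq_nonneg _) ?_
    (Eventually.of_forall fun ω => ?_)
  · exact (Integrable.of_bound hm B (Eventually.of_forall fun ω => hB N ω)).abs.const_mul B
  · simp only [Pi.pow_apply]
    rw [← sq_abs, sq]
    exact mul_le_mul_of_nonneg_right (hB N ω) (abs_nonneg _)

end Mean

/-! ### The main theorem -/

section Main

variable {d T : ℕ} {M : Model d}

/-- Positive densities make the filtering distributions charge open sets, hence nonzero, which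
forces `0 < Z < ∞`; the unit integral of `Gtilde` makes the backward kernels probabilities. Since
`G` may vanish, that these kernels charge open sets is deduced from strict monotonicity of their
Rosenblatt transforms. -/
theorem Model.regular_of_densities
    (h_dens : ∀ t ≤ T, ∃ p : Cube d → ℝ, Measurable p ∧ (∀ x, 0 < p x) ∧
      M.filt t = (lebesgue d).withDensity fun x => ENNReal.ofReal (p x))
    (hG : ∀ t, t + 1 ≤ T →
      (Continuous fun p : Cube d × Cube d => M.Gtilde (t + 1) (M.filt t) p.1 p.2) ∧
      ∃ B : ℝ, ∀ x' x, |M.Gtilde (t + 1) (M.filt t) x' x| ≤ B)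
    (hK : ∀ t, t + 1 ≤ T → ∃ K : Cube d → Cube d → Fin d → ℝ,
      (∀ x, IsRosenblatt (M.backKernel (t + 1) (M.filt t) x) (K x)) ∧ CoordStrictMono K) :
    M.Regular T := by
  have hpos : ∀ t ≤ T, (M.filt t).IsOpenPosMeasure := fun t ht => by
    obtain ⟨p, hp, hp0, he⟩ := h_dens t ht
    rw [he]
    exact isOpenPosMeasure_of_density hp hp0
  have hZ : ∀ t ≤ T, M.Z t ≠ 0 ∧ M.Z t ≠ ∞ := fun t ht => by
    have := hpos t ht
    refine M.Z_ne_of_filt_ne_zero fun h0 => ?_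
    have h1 := isOpen_univ.measure_ne_zero (M.filt t)
      (Set.univ_nonempty : (Set.univ : Set (Cube d)).Nonempty)
    simp [h0] at h1
  have hone : ∀ t, t + 1 ≤ T → ∀ y,
      ∫ x', M.Gtilde (t + 1) (M.filt t) x' y ∂M.filt t = 1 := fun t ht y => by
    obtain ⟨p, hp, hp0, he⟩ := h_dens (t + 1) ht
    obtain ⟨hc, B, hB⟩ := hG t ht
    have h1 := hZ t (Nat.le_of_succ_le ht)
    exact M.integral_Gtilde_eq_one h1.1 h1.2 (hZ _ ht).1 (hZ _ ht).2 hp hp0 he hc hB y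
  have hprob : ∀ t, t + 1 ≤ T → ∀ y,
      IsProbabilityMeasure (M.backKernel (t + 1) (M.filt t) y) := fun t ht y => by
    obtain ⟨hc, B, hB⟩ := hG t ht
    have h1 := hZ t (Nat.le_of_succ_le ht)
    have := M.isProbabilityMeasure_filt h1.1 h1.2
    have hcy : Continuous fun x' => M.Gtilde (t + 1) (M.filt t) x' y :=
      hc.comp (continuous_id.prodMk continuous_const)
    have hint : Integrable (fun x' => M.Gtilde (t + 1) (M.filt t) x' y) (M.filt t) :=
      Integrable.of_bound hcy.aestronglyMeasurable B (Eventually.of_forall fun x' => hB x' y)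
    constructor
    rw [Model.backKernel, withDensity_apply _ MeasurableSet.univ, Measure.restrict_univ,
      ← ofReal_integral_eq_lintegral_ofReal hint
        (Eventually.of_forall fun x' => M.Gtilde_nonneg _ _ _ _), hone t ht y, ENNReal.ofReal_one]
  refine ⟨fun t ht => (hZ t ht).1, fun t ht => (hZ t ht).2, fun t ht => ?_, hpos, fun t ht y => ?_,
    fun t ht => (hG t ht).1, fun t ht => (hG t ht).2, hprob, fun t ht y => ?_⟩
  · obtain ⟨p, -, -, he⟩ := h_dens t ht
    rw [he]
    exact withDensity_absolutelyContinuous _ _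
  -- With a zero normaliser, division by zero would make `Gtilde` vanish identically in `x'`, and
  -- its integral would be zero instead of one.
  · refine lt_of_le_of_ne (integral_nonneg fun x' => M.densG_nonneg _ _ _) fun h0 => ?_
    have h1 := hone t ht y
    simp only [Model.Gtilde, ← h0, div_zero, integral_zero] at h1
    exact zero_ne_one h1
  · obtain ⟨K, hR, hmono⟩ := hK t ht
    have := hprob t ht y
    exact (hR y).isOpenPosMeasure fun i x => hmono i y x

/-- If the discrepancies of the forward inputs tend to zero uniformly on a nonempty set `A`, then
on `A` the backward trajectories are uniformly close to their limits outside of a set of small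
measure. -/
theorem exists_uniform_backward (hM : M.Regular T) (hd : 1 ≤ d)
    {H : unitInterval → Fin d → unitInterval} (hH : IsHilbertCurve H)
    {h : (Fin d → unitInterval) → unitInterval} (hh : ∀ x, H (h x) = x) (hm : Measurable h)
    {F0 : Cube d → Fin d → ℝ} {F : ℕ → Cube d → Cube d → Fin d → ℝ}
    (hG0 : Continuous M.G0 ∧ ∃ B : ℝ, ∀ x, M.G0 x ≤ B)
    (hG : ∀ t, 1 ≤ t → t ≤ T → (Continuous fun p : Cube d × Cube d => M.G t p.1 p.2) ∧
      ∃ B : ℝ, ∀ x' x, M.G t x' x ≤ B)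
    (hT0 : Continuous (rosenblattInv F0)) (hmap0 : (lebesgue d).map (rosenblattInv F0) = M.m0)
    (hT : ∀ t, 1 ≤ t → t ≤ T →
      Continuous fun p : Cube d × Cube d => rosenblattInv (F t p.1) p.2)
    (hmap : ∀ t, 1 ≤ t → t ≤ T → ∀ x', (lebesgue d).map (rosenblattInv (F t x')) = M.m t x')
    {Ω : Type*} {u : (t : ℕ) → Ω → (N : ℕ) → Fin N → Cube (dimAt d t)} {A : Set Ω}
    (hA : A.Nonempty)
    (hu : ∀ t ≤ T, ∀ ε : ℝ, 0 < ε → ∃ N₀ : ℕ, ∀ ω ∈ A, ∀ N, N₀ ≤ N → discrepancy (u t ω N) ≤ ε)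
    {φ : (Fin (T + 1) → Cube d) → ℝ} (hφ : Continuous φ) {B : ℝ} (hB : ∀ x, |φ x| ≤ B)
    {ε : ℝ} (hε : 0 < ε) :
    ∃ K : Set (Cube (T + 1)), MeasurableSet K ∧ (lebesgue (T + 1)).real Kᶜ < ε ∧
      ∀ᶠ N : ℕ in atTop, ∀ ω ∈ A, ∀ (v : Fin N → Cube (T + 1)) (n : Fin N),
        |φ (backward M (fun x => h (toClosedCube x)) T
            (forward M (fun x => h (toClosedCube x)) F0 F (fun t => u t ω N)) v n) -
          φ (limitTrajectory M H h T (v n))| ≤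
        ε + 2 * B * Kᶜ.indicator (fun _ => (1 : ℝ)) (v n) := by
  -- Convergence along `l` is convergence in the sample size, uniformly in `ω ∈ A`; the
  -- deterministic limit theorems thus apply to all `ω` at once.
  let l : Filter (ℕ × Ω) := atTop ×ˢ 𝓟 A
  have hl : l.NeBot := prod_neBot.2 ⟨atTop_neBot, principal_neBot_iff.2 hA⟩
  -- The shift excludes empty point sets; it is undone by `n = m + 1` below.
  let N : ℕ × Ω → ℕ := fun i => i.1 + 1
  have hN : ∀ i, 0 < N i := fun i => Nat.succ_pos _
  let s : ∀ i, ℕ → (Fin (N i) → Cube d) × (Fin (N i) → ℝ) := fun i =>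
    forward M (fun x => h (toClosedCube x)) F0 F fun t => u t i.2 (N i)
  have hdisc : ∀ t ≤ T, Tendsto (fun i => discrepancy (u t i.2 (N i))) l (𝓝 0) := by
    intro t ht
    refine tendsto_order.2 ⟨fun c hc => Eventually.of_forall fun i => ?_, fun c hc => ?_⟩
    · exact hc.trans_le (Real.iSup_nonneg fun _ => abs_nonneg _)
    · obtain ⟨N₀, hN₀⟩ := hu t ht (c / 2) (half_pos hc)
      refine eventually_prod_principal_iff.2 ?_
      filter_upwards [eventually_ge_atTop N₀] with n hn ω hω
      exact (hN₀ ω hω (n + 1) (hn.trans (Nat.le_succ n))).trans_lt (half_lt_self hc)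
  have hs : ∀ t ≤ T, Approximates l (fun i => (s i t).1) (fun i => (s i t).2) (M.filt t) :=
    fun t ht => forward_approximates hM hd hH hh hm hG0 hG hT0 hmap0 hT hmap hN
      (u := fun i t => u t i.2 (N i)) hdisc ht
  have hlim := ae_tendsto_backPath hM hd hH hh hm hN hs
  have hsurj : Function.Surjective (Sigma.fst : (Σ i, Fin (N i)) → ℕ × Ω) :=
    fun i => ⟨⟨i, ⟨0, hN i⟩⟩, rfl⟩
  have hne : (comap (Sigma.fst : (Σ i, Fin (N i)) → ℕ × Ω) l).NeBot := hl.comap_of_surj hsurj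
  let g : (Σ i, Fin (N i)) → Cube (T + 1) → ℝ := fun j v =>
    φ (backPath M (fun x => h (toClosedCube x)) (s j.1) j.2 T
      (resample (fun x => (h (toClosedCube x) : ℝ)) (s j.1 T).1 (s j.1 T).2
        (v (Fin.last T)) j.2) (Fin.init v))
  have hB0 : 0 ≤ B := (abs_nonneg _).trans (hB fun _ _ => ⟨0, by simp⟩)
  obtain ⟨K, G, f, hK, hKε, hGK, -, hf, hev⟩ := exists_uniform_approx
    (μ := lebesgue (T + 1)) (l := comap (Sigma.fst : (Σ i, Fin (N i)) → ℕ × Ω) l) (g := g)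
    (g₀ := fun v => φ (limitTrajectory M H h T v)) hB0 (fun j e => hB _)
    (hlim.mono fun v hv => (hφ.tendsto _).comp hv) hε
  refine ⟨K, hK, hKε, ?_⟩
  obtain ⟨S, hS, hSg⟩ := mem_comap.1 hev
  have hS' := eventually_prod_principal_iff.1 hS
  obtain ⟨N₁, hN₁⟩ := eventually_atTop.1 hS'
  filter_upwards [eventually_ge_atTop (N₁ + 1)] with n hn ω hω v j
  obtain ⟨n, rfl⟩ : ∃ m, n = m + 1 := ⟨n - 1, by omega⟩
  have hmem := hSg (a := ⟨(n, ω), j⟩) (hN₁ n (by omega) ω hω) (v j)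
  -- On `K` the approximant `G` equals the limit and `f` vanishes; off `K` the bound `2 * B` is
  -- trivial.
  by_cases hv : v j ∈ K
  · obtain ⟨h1, h2⟩ := hGK _ hv
    rw [h1, h2] at hmem
    rw [Set.indicator_of_notMem (by simpa using hv)]
    exact hmem
  · have h1 := abs_sub (φ (backward M (fun x => h (toClosedCube x)) T
      (forward M (fun x => h (toClosedCube x)) F0 F (fun t => u t ω (n + 1))) v j))
      (φ (limitTrajectory M H h T (v j)))
    have h2 := hB (backward M (fun x => h (toClosedCube x)) T
      (forward M (fun x => h (toClosedCube x)) F0 F (fun t => u t ω (n + 1))) v j)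
    have h3 := hB (limitTrajectory M H h T (v j))
    simp only [Set.mem_compl_iff, hv, not_false_eq_true, Set.indicator_of_mem, mul_one]
    linarith

end Main

end SQMC
end

theorem mainTheorem7 {d T : ℕ} (hd : 1 ≤ d) (M : SQMC.Model d)
    -- a Hilbert curve and a measurable pseudo-inverse
    (H : unitInterval → Fin d → unitInterval) (hH : SQMC.IsHilbertCurve H)
    (h : (Fin d → unitInterval) → unitInterval) (hh : ∀ x, H (h x) = x) (hh_meas : Measurable h)
    -- Rosenblatt transforms of the initial distribution and of the transition kernels
    (F0 : SQMC.Cube d → Fin d → ℝ) (hF0 : SQMC.IsRosenblatt M.m0 F0)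
    (F : ℕ → SQMC.Cube d → SQMC.Cube d → Fin d → ℝ)
    (hF : ∀ t, 1 ≤ t → t ≤ T → ∀ x', SQMC.IsRosenblatt (M.m t x') (F t x'))
    {Ω : Type*} [MeasurableSpace Ω] (P : Measure Ω) [IsProbabilityMeasure P]
    -- forward inputs: independent random sequences of point sets, of vanishing discrepancy
    (u : (t : ℕ) → Ω → (N : ℕ) → Fin N → SQMC.Cube (SQMC.dimAt d t))
    (hu_meas : ∀ t ≤ T, Measurable (u t))
    (hu_indep : iIndepFun (fun t : Fin (T + 1) => u t) P)
    (hu_disc : ∀ t ≤ T, ∀ ε : ℝ, 0 < ε → ∃ N₀ : ℕ,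
      ∀ᵐ ω ∂P, ∀ N, N₀ ≤ N → SQMC.discrepancy (u t ω N) ≤ ε)
    -- backward inputs: marginally uniform, with a variance bound
    (ub : Ω → (N : ℕ) → Fin N → SQMC.Cube (T + 1)) (hub_meas : Measurable ub)
    (hub_unif : ∀ (N : ℕ) (n : Fin N), P.map (fun ω => ub ω N n) = SQMC.lebesgue (T + 1))
    (C : ℝ) (r : ℕ → ℝ) (hr : Tendsto r atTop (𝓝 0))
    (hub_var : ∀ ψ : SQMC.Cube (T + 1) → ℝ, MemLp ψ 2 (SQMC.lebesgue (T + 1)) → ∀ N : ℕ, 1 ≤ N →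
      variance (fun ω => (1 / (N : ℝ)) * ∑ n, ψ (ub ω N n)) P
        ≤ C * (∫ v, (ψ v - ∫ w, ψ w ∂SQMC.lebesgue (T + 1)) ^ 2 ∂SQMC.lebesgue (T + 1)) * r N)
    -- the particles are almost surely pairwise distinct
    (h_distinct : ∀ᵐ ω ∂P, ∀ N : ℕ, ∀ t ≤ T, Function.Injective
      (SQMC.forward M (fun x => h (SQMC.toClosedCube x)) F0 F (fun s => u s ω N) t).1)
    -- the potential functions are continuous and bounded
    (hG0 : Continuous M.G0 ∧ ∃ B : ℝ, ∀ x, M.G0 x ≤ B)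
    (hG : ∀ t, 1 ≤ t → t ≤ T → (Continuous fun p : SQMC.Cube d × SQMC.Cube d => M.G t p.1 p.2) ∧
      ∃ B : ℝ, ∀ x' x, M.G t x' x ≤ B)
    -- regularity of the Rosenblatt transforms
    (hF0_reg : SQMC.CoordStrictMono (fun _ => F0) ∧ SQMC.JointlyHolder (fun _ => F0) ∧
      SQMC.BoundedCondDensities (fun _ => F0))
    (hF_reg : ∀ t, 1 ≤ t → t ≤ T → SQMC.CoordStrictMono (F t) ∧ SQMC.JointlyHolder (F t) ∧
      SQMC.BoundedCondDensities (F t))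
    -- the filtering distributions have strictly positive bounded densities
    (h_dens : ∀ t ≤ T, ∃ p : SQMC.Cube d → ℝ, Measurable p ∧ (∀ x, 0 < p x) ∧
      (∃ B : ℝ, ∀ x, p x ≤ B) ∧ M.filt t = (SQMC.lebesgue d).withDensity fun x => ENNReal.ofReal (p x))
    -- the functions `G̃_t` are continuous and bounded
    (hH1 : ∀ t, t + 1 ≤ T →
      (Continuous fun p : SQMC.Cube d × SQMC.Cube d => M.Gtilde (t + 1) (M.filt t) p.1 p.2) ∧
      ∃ B : ℝ, ∀ x' x, |M.Gtilde (t + 1) (M.filt t) x' x| ≤ B)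
    -- regularity of the Rosenblatt transforms of the backward kernels
    (hH2 : ∀ t, t + 1 ≤ T → ∃ K : SQMC.Cube d → SQMC.Cube d → Fin d → ℝ,
      (∀ x, SQMC.IsRosenblatt (M.backKernel (t + 1) (M.filt t) x) (K x)) ∧
      SQMC.CoordStrictMono K ∧ SQMC.JointlyHolder K)
    (φ : (Fin (T + 1) → SQMC.Cube d) → ℝ) (hφ : Continuous φ) (hφ_bdd : ∃ B : ℝ, ∀ x, |φ x| ≤ B) :
    let est : ℕ → Ω → ℝ := fun N ω =>
      SQMC.estimate M (fun x => h (SQMC.toClosedCube x)) F0 F T φ (fun t => u t ω N) (ub ω N)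
    (∀ N, MemLp (est N) 2 P) ∧
    Tendsto (fun N => ∫ ω, |est N ω - ∫ x, φ x ∂M.smooth T| ∂P) atTop (𝓝 0) ∧
    Tendsto (fun N => variance (est N) P) atTop (𝓝 0) := by
  intro est
  have hF0' := SQMC.continuous_rosenblattInv (π := fun _ => M.m0) (fun _ => M.prob_m0)
    (fun _ => hF0) hF0_reg.1 hF0_reg.2.1 hF0_reg.2.2
  -- `F0` is treated as a family that is constant in its parameter; `x₀` is a dummy value of that
  -- parameter.
  have x₀ : SQMC.Cube d := fun _ => ⟨0, by simp⟩
  have hT0 : Continuous (SQMC.rosenblattInv F0) :=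
    hF0'.comp (continuous_const.prodMk continuous_id (f := fun _ => x₀))
  have hmap0 : (SQMC.lebesgue d).map (SQMC.rosenblattInv F0) = M.m0 :=
    SQMC.map_rosenblattInv (π := fun _ => M.m0) (fun _ => M.prob_m0)
      (fun _ => hF0) hF0_reg.1 hF0_reg.2.1 hF0_reg.2.2 x₀
  have hprob : ∀ t x', IsProbabilityMeasure (M.m t x') := fun t x' =>
    (M.markov_m t).isProbabilityMeasure x'
  have hT : ∀ t, 1 ≤ t → t ≤ T →
      Continuous fun p : SQMC.Cube d × SQMC.Cube d => SQMC.rosenblattInv (F t p.1) p.2 :=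
    fun t h1 h2 => SQMC.continuous_rosenblattInv (hprob t) (hF t h1 h2) (hF_reg t h1 h2).1
      (hF_reg t h1 h2).2.1 (hF_reg t h1 h2).2.2
  have hmap : ∀ t, 1 ≤ t → t ≤ T → ∀ x',
      (SQMC.lebesgue d).map (SQMC.rosenblattInv (F t x')) = M.m t x' :=
    fun t h1 h2 => SQMC.map_rosenblattInv (hprob t) (hF t h1 h2) (hF_reg t h1 h2).1
      (hF_reg t h1 h2).2.1 (hF_reg t h1 h2).2.2
  have hM : M.Regular T := SQMC.Model.regular_of_densities
    (fun t ht => by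
      obtain ⟨p, hp, hp0, -, he⟩ := h_dens t ht
      exact ⟨p, hp, hp0, he⟩) hH1
    (fun t ht => by
      obtain ⟨K, hR, hmono, -⟩ := hH2 t ht
      exact ⟨K, hR, hmono⟩)
  obtain ⟨B, hB⟩ := hφ_bdd
  have hB0 : 0 ≤ B := (abs_nonneg _).trans (hB fun _ => x₀)
  have hk : Measurable fun x : SQMC.Cube d => (h (SQMC.toClosedCube x) : ℝ) :=
    measurable_subtype_coe.comp (hh_meas.comp SQMC.continuous_toClosedCube.measurable)
  set g : (N : ℕ) → Ω → Fin N → ℝ := fun N ω n =>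
    φ (SQMC.backward M (fun x => h (SQMC.toClosedCube x)) T
      (SQMC.forward M (fun x => h (SQMC.toClosedCube x)) F0 F (fun t => u t ω N)) (ub ω N) n)
    with hg
  have hub : ∀ (N : ℕ) (n : Fin N), Measurable fun ω => ub ω N n := fun N n =>
    (measurable_pi_apply n).comp ((measurable_pi_apply N).comp hub_meas)
  have hgm : ∀ (N : ℕ) (n : Fin N), Measurable fun ω => g N ω n := by
    intro N n
    refine hφ.measurable.comp (SQMC.measurable_backward hk (fun t ht =>
      SQMC.measurable_forward hk hT0.measurable (fun t h1 h2 => (hT t h1 h2).measurable)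
        (fun t ht n => ?_) ht) (hub N) n)
    exact (measurable_pi_apply n).comp ((measurable_pi_apply N).comp (hu_meas t ht))
  have hest : ∀ N ω, est N ω = (1 / (N : ℝ)) * ∑ n, g N ω n := fun N ω =>
    SQMC.integral_empirical _ hφ
  have hestm : ∀ N, Measurable (est N) := fun N => by
    have h1 : est N = fun ω => (1 / (N : ℝ)) * ∑ n, g N ω n := funext (hest N)
    rw [h1]
    exact (Finset.measurable_sum _ fun n _ => hgm N n).const_mul _
  have hestB : ∀ N ω, |est N ω| ≤ B := fun N ω => by
    rw [hest, abs_mul, abs_of_nonneg (by positivity : (0 : ℝ) ≤ 1 / N)]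
    -- The average over no points is zero.
    rcases Nat.eq_zero_or_pos N with rfl | hN
    · simpa using hB0
    · have h1 : ∑ n, |g N ω n| ≤ ∑ _n : Fin N, B := Finset.sum_le_sum fun n _ => hB _
      have h2 : |∑ n, g N ω n| ≤ N * B := by
        refine (Finset.abs_sum_le_sum_abs _ _).trans (h1.trans (le_of_eq ?_))
        simp
      have hN' : (0 : ℝ) < N := Nat.cast_pos.2 hN
      rw [one_div, inv_mul_le_iff₀ hN']
      exact h2
  have hsm := M.isProbabilityMeasure_smooth (hM.Z_ne_zero T le_rfl) (hM.Z_ne_top T le_rfl)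
  set ψ : SQMC.Cube (T + 1) → ℝ := fun v => φ (SQMC.limitTrajectory M H h T v) with hψ
  have hlt := hM.measurable_limitTrajectory hH.continuous hh_meas
  have hψm : Measurable ψ := hφ.measurable.comp hlt
  have hψint : ∫ v, ψ v ∂SQMC.lebesgue (T + 1) = ∫ x, φ x ∂M.smooth T := by
    rw [← hM.map_limitTrajectory hH.continuous hh hh_meas,
      integral_map hlt.aemeasurable hφ.measurable.aestronglyMeasurable]
  choose! N₀ hN₀ using hu_disc
  -- Countably many tolerances `1 / (k + 1)` keep this an almost sure condition, and the thresholds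
  -- `N₀` do not depend on `ω`, so the discrepancies vanish uniformly on `A`.
  set A : Set Ω := {ω | ∀ t ≤ T, ∀ k : ℕ, ∀ N, N₀ t (1 / ((k : ℝ) + 1)) ≤ N →
    SQMC.discrepancy (u t ω N) ≤ 1 / ((k : ℝ) + 1)} with hA
  have hAae : ∀ᵐ ω ∂P, ω ∈ A := by
    have h1 : ∀ᵐ ω ∂P, ∀ t : ℕ, ∀ k : ℕ, t ≤ T → ∀ N, N₀ t (1 / ((k : ℝ) + 1)) ≤ N →
        SQMC.discrepancy (u t ω N) ≤ 1 / ((k : ℝ) + 1) := by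
      refine ae_all_iff.2 fun t => ae_all_iff.2 fun k => ?_
      by_cases ht : t ≤ T
      · filter_upwards [hN₀ t ht (1 / ((k : ℝ) + 1)) (by positivity)] with ω hω _
        exact hω
      · exact Eventually.of_forall fun ω h2 => absurd h2 ht
    filter_upwards [h1] with ω hω t ht k
    exact hω t k ht
  have hAne : A.Nonempty := hAae.exists
  have hudisc : ∀ t ≤ T, ∀ ε : ℝ, 0 < ε → ∃ N₁ : ℕ, ∀ ω ∈ A, ∀ N, N₁ ≤ N →
      SQMC.discrepancy (u t ω N) ≤ ε := by
    intro t ht ε hε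
    obtain ⟨k, hk⟩ := exists_nat_one_div_lt hε
    exact ⟨_, fun ω hω N hN => (hω t ht k N hN).trans hk.le⟩
  have hav := SQMC.tendsto_integral_abs_average (P := P) hub hub_unif hψm (fun v => hB _)
    (r := fun N => C * (∫ v, (ψ v - ∫ w, ψ w ∂SQMC.lebesgue (T + 1)) ^ 2
      ∂SQMC.lebesgue (T + 1)) * r N) (by simpa using hr.const_mul _)
    (fun N hN => hub_var ψ (MemLp.of_bound hψm.aestronglyMeasurable B
      (Eventually.of_forall fun v => hB _)) N hN)
  have hdiff := SQMC.tendsto_integral_abs_sub_average (P := P) hub hub_unif (ψ := ψ)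
    (B := 2 * B) (by positivity) (g := g) (fun ε hε => by
      obtain ⟨K, hK, hKε, hev⟩ := SQMC.exists_uniform_backward hM hd hH hh hh_meas hG0 hG hT0 hmap0
        hT hmap hAne hudisc hφ hB hε
      refine ⟨K, hK, hKε, hev.mono fun N hN => ?_⟩
      filter_upwards [hAae] with ω hω n
      exact hN ω hω (ub ω N) n)
  have hmain : Tendsto (fun N => ∫ ω, |est N ω - ∫ x, φ x ∂M.smooth T| ∂P) atTop (𝓝 0) := by
    -- The triangle inequality goes through the average of `ψ`, that is, of `φ` along the limit
    -- trajectories of the backward points.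
    have hsum := hdiff.add hav
    rw [add_zero] at hsum
    refine squeeze_zero (fun N => integral_nonneg fun ω => abs_nonneg _) (fun N => ?_) hsum
    have hψavg : Measurable fun ω => (1 / (N : ℝ)) * ∑ n, ψ (ub ω N n) :=
      (Finset.measurable_sum _ fun n _ => hψm.comp (hub N n)).const_mul _
    have hψi : Integrable (fun ω => (1 / (N : ℝ)) * ∑ n, ψ (ub ω N n)) P :=
      (integrable_finsetSum _ fun n _ => Integrable.of_bound
        (hψm.comp (hub N n)).aestronglyMeasurable B
        (Eventually.of_forall fun ω => hB _)).const_mul _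
    have hgi : Integrable (fun ω => (1 / (N : ℝ)) * ∑ n, g N ω n) P :=
      (integrable_finsetSum _ fun n _ => Integrable.of_bound
        (hgm N n).aestronglyMeasurable B (Eventually.of_forall fun ω => hB _)).const_mul _
    have hi1 : Integrable (fun ω => |(1 / (N : ℝ)) * ∑ n, g N ω n -
        (1 / (N : ℝ)) * ∑ n, ψ (ub ω N n)|) P := (hgi.sub hψi).abs
    have hi2 : Integrable (fun ω => |(1 / (N : ℝ)) * ∑ n, ψ (ub ω N n) -
        ∫ v, ψ v ∂SQMC.lebesgue (T + 1)|) P := (hψi.sub (integrable_const _)).abs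
    rw [← integral_add hi1 hi2]
    refine integral_mono_of_nonneg (Eventually.of_forall fun ω => abs_nonneg _) (hi1.add hi2)
      (Eventually.of_forall fun ω => ?_)
    simp only [hest, ← hψint]
    exact abs_sub_le _ _ _
  have hQ : |∫ x, φ x ∂M.smooth T| ≤ B := by
    have := norm_integral_le_of_norm_le_const (μ := M.smooth T) (f := φ) (C := B)
      (Eventually.of_forall hB)
    simpa using this
  refine ⟨fun N => MemLp.of_bound (hestm N).aestronglyMeasurable B
    (Eventually.of_forall (hestB N)), hmain, ?_⟩
  exact SQMC.tendsto_variance_of_tendsto_integral_abs (fun N => (hestm N).aestronglyMeasurable)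
    (B := B + B) (fun N ω => (abs_sub _ _).trans (add_le_add (hestB N ω) hQ)) hmain
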